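/- **Setting.** Let $0<\gamma\le 1$. A function $F:[0,1]^n\to\mathbb{R}_{\ge 0}$ is *$\gamma$-weakly DR-submodular* if $F(x+c\,e_i)-F(x)\ge\gamma\,(F(y+c\,e_i)-F(y))$ for all $x\le y$ (coordinatewise) in $[0,1]^n$, all $i$ and all $c>0$ with $x+c\,e_i,\,y+c\,e_i\in[0,1]^n$. It is *$L$-smooth* if it is differentiable on $[0,1]^n$ with $\|\nabla F(x)-\nabla F(y)\|_2\le L\|x-y\|_2$ for all $x,y\in[0,1]^n$. A convex body $P\subseteq[0,1]^n$ (compact, convex, nonempty interior) is *down-closed* if $y\in P$ and $0\le x\le y$ imply $x\in P$, and *meta-solvable* if linear functions can be maximized over the points of $P$ that satisfy one additional linear inequality (or the absence of such points reported); every such optimization is one oracle call. An *algorithm* is a program, the same for all $n$, of a real random access machine: natural-number, real and vector memory with indirect addressing; unit-cost addition and truncated subtraction of natural numbers; unit-cost arithmetic and comparison of reals, with rational constants; and unit-cost oracle calls for the values and gradients of $F$ and for linear optimization over $P$ as above. It is given $n$, $\gamma$ and $\delta$; it is not given $L$ or the diameter of $P$. **Coefficients.** For $0<\gamma<1$, $t\in(0,1)$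 and $r\ge 0$ put $$A_\gamma(t)=-\frac{e^{\gamma t-\gamma}}{1-\gamma}+\frac{e^{-\gamma^2}}{\gamma(1-\gamma)}\bigl(e^{\gamma^2t}-(1-\gamma)\bigr),\qquad B_\gamma(t)=\frac{e^{-\gamma}-e^{\gamma t-\gamma}}{\gamma},$$ $$\begin{aligned}C_\gamma(t)={}&\frac{e^{\gamma^2t}-1}{\gamma(1-\gamma)}\bigl(e^{-\gamma(1-t)-\gamma^2t}-e^{-\gamma^2}\bigr)+\frac{e^{-\gamma(1-t)}}{\gamma}\Bigl[(e^{-\gamma t}-1)+\frac{e^{-\gamma^2t}-e^{-\gamma t}}{1-\gamma}\Bigr]\\&+e^{-\gamma(1-t)-\gamma^2t}\Bigl[\frac{\gamma^2}{1-\gamma}(1-t)e^{\gamma(1-\gamma)(1-t)}+\frac{\gamma}{(1-\gamma)^2}\bigl(1-e^{\gamma(1-\gamma)(1-t)}\bigr)\Bigr],\end{aligned}$$ $$D_\gamma(r)=\frac{2\gamma^{3/2}r+\frac{\gamma}{1+\gamma^2}r^2}{r^2+2\gamma^{3/2}r+1},\qquad E_\gamma(r)=\frac{\frac{\gamma^2}{1+\gamma^2}r^2}{r^2+2\gamma^{3/2}r+1}.$$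 For $\gamma=1$ let $A_1,B_1,C_1,D_1,E_1$ be the limits for $\gamma\to1$; thus $A_1(t)=e^{t-1}(2-t)-e^{-1}$ and $C_1(t)=e^{-1}\bigl(2-2e^t+te^t+\tfrac12(1-t)^2\bigr)$. Let $$\Phi_\gamma=\sup\bigl\{(1-\alpha)A_\gamma(t)\bigr\}$$ over all $(\alpha,r,t)\in[0,1]\times[0,\infty)\times(0,1)$ with $(1-\alpha)B_\gamma(t)+\alpha D_\gamma(r)\ge0$ and $(1-\alpha)C_\gamma(t)+\alpha E_\gamma(r)\ge0$. **Theorem.** For every $\gamma\in(0,1]$ there is a constant $C>0$, depending only on $\gamma$, such that the following holds. 1. For every $\delta\in(0,1)$ there is an algorithm that, for every $n$, every nonnegative, $L$-smooth, $\gamma$-weakly DR-submodular $F:[0,1]^n\to\mathbb{R}_{\ge0}$ and every down-closed, meta-solvable convex body $P\subseteq[0,1]^n$ of Euclidean diameter $D$, returns after a number of steps polynomial in $n$ (the polynomial depending on $\gamma,\delta$ only) a point $x\in P$ with $$F(x)\ \ge\ \Phi_\gamma\cdot\max_{y\in P}F(y)-C\,\delta D^2L.$$ 2. For every $\varepsilon>0$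 there is a single algorithm that, for every $\delta\in(0,1)$ and every $n,F,P$ as in 1, returns after a number of steps polynomial in $n$ and $\delta^{-1}$ (the polynomial depending on $\gamma,\varepsilon$ only) a point $x\in P$ with $$F(x)\ \ge\ (\Phi_\gamma-\varepsilon)\max_{y\in P}F(y)-C\,\delta D^2L.$$ Moreover $\Phi_\gamma>\gamma e^{-\gamma}$ for all $\gamma\in(0,1)$, and $0.401\le\Phi_1<0.402$. -/

import Mathlib

noncomputable section

namespace WeakDR

open Filter Topology

/-! ## Geometry of the cube and the objective functions -/

/-- Euclidean `n`-space. -/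
abbrev Vec (n : ℕ) : Type := EuclideanSpace ℝ (Fin n)

/-- The cube `[0,1]^n`. -/
def cube (n : ℕ) : Set (Vec n) := {x | ∀ i, 0 ≤ x i ∧ x i ≤ 1}

/-- `F` is `γ`-weakly DR-submodular on `[0,1]^n`. -/
def IsWeaklyDRSubmodular {n : ℕ} (γ : ℝ) (F : Vec n → ℝ) : Prop :=
  ∀ x ∈ cube n, ∀ y ∈ cube n, (∀ i, x i ≤ y i) → ∀ (i : Fin n) (c : ℝ), 0 < c →
    x + EuclideanSpace.single i c ∈ cube n → y + EuclideanSpace.single i c ∈ cube n →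
    γ * (F (y + EuclideanSpace.single i c) - F y) ≤ F (x + EuclideanSpace.single i c) - F x

/-- `F` is differentiable on `[0,1]^n` with gradient `G` (one-sided at the boundary), and `G` is
`L`-Lipschitz on `[0,1]^n` for the Euclidean norm. -/
def IsSmoothWithGradient {n : ℕ} (L : ℝ) (F : Vec n → ℝ) (G : Vec n → Vec n) : Prop :=
  (∀ x ∈ cube n, HasGradientWithinAt F (G x) (cube n) x) ∧
    ∀ x ∈ cube n, ∀ y ∈ cube n, ‖G x - G y‖ ≤ L * ‖x - y‖

/-- `P` is a convex body: compact, convex, with nonempty interior. -/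
def IsConvexBody {n : ℕ} (P : Set (Vec n)) : Prop :=
  IsCompact P ∧ Convex ℝ P ∧ (interior P).Nonempty

/-- `P` is down-closed. -/
def IsDownClosed {n : ℕ} (P : Set (Vec n)) : Prop :=
  ∀ y ∈ P, ∀ x : Vec n, (∀ i, 0 ≤ x i ∧ x i ≤ y i) → x ∈ P

/-- `lin c a b` maximizes the linear function `⟨c, ·⟩` over the points of `P` that satisfy the one
additional linear constraint `b ≤ ⟨a, ·⟩`, and answers `none` if there is no such point.
With `a = 0` and `b = 0` this is linear optimization over `P` itself. -/
def IsMetaSolver {n : ℕ} (P : Set (Vec n)) (lin : Vec n → Vec n → ℝ → Option (Vec n)) : Prop :=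
  ∀ (c a : Vec n) (b : ℝ),
    (lin c a b = none → ∀ y ∈ P, inner ℝ a y < b) ∧
    ∀ x, lin c a b = some x →
      x ∈ P ∧ b ≤ inner ℝ a x ∧ ∀ y ∈ P, b ≤ inner ℝ a y → inner ℝ c y ≤ inner ℝ c x

/-! ## The coefficients and the approximation factor -/

/-- The coefficient `A_γ(t)`; the value at `γ = 1` is the limit for `γ → 1`. -/
def coefA (γ t : ℝ) : ℝ :=
  if γ = 1 then Real.exp (t - 1) * (2 - t) - Real.exp (-1)
  else
    -(Real.exp (γ * t - γ) / (1 - γ)) +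
      Real.exp (-γ ^ 2) / (γ * (1 - γ)) * (Real.exp (γ ^ 2 * t) - (1 - γ))

/-- The coefficient `B_γ(t)`. -/
def coefB (γ t : ℝ) : ℝ := (Real.exp (-γ) - Real.exp (γ * t - γ)) / γ

/-- The coefficient `C_γ(t)`; the value at `γ = 1` is the limit for `γ → 1`. -/
def coefC (γ t : ℝ) : ℝ :=
  if γ = 1 then
    Real.exp (-1) * (2 - 2 * Real.exp t + t * Real.exp t + (1 - t) ^ 2 / 2)
  else
    (Real.exp (γ ^ 2 * t) - 1) / (γ * (1 - γ)) *
        (Real.exp (-γ * (1 - t) - γ ^ 2 * t) - Real.exp (-γ ^ 2)) +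
      Real.exp (-γ * (1 - t)) / γ *
        ((Real.exp (-γ * t) - 1) +
          (Real.exp (-γ ^ 2 * t) - Real.exp (-γ * t)) / (1 - γ)) +
      Real.exp (-γ * (1 - t) - γ ^ 2 * t) *
        (γ ^ 2 / (1 - γ) * (1 - t) * Real.exp (γ * (1 - γ) * (1 - t)) +
          γ / (1 - γ) ^ 2 * (1 - Real.exp (γ * (1 - γ) * (1 - t))))

/-- `coefA 1 t` is the limit of `coefA γ t` for `γ → 1`. -/
theorem tendsto_coefA (t : ℝ) : Tendsto (fun γ => coefA γ t) (𝓝[≠] 1) (𝓝 (coefA 1 t)) := by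
  have h1 : HasDerivAt (fun γ : ℝ => Real.exp (γ ^ 2 * (t - 1)) - γ * Real.exp (γ * (t - 1)))
      (Real.exp (t - 1) * (t - 2)) 1 := by
    have := ((((hasDerivAt_id' (1 : ℝ)).pow 2).mul_const (t - 1)).exp).sub
      ((hasDerivAt_id' (1 : ℝ)).mul ((hasDerivAt_id' (1 : ℝ)).mul_const (t - 1)).exp)
    refine this.congr_deriv ?_
    norm_num
    ring
  have h2 := hasDerivAt_iff_tendsto_slope.1 h1
  have h3 : Tendsto (fun γ : ℝ => Real.exp (-γ ^ 2) / γ) (𝓝[≠] 1) (𝓝 (Real.exp (-1))) := by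
    have : ContinuousAt (fun γ : ℝ => Real.exp (-γ ^ 2) / γ) 1 := by
      apply ContinuousAt.div <;> first | fun_prop | simp
    simpa using this.tendsto.mono_left nhdsWithin_le_nhds
  have h4 : Tendsto (fun γ : ℝ => γ⁻¹) (𝓝[≠] 1) (𝓝 1) := by
    simpa using (continuousAt_inv₀ (one_ne_zero (α := ℝ))).tendsto.mono_left nhdsWithin_le_nhds
  have h5 := ((h2.mul h4).neg).sub h3
  have h6 : coefA 1 t = -(Real.exp (t - 1) * (t - 2) * 1) - Real.exp (-1) := by
    simp [coefA]; ring
  rw [h6]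
  refine h5.congr' ?_
  have h7 : ∀ᶠ γ : ℝ in 𝓝[≠] 1, γ ≠ 0 :=
    nhdsWithin_le_nhds (isOpen_ne.mem_nhds one_ne_zero)
  filter_upwards [self_mem_nhdsWithin, h7] with γ h8 h9
  have h8' : γ ≠ 1 := h8
  have h10 : γ - 1 ≠ 0 := sub_ne_zero.2 h8'
  have h11 : 1 - γ ≠ 0 := sub_ne_zero.2 h8'.symm
  have e1 : Real.exp (γ * (t - 1)) = Real.exp (γ * t - γ) := by congr 1; ring
  have e2 : Real.exp (γ ^ 2 * (t - 1)) = Real.exp (-γ ^ 2) * Real.exp (γ ^ 2 * t) := by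
    rw [← Real.exp_add]; congr 1; ring
  simp only [coefA, if_neg h8', slope_def_field, e1, e2]
  have e3 : (1 : ℝ) ^ 2 * (t - 1) = 1 * (t - 1) := by ring
  have e4 : (γ - 1)= -(1 - γ) := by ring
  simp only [e4]
  norm_num
  field_simp
  ring_nf

/-- `coefC 1 t` is the limit of `coefC γ t` for `γ → 1`. -/
theorem tendsto_coefC (t : ℝ) : Tendsto (fun γ => coefC γ t) (𝓝[≠] 1) (𝓝 (coefC 1 t)) := by
  have key : ∀ f : ℝ → ℝ, ContinuousAt f 1 → Tendsto f (𝓝[≠] 1) (𝓝 (f 1)) :=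
    fun f hf => hf.tendsto.mono_left nhdsWithin_le_nhds
  have h7 : ∀ᶠ γ : ℝ in 𝓝[≠] 1, γ ≠ 0 :=
    nhdsWithin_le_nhds (isOpen_ne.mem_nhds one_ne_zero)
  have h1 : HasDerivAt (fun γ : ℝ => Real.exp (-γ * (1 - t) - γ ^ 2 * t) - Real.exp (-γ ^ 2))
      (Real.exp (-1) * (1 - t)) 1 := by
    have := ((((hasDerivAt_id' (1 : ℝ)).neg.mul_const (1 - t)).sub
      (((hasDerivAt_id' (1 : ℝ)).pow 2).mul_const t)).exp).sub
      (((hasDerivAt_id' (1 : ℝ)).pow 2).neg.exp)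
    refine this.congr_deriv ?_
    norm_num
    ring_nf
  have h2 : HasDerivAt (fun γ : ℝ => Real.exp (-γ ^ 2 * t) - Real.exp (-γ * t))
      (-(t * Real.exp (-t))) 1 := by
    have := ((((hasDerivAt_id' (1 : ℝ)).pow 2).neg.mul_const t).exp).sub
      (((hasDerivAt_id' (1 : ℝ)).neg.mul_const t).exp)
    refine this.congr_deriv ?_
    norm_num
    ring_nf
  have h1' := hasDerivAt_iff_tendsto_slope.1 h1
  have h2' := hasDerivAt_iff_tendsto_slope.1 h2
  have hg : Tendsto (fun u : ℝ => (u * Real.exp u + 1 - Real.exp u) / u ^ 2) (𝓝[≠] 0)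
      (𝓝 (1 / 2)) := by
    apply HasDerivAt.lhopital_zero_nhdsNE (f' := fun u => u * Real.exp u) (g' := fun u => 2 * u)
    · filter_upwards with u
      have := ((((hasDerivAt_id' u).mul (Real.hasDerivAt_exp u)).add_const 1).sub
        (Real.hasDerivAt_exp u))
      refine this.congr_deriv ?_
      ring
    · filter_upwards with u
      simpa using hasDerivAt_pow 2 u
    · filter_upwards [self_mem_nhdsWithin] with u hu
      exact mul_ne_zero two_ne_zero hu
    · have : ContinuousAt (fun u : ℝ => u * Real.exp u + 1 - Real.exp u) 0 := by fun_prop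
      simpa using this.tendsto.mono_left nhdsWithin_le_nhds
    · have : ContinuousAt (fun u : ℝ => u ^ 2) 0 := by fun_prop
      simpa using this.tendsto.mono_left nhdsWithin_le_nhds
    · have : ContinuousAt (fun u : ℝ => Real.exp u / 2) 0 := by fun_prop
      have h := this.tendsto.mono_left (nhdsWithin_le_nhds (s := {0}ᶜ))
      simp only [Real.exp_zero] at h
      refine h.congr' ?_
      filter_upwards [self_mem_nhdsWithin] with u hu
      have hu' : u ≠ 0 := hu
      field_simp
  have h3 : Tendsto (fun γ : ℝ => γ ^ 2 / (1 - γ) * (1 - t) * Real.exp (γ * (1 - γ) * (1 - t)) +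
          γ / (1 - γ) ^ 2 * (1 - Real.exp (γ * (1 - γ) * (1 - t)))) (𝓝[≠] 1)
          (𝓝 ((1 - t) ^ 2 / 2)) := by
    by_cases hs : 1 - t = 0
    · simp [hs]
    have hu : Tendsto (fun γ : ℝ => γ * (1 - γ) * (1 - t)) (𝓝[≠] 1) (𝓝[≠] 0) := by
      apply tendsto_nhdsWithin_of_tendsto_nhds_of_eventually_within
      · simpa using key (fun γ : ℝ => γ * (1 - γ) * (1 - t)) (by fun_prop)
      · filter_upwards [self_mem_nhdsWithin, h7] with γ h8 h9
        have h8' : γ ≠ 1 := h8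
        exact mul_ne_zero (mul_ne_zero h9 (sub_ne_zero.2 h8'.symm)) hs
    have h4 := (hg.comp hu).mul (key (fun γ : ℝ => γ ^ 3 * (1 - t) ^ 2) (by fun_prop))
    have e : 1 / 2 * ((1 : ℝ) ^ 3 * (1 - t) ^ 2) = (1 - t) ^ 2 / 2 := by ring
    rw [e] at h4
    refine h4.congr' ?_
    filter_upwards [self_mem_nhdsWithin, h7] with γ h8 h9
    have h8' : γ ≠ 1 := h8
    have h11 : 1 - γ ≠ 0 := sub_ne_zero.2 h8'.symm
    simp only [Function.comp]
    field_simp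
    ring
  have c1 := key (fun γ : ℝ => (Real.exp (γ ^ 2 * t) - 1) / γ) (by
    apply ContinuousAt.div <;> first | fun_prop | simp)
  have c2 := key (fun γ : ℝ => Real.exp (-γ * (1 - t)) / γ) (by
    apply ContinuousAt.div <;> first | fun_prop | simp)
  have c3 := key (fun γ : ℝ => Real.exp (-γ * t) - 1) (by fun_prop)
  have c4 := key (fun γ : ℝ => Real.exp (-γ * (1 - t) - γ ^ 2 * t)) (by fun_prop)
  have h5 := ((c1.mul h1'.neg).add (c2.mul (c3.add h2'.neg))).add (c4.mul h3)
  have h6 : coefC 1 t = (Real.exp (1 ^ 2 * t) - 1) / 1 * -(Real.exp (-1) * (1 - t)) +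
      Real.exp (-1 * (1 - t)) / 1 * (Real.exp (-1 * t) - 1 + - -(t * Real.exp (-t))) +
      Real.exp (-1 * (1 - t) - 1 ^ 2 * t) * ((1 - t) ^ 2 / 2) := by
    have e1 : Real.exp (-1 * (1 - t)) = Real.exp (-1) * Real.exp t := by
      rw [← Real.exp_add]; congr 1; ring
    have e2 : Real.exp (-1 * (1 - t) - 1 ^ 2 * t) = Real.exp (-1) := by congr 1; ring
    have e3 : Real.exp t * Real.exp (-t) = 1 := by rw [← Real.exp_add]; simp
    rw [e1, e2]
    simp only [coefC, if_true, one_pow, one_mul, neg_one_mul, div_one, neg_neg]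
    linear_combination (-Real.exp (-1) * (1 + t)) * e3
  rw [h6]
  refine h5.congr' ?_
  filter_upwards [self_mem_nhdsWithin, h7] with γ h8 h9
  have h8' : γ ≠ 1 := h8
  have h11 : 1 - γ ≠ 0 := sub_ne_zero.2 h8'.symm
  have e4 : (γ - 1) = -(1 - γ) := by ring
  have e5 : Real.exp (-1 * (1 - t) - 1 ^ 2 * t) - Real.exp (-1 ^ 2) = 0 := by
    rw [sub_eq_zero]; congr 1; ring
  have e6 : Real.exp (-1 ^ 2 * t) - Real.exp (-1 * t) = 0 := by
    rw [sub_eq_zero]; congr 1; ring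
  simp only [coefC, if_neg h8', slope_def_field, e4, e5, e6, sub_zero, div_neg, neg_neg]
  congr 2
  field_simp

/-- The coefficient `D_γ(r)`. -/
def coefD (γ r : ℝ) : ℝ :=
  (2 * γ ^ (3 / 2 : ℝ) * r + γ / (1 + γ ^ 2) * r ^ 2) / (r ^ 2 + 2 * γ ^ (3 / 2 : ℝ) * r + 1)

/-- The coefficient `E_γ(r)`. -/
def coefE (γ r : ℝ) : ℝ :=
  (γ ^ 2 / (1 + γ ^ 2) * r ^ 2) / (r ^ 2 + 2 * γ ^ (3 / 2 : ℝ) * r + 1)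

/-- The feasible triples `(α, r, t)`. -/
def feasible (γ : ℝ) : Set (ℝ × ℝ × ℝ) :=
  {p | p.1 ∈ Set.Icc (0 : ℝ) 1 ∧ 0 ≤ p.2.1 ∧ p.2.2 ∈ Set.Ioo (0 : ℝ) 1 ∧
    0 ≤ (1 - p.1) * coefB γ p.2.2 + p.1 * coefD γ p.2.1 ∧
    0 ≤ (1 - p.1) * coefC γ p.2.2 + p.1 * coefE γ p.2.1}

/-- The approximation factor `Φ_γ`, the optimal value of the three-parameter program. -/
def Phi (γ : ℝ) : ℝ := sSup ((fun p : ℝ × ℝ × ℝ => (1 - p.1) * coefA γ p.2.2) '' feasible γ)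

/-! ## Algorithms: a real random access machine with oracles

A program is one finite text for all dimensions. It works on three memories: natural numbers,
real numbers, and vectors of the current dimension `n`, all with indirect addressing. -/

/-- The oracles of an instance: value and gradient of the objective, and linear optimization over
the feasible region under one additional linear constraint. -/
structure Oracle (n : ℕ) where
  value : Vec n → ℝ
  grad : Vec n → Vec n
  lin : Vec n → Vec n → ℝ → Option (Vec n)

/-- A memory state of the machine in dimension `n`. -/
structure State (n : ℕ) where
  nat : ℕ → ℕ
  real : ℕ → ℝ
  vec : ℕ → Vec n

/-- The initial state: the parameters `γ` and `δ` are in the real cells `0` and `1`, and all other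
cells are zero. -/
def State.init (n : ℕ) (γ δ : ℝ) : State n where
  nat := fun _ => 0
  real := fun k => if k = 0 then γ else if k = 1 then δ else 0
  vec := fun _ => 0

/-- Expressions for natural numbers (no multiplication, so that numbers grow by at most a constant
factor per step); `cell a` is the content of the natural-number cell with address `a`. -/
inductive NatExp : Type
  | lit (k : ℕ)
  | dim
  | cell (a : NatExp)
  | add (a b : NatExp)
  | sub (a b : NatExp)

/-- Expressions for real numbers, with rational constants; `cell a` is the content of the real cell
with address `a`, and `coord v i` is the coordinate number `i` of the vector cell `v`. -/
inductive RealExp : Type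
  | lit (q : ℚ)
  | cell (a : NatExp)
  | coord (v i : NatExp)
  | add (a b : RealExp)
  | sub (a b : RealExp)
  | mul (a b : RealExp)
  | div (a b : RealExp)

/-- Tests. -/
inductive Test : Type
  | natLt (a b : NatExp)
  | realLt (a b : RealExp)

/-- Elementary instructions. -/
inductive Instr : Type
  /-- store a natural number in cell `a` -/
  | setNat (a : NatExp) (e : NatExp)
  /-- store a real number in cell `a` -/
  | setReal (a : NatExp) (e : RealExp)
  /-- overwrite coordinate number `i` of the vector cell `v` (no effect if `n ≤ i`) -/
  | setCoord (v i : NatExp) (e : RealExp)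
  /-- store in real cell `a` the value of the objective at the vector in cell `v` -/
  | value (a v : NatExp)
  /-- store in vector cell `w` the gradient of the objective at the vector in cell `v` -/
  | grad (w v : NatExp)
  /-- linear optimization with the objective vector in cell `c`, under the constraint given by the
  vector in cell `a` and the number `b`: store the answer in vector cell `w` and the number `1` in
  the natural-number cell `f`; if there is no feasible point, store `0` in cell `f` -/
  | lin (f w c a : NatExp) (b : RealExp)

/-- Programs. -/
inductive Prog : Type
  | instr (a : Instr)
  | seq (p q : Prog)
  | ite (b : Test) (p q : Prog)
  | while (b : Test) (p : Prog)

variable {n : ℕ}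

/-- Value of an expression. -/
def NatExp.eval (s : State n) : NatExp → ℕ
  | .lit k => k
  | .dim => n
  | .cell a => s.nat (a.eval s)
  | .add a b => a.eval s + b.eval s
  | .sub a b => a.eval s - b.eval s

/-- Value of an expression; coordinates out of range read as `0`, and division by `0` gives `0`. -/
def RealExp.eval (s : State n) : RealExp → ℝ
  | .lit q => (q : ℝ)
  | .cell a => s.real (a.eval s)
  | .coord v i => if h : i.eval s < n then s.vec (v.eval s) ⟨i.eval s, h⟩ else 0
  | .add a b => a.eval s + b.eval s
  | .sub a b => a.eval s - b.eval s
  | .mul a b => a.eval s * b.eval s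
  | .div a b => a.eval s / b.eval s

/-- Truth of a test. -/
def Test.holds (s : State n) : Test → Prop
  | .natLt a b => a.eval s < b.eval s
  | .realLt a b => a.eval s < b.eval s

/-- The vector `x` with its coordinate number `i` replaced by `r`. -/
def setCoordinate (x : Vec n) (i : ℕ) (r : ℝ) : Vec n :=
  WithLp.toLp 2 (fun j : Fin n => if (j : ℕ) = i then r else x j)

/-- Effect of an elementary instruction. -/
def Instr.step (O : Oracle n) (s : State n) : Instr → State n
  | .setNat a e => { s with nat := Function.update s.nat (a.eval s) (e.eval s) }
  | .setReal a e => { s with real := Function.update s.real (a.eval s) (e.eval s) }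
  | .setCoord v i e =>
      { s with vec := Function.update s.vec (v.eval s)
                (setCoordinate (s.vec (v.eval s)) (i.eval s) (e.eval s)) }
  | .value a v => { s with real := Function.update s.real (a.eval s) (O.value (s.vec (v.eval s))) }
  | .grad w v => { s with vec := Function.update s.vec (w.eval s) (O.grad (s.vec (v.eval s))) }
  | .lin f w c a b =>
      match O.lin (s.vec (c.eval s)) (s.vec (a.eval s)) (b.eval s) with
      | none => { s with nat := Function.update s.nat (f.eval s) 0 }
      | some x =>
          { s with
            nat := Function.update s.nat (f.eval s) 1
            vec := Function.update s.vec (w.eval s) x }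

/-- `Exec O p s s' t`: started in state `s`, the program `p` halts in state `s'` after `t` steps.
Every instruction, every oracle call and every evaluation of a test is one step (the size of the
expressions in it is bounded by the fixed program). -/
inductive Exec (O : Oracle n) : Prog → State n → State n → ℕ → Prop
  | instr (a : Instr) (s : State n) : Exec O (.instr a) s (a.step O s) 1
  | seq {p q : Prog} {s s' s'' : State n} {t t' : ℕ} :
      Exec O p s s' t → Exec O q s' s'' t' → Exec O (.seq p q) s s'' (t + t')
  | iteTrue {b : Test} {p q : Prog} {s s' : State n} {t : ℕ} :
      b.holds s → Exec O p s s' t → Exec O (.ite b p q) s s' (t + 1)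
  | iteFalse {b : Test} {p q : Prog} {s s' : State n} {t : ℕ} :
      ¬ b.holds s → Exec O q s s' t → Exec O (.ite b p q) s s' (t + 1)
  | whileTrue {b : Test} {p : Prog} {s s' s'' : State n} {t t' : ℕ} :
      b.holds s → Exec O p s s' t → Exec O (.while b p) s' s'' t' →
      Exec O (.while b p) s s'' (t + t' + 1)
  | whileFalse {b : Test} {p : Prog} {s : State n} :
      ¬ b.holds s → Exec O (.while b p) s s 1

/-- On the parameters `γ`, `δ` and the oracles `O`, the program `p` halts after at most `T` steps,
and its output, the content of the vector cell `0`, is `x`. -/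
def Returns (O : Oracle n) (p : Prog) (γ δ T : ℝ) (x : Vec n) : Prop :=
  ∃ (s : State n) (t : ℕ),
    Exec O p (State.init n γ δ) s t ∧ (t : ℝ) ≤ T ∧ s.vec 0 = x

/-- The oracles `O` and the region `P` form an instance of the maximization problem with
parameters `γ` and `L`. -/
structure IsInstance (γ L : ℝ) (P : Set (Vec n)) (O : Oracle n) : Prop where
  nonneg : ∀ x ∈ cube n, 0 ≤ O.value x
  smooth : IsSmoothWithGradient L O.value O.grad
  weaklyDR : IsWeaklyDRSubmodular γ O.value
  subset_cube : P ⊆ cube n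
  convexBody : IsConvexBody P
  downClosed : IsDownClosed P
  metaSolver : IsMetaSolver P O.lin

end WeakDR

end

/-!
For `γ < 1` the inequality that defines weak DR-submodularity, read for `x = y`, says that every
increment dominates `γ` times itself, so that the objective is monotone. Continuous greedy then
reaches `1 - exp (-γ)` times the optimal value (`Run.greedyProg`), and this is at least `Φ_γ`, by
weak duality for the program that defines `Φ_γ` with multiplier `1 - exp (-γ)` for the first
constraint (`Phi_le_of_lt_one`).

For `γ = 1` the objective is DR-submodular but need not be monotone. Write `v` for the optimal
value, attained at `o`, and `x ⊕ y = x + y - x ⊙ y`. The algorithm is built around a local optimum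
`z` of the feasible region, for which `F (z ⊕ o) + F (z ⊙ o) ≤ 2 F z` up to a small error
(`LSInv.localOpt`). It compares two candidates.

* Double greedy on the box below `z` gives a point of value at least
  `(r² F z + 2 r F (z ⊙ o)) / (1 + r)²`, for all `r ≥ 0` at once (`DGInv.final`).
* A measured continuous greedy first avoids `z` (`AvoidInv.step`), and from time `t` on moves
  towards points `w`, each a local optimum of the part of the region on which the linear gain is at
  least the one promised by `o` (`ReachInv.step`). If `F (w ⊕ o)` is at least about `F (z ⊕ o)` for
  all these `w`, then it reaches about `A v + B F (z ⊙ o) + C F (z ⊕ o)` with `A`, `B`, `C` the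
  coefficients at `t`.

A convex combination of the two bounds with weights `α` and `1 - α` is at least `(1 - α) A v` for
every feasible triple `(α, r, t)` (`candidate_bound`). If instead some `w` has `F (w ⊕ o)` smaller
than `F (z ⊕ o)` by `ε v`, then `w` takes the place of `z`. As `0 ≤ F (z ⊕ o) ≤ 2 v`, this happens
at most `2 / ε` times in a row, so it is enough to put all points `w` on a queue and to process
about `2 / ε` levels of it (`Run.levelProg`, `Run.aidedProg`). The unknown values `F (y ⊕ o)` and
`F (z ⊕ o)` are guessed on a grid whose scale `S = F 0 + ⟨∇F 0, x₀⟩`, with `x₀` the first answer of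
the linear oracle, lies between `v` and `v + L D²` (`success_of_guesses`).

A fixed loss `ε` in the factor disappears when `δ` is fixed: take `ε = δ`. The point `x₀` has value
at least `v - L D²`, so that it is good enough unless `v ≤ 2 L D²`, and then `δ v` is of the order of
the additive error (`exists_exact_approximation`).

The bounds on `Φ_1` come from an explicit feasible triple and from explicit multipliers. The bound
`γ exp (-γ) < Φ_γ` comes from triples with `α` and `t` close to `0`.

Running times are certified by total-correctness triples `Run O p s T Q`, which are proved by
symbolic execution of the programs.
-/

noncomputable section

namespace WeakDR

open Filter Topology

variable {n : ℕ}

/-! ### Calculus on the cube -/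

theorem inner_eq_sum (x y : Vec n) : inner ℝ x y = ∑ i, x i * y i := by
  simp [PiLp.inner_apply, mul_comm]

theorem convex_cube (n : ℕ) : Convex ℝ (cube n) := by
  intro x hx y hy a b ha hb hab i
  have h1 := hx i
  have h2 := hy i
  simp only [PiLp.add_apply, PiLp.smul_apply, smul_eq_mul]
  constructor
  · nlinarith
  · nlinarith

theorem add_smul_mem_cube {x v : Vec n} (hx : x ∈ cube n) (hxv : x + v ∈ cube n) {c : ℝ}
    (hc : c ∈ Set.Icc (0 : ℝ) 1) : x + c • v ∈ cube n :=
  (convex_cube n).add_smul_mem hx hxv hc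

/-- Derivative of the objective along a segment in the cube. -/
theorem hasDerivWithinAt_segment {L : ℝ} {F : Vec n → ℝ} {G : Vec n → Vec n}
    (hs : IsSmoothWithGradient L F G) {x v : Vec n} (hx : x ∈ cube n) (hxv : x + v ∈ cube n)
    {c : ℝ} (hc : c ∈ Set.Icc (0 : ℝ) 1) :
    HasDerivWithinAt (fun c : ℝ => F (x + c • v)) (inner ℝ (G (x + c • v)) v)
      (Set.Icc 0 1) c := by
  have h1 := (hs.1 _ (add_smul_mem_cube hx hxv hc)).hasFDerivWithinAt
  have h2 : HasDerivWithinAt (fun c : ℝ => x + c • v) v (Set.Icc 0 1) c := by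
    have := ((hasDerivAt_id c).smul_const v).const_add x
    simpa using this.hasDerivWithinAt
  have h3 := h1.comp_hasDerivWithinAt (t := cube n) c h2
    (fun d hd => add_smul_mem_cube hx hxv hd)
  exact h3.congr_deriv (by simp)

/-- Mean value theorem along a segment in the cube. -/
theorem exists_mean_value {L : ℝ} {F : Vec n → ℝ} {G : Vec n → Vec n}
    (hs : IsSmoothWithGradient L F G) {x v : Vec n} (hx : x ∈ cube n) (hxv : x + v ∈ cube n) :
    ∃ c ∈ Set.Ioo (0 : ℝ) 1, F (x + v) - F x = inner ℝ (G (x + c • v)) v := by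
  obtain ⟨c, hc, h⟩ := exists_hasDerivAt_eq_slope (fun c : ℝ => F (x + c • v))
    (fun c => inner ℝ (G (x + c • v)) v) (zero_lt_one)
    (fun c hc => (hasDerivWithinAt_segment hs hx hxv hc).continuousWithinAt)
    (fun c hc => (hasDerivWithinAt_segment hs hx hxv ⟨hc.1.le, hc.2.le⟩).hasDerivAt
      (Icc_mem_nhds hc.1 hc.2))
  exact ⟨c, hc, by simpa using h.symm⟩

theorem deriv_nonneg_of_min_left {f : ℝ → ℝ} {f' : ℝ}
    (h : HasDerivWithinAt f f' (Set.Icc 0 1) 0) (hm : ∀ c ∈ Set.Ioc (0 : ℝ) 1, f 0 ≤ f c) :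
    0 ≤ f' := by
  have h1 : HasDerivWithinAt f f' (Set.Ioc 0 1) 0 := h.mono Set.Ioc_subset_Icc_self
  rw [hasDerivWithinAt_iff_tendsto_slope' (by simp)] at h1
  have : (𝓝[Set.Ioc (0 : ℝ) 1] 0).NeBot := by
    rw [nhdsWithin_Ioc_eq_nhdsGT zero_lt_one]; infer_instance
  refine ge_of_tendsto h1 ?_
  filter_upwards [self_mem_nhdsWithin] with c hc
  rw [slope_def_field]
  exact div_nonneg (sub_nonneg.2 (hm c hc)) (by simpa using hc.1.le)

/-- A smooth objective decreases at most by a quadratic term below its linearization. -/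
theorem IsSmoothWithGradient.lower_bound {L : ℝ} {F : Vec n → ℝ} {G : Vec n → Vec n}
    (hs : IsSmoothWithGradient L F G) {x v : Vec n} (hx : x ∈ cube n) (hxv : x + v ∈ cube n) :
    F x + inner ℝ (G x) v - L * ‖v‖ ^ 2 ≤ F (x + v) := by
  obtain ⟨c, hc, h⟩ := exists_mean_value hs hx hxv
  have h1 := hs.2 _ (add_smul_mem_cube hx hxv ⟨hc.1.le, hc.2.le⟩) _ hx
  have h2 : ‖x + c • v - x‖ = c * ‖v‖ := by
    rw [add_sub_cancel_left, norm_smul, Real.norm_of_nonneg hc.1.le]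
  have h3 : inner ℝ (G (x + c • v)) v = inner ℝ (G x) v + inner ℝ (G (x + c • v) - G x) v := by
    rw [inner_sub_left]; ring
  have h4 := abs_real_inner_le_norm (G (x + c • v) - G x) v
  rw [h2] at h1
  have h5 : ‖G (x + c • v) - G x‖ * ‖v‖ ≤ L * ‖v‖ ^ 2 := by
    have hL : 0 ≤ L * (c * ‖v‖) := (norm_nonneg _).trans h1
    have hv := norm_nonneg v
    have h6 : L * (c * ‖v‖) * ‖v‖ ≤ L * ‖v‖ ^ 2 := by
      have h7 : 0 ≤ L * ‖v‖ := by
        have : 0 ≤ c * (L * ‖v‖) := by nlinarith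
        exact nonneg_of_mul_nonneg_right this hc.1
      nlinarith [mul_nonneg h7 hv, mul_nonneg (mul_nonneg h7 hv) (sub_nonneg.2 hc.2.le)]
    exact (mul_le_mul_of_nonneg_right h1 hv).trans h6
  have h6 := (abs_le.1 h4).1
  linarith

theorem single_mem_cube_iff {x : Vec n} (hx : x ∈ cube n) (i : Fin n) (c : ℝ) :
    x + EuclideanSpace.single i c ∈ cube n ↔ 0 ≤ x i + c ∧ x i + c ≤ 1 := by
  constructor
  · intro h
    simpa using h i
  · intro h j
    by_cases hj : j = i
    · subst hj; simpa using h
    · simpa [hj] using hx j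

theorem inner_single (g : Vec n) (i : Fin n) (c : ℝ) :
    inner ℝ g (EuclideanSpace.single i c) = g i * c := by
  rw [inner_eq_sum, Finset.sum_eq_single i]
  · simp
  · intro j _ hj; simp [hj]
  · simp

/-- The gradient of a weakly DR-submodular function is antitone up to the factor `γ`. At the upper
faces of the cube, where there is no room for a forward difference, one passes to the limit or uses
a backward difference. -/
theorem gradient_antitone {γ L : ℝ} {F : Vec n → ℝ} {G : Vec n → Vec n}
    (hs : IsSmoothWithGradient L F G) (hd : IsWeaklyDRSubmodular γ F)
    {x y : Vec n} (hx : x ∈ cube n) (hy : y ∈ cube n) (hxy : ∀ i, x i ≤ y i) (i : Fin n) :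
    γ * G y i ≤ G x i := by
  have forward : ∀ y : Vec n, y ∈ cube n → (∀ i, x i ≤ y i) → y i < 1 → γ * G y i ≤ G x i := by
    intro y hy hxy hyi
    set c := 1 - y i with hc
    have hc0 : 0 < c := by linarith
    have hyv : y + EuclideanSpace.single i c ∈ cube n :=
      (single_mem_cube_iff hy i c).2 ⟨by linarith [(hy i).1], by linarith⟩
    have hxv : x + EuclideanSpace.single i c ∈ cube n :=
      (single_mem_cube_iff hx i c).2 ⟨by linarith [(hx i).1], by linarith [hxy i]⟩
    have d1 := hasDerivWithinAt_segment hs hx hxv (c := 0) (by simp)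
    have d2 := hasDerivWithinAt_segment hs hy hyv (c := 0) (by simp)
    have d3 := d1.sub (d2.const_mul γ)
    have := deriv_nonneg_of_min_left d3 (by
      intro s hs'
      have e : s • EuclideanSpace.single i c = EuclideanSpace.single i (s * c) := by
        ext j; by_cases hj : j = i <;> simp [hj]
      have h1 := hd x hx y hy hxy i (s * c) (mul_pos hs'.1 hc0)
        (by rw [← e]; exact add_smul_mem_cube hx hxv ⟨hs'.1.le, hs'.2⟩)
        (by rw [← e]; exact add_smul_mem_cube hy hyv ⟨hs'.1.le, hs'.2⟩)
      simp only [Pi.sub_apply, zero_smul, add_zero, e]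
      linarith)
    simp only [zero_smul, add_zero, inner_single] at this
    have h2 : 0 ≤ (G x i - γ * G y i) * c := by linarith
    have := nonneg_of_mul_nonneg_left h2 hc0
    linarith
  rcases lt_or_ge (y i) 1 with h | h
  · exact forward y hy hxy h
  have hy1 : y i = 1 := le_antisymm (hy i).2 h
  rcases lt_or_ge (x i) 1 with h' | h'
  · have hlim : ∀ c ∈ Set.Ioo (0 : ℝ) (1 - x i), γ * G y i ≤ G x i + |γ| * (L * c) := by
      intro c hc
      have hyc : y + EuclideanSpace.single i (-c) ∈ cube n :=
        (single_mem_cube_iff hy i _).2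
          ⟨by linarith [(hx i).1, hc.2], by linarith [hc.1]⟩
      have h1 := forward _ hyc (by
        intro j
        by_cases hj : j = i
        · subst hj; simp; linarith [hc.2]
        · simpa [hj] using hxy j) (by simp; linarith [hc.1])
      have h2 := hs.2 y hy _ hyc
      have h3 : ‖y - (y + EuclideanSpace.single i (-c))‖ = c := by
        simp [abs_of_pos hc.1]
      rw [h3] at h2
      have h4 : |G y i - G (y + EuclideanSpace.single i (-c)) i| ≤ L * c := by
        refine le_trans ?_ h2
        have := PiLp.norm_apply_le (G y - G (y + EuclideanSpace.single i (-c))) i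
        simpa using this
      have h5 : γ * G y i - γ * G (y + EuclideanSpace.single i (-c)) i ≤ |γ| * (L * c) := by
        rw [← mul_sub]
        refine (le_abs_self _).trans ?_
        rw [abs_mul]
        exact mul_le_mul_of_nonneg_left h4 (abs_nonneg _)
      linarith
    have ht : Tendsto (fun c : ℝ => G x i + |γ| * (L * c)) (𝓝[>] 0) (𝓝 (G x i)) := by
      have : ContinuousAt (fun c : ℝ => G x i + |γ| * (L * c)) 0 := by fun_prop
      simpa using this.tendsto.mono_left nhdsWithin_le_nhds
    refine ge_of_tendsto ht ?_
    filter_upwards [Ioo_mem_nhdsGT (sub_pos.2 h')] with c hc using hlim c hc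
  · have hx1 : x i = 1 := le_antisymm (hx i).2 h'
    have hyv : y + EuclideanSpace.single i (-1) ∈ cube n :=
      (single_mem_cube_iff hy i _).2 ⟨by linarith, by linarith⟩
    have hxv : x + EuclideanSpace.single i (-1) ∈ cube n :=
      (single_mem_cube_iff hx i _).2 ⟨by linarith, by linarith⟩
    have d1 := hasDerivWithinAt_segment hs hx hxv (c := 0) (by simp)
    have d2 := hasDerivWithinAt_segment hs hy hyv (c := 0) (by simp)
    have d3 := (d2.const_mul γ).sub d1
    have := deriv_nonneg_of_min_left d3 (by
      intro s hs'
      have e : s • EuclideanSpace.single i (-1) = EuclideanSpace.single i (-s) := by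
        ext j; by_cases hj : j = i <;> simp [hj]
      have m1 := add_smul_mem_cube hx hxv ⟨hs'.1.le, hs'.2⟩
      have m2 := add_smul_mem_cube hy hyv ⟨hs'.1.le, hs'.2⟩
      rw [e] at m1 m2
      have c1 : x + EuclideanSpace.single i (-s) + EuclideanSpace.single i s = x := by
        ext j; by_cases hj : j = i <;> simp [hj]
      have c2 : y + EuclideanSpace.single i (-s) + EuclideanSpace.single i s = y := by
        ext j; by_cases hj : j = i <;> simp [hj]
      have h1 := hd _ m1 _ m2 (by intro j; simpa using hxy j) i s hs'.1
        (by rw [c1]; exact hx) (by rw [c2]; exact hy)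
      rw [c1, c2] at h1
      simp only [Pi.sub_apply, zero_smul, add_zero, e]
      linarith)
    simp only [zero_smul, add_zero, inner_single] at this
    linarith

/-- For `γ < 1`, the defining inequality with `x = y` makes all partial derivatives nonnegative. -/
theorem gradient_nonneg {γ L : ℝ} {F : Vec n → ℝ} {G : Vec n → Vec n} (hγ : γ < 1)
    (hs : IsSmoothWithGradient L F G) (hd : IsWeaklyDRSubmodular γ F)
    {x : Vec n} (hx : x ∈ cube n) (i : Fin n) : 0 ≤ G x i := by
  have := gradient_antitone hs hd hx hx (fun _ => le_rfl) i
  nlinarith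

theorem inner_le_inner_of_coord {a b v : Vec n} (h : ∀ i, 0 < v i → a i ≤ b i)
    (hv : ∀ i, 0 ≤ v i) : inner ℝ a v ≤ inner ℝ b v := by
  rw [inner_eq_sum, inner_eq_sum]
  refine Finset.sum_le_sum fun i _ => ?_
  rcases (hv i).eq_or_lt with h0 | h0
  · rw [← h0]; simp
  · exact mul_le_mul_of_nonneg_right (h i h0) h0.le

/-- The increment in a nonnegative direction is at most `1 / γ` times the linear prediction. -/
theorem increment_le_inner {γ L : ℝ} {F : Vec n → ℝ} {G : Vec n → Vec n}
    (hs : IsSmoothWithGradient L F G) (hd : IsWeaklyDRSubmodular γ F)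
    {x v : Vec n} (hx : x ∈ cube n) (hxv : x + v ∈ cube n) (hv : ∀ i, 0 ≤ v i) :
    γ * (F (x + v) - F x) ≤ inner ℝ (G x) v := by
  obtain ⟨c, hc, h⟩ := exists_mean_value hs hx hxv
  rw [h, ← real_inner_smul_left]
  refine inner_le_inner_of_coord (fun i _ => ?_) hv
  have := gradient_antitone hs hd hx (add_smul_mem_cube hx hxv ⟨hc.1.le, hc.2.le⟩)
    (fun j => by simpa using mul_nonneg hc.1.le (hv j)) i
  simpa using this

/-! ### Inequalities for DR-submodular functions -/

/-- `F` is a nonnegative DR-submodular function on the cube with `L`-Lipschitz gradient `G`. -/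
structure IsSmoothDR (L : ℝ) (F : Vec n → ℝ) (G : Vec n → Vec n) : Prop where
  nonneg : ∀ x ∈ cube n, 0 ≤ F x
  smooth : IsSmoothWithGradient L F G
  dr : IsWeaklyDRSubmodular 1 F

/-- The probabilistic sum `x + y - x y`, coordinatewise. -/
def psum (x y : Vec n) : Vec n := WithLp.toLp 2 (fun i => x i + y i - x i * y i)

/-- The coordinatewise product. -/
def had (x y : Vec n) : Vec n := WithLp.toLp 2 (fun i => x i * y i)

/-- The coordinatewise complement `1 - x`. -/
def compl (x : Vec n) : Vec n := WithLp.toLp 2 (fun i => 1 - x i)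

@[simp] theorem psum_apply (x y : Vec n) (i : Fin n) : psum x y i = x i + y i - x i * y i := rfl
@[simp] theorem had_apply (x y : Vec n) (i : Fin n) : had x y i = x i * y i := rfl
@[simp] theorem compl_apply (x : Vec n) (i : Fin n) : compl x i = 1 - x i := rfl

theorem psum_mem_cube {x y : Vec n} (hx : x ∈ cube n) (hy : y ∈ cube n) : psum x y ∈ cube n := by
  intro i
  have h1 := hx i
  have h2 := hy i
  simp only [psum_apply]
  constructor <;> nlinarith [mul_nonneg (sub_nonneg.2 h1.2) (sub_nonneg.2 h2.2)]

theorem had_mem_cube {x y : Vec n} (hx : x ∈ cube n) (hy : y ∈ cube n) : had x y ∈ cube n := by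
  intro i
  have h1 := hx i
  have h2 := hy i
  simp only [had_apply]
  exact ⟨mul_nonneg h1.1 h2.1, mul_le_one₀ h1.2 h2.1 h2.2⟩

theorem compl_mem_cube {x : Vec n} (hx : x ∈ cube n) : compl x ∈ cube n := by
  intro i
  have h1 := hx i
  simp only [compl_apply]
  constructor <;> linarith

theorem zero_mem_cube : (0 : Vec n) ∈ cube n := fun i => by simp

theorem norm_le_norm_of_abs_le {x y : Vec n} (h : ∀ i, |x i| ≤ y i) : ‖x‖ ≤ ‖y‖ := by
  rw [EuclideanSpace.norm_eq, EuclideanSpace.norm_eq]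
  refine Real.sqrt_le_sqrt (Finset.sum_le_sum fun i _ => ?_)
  have h1 := h i
  simp only [Real.norm_eq_abs, sq_abs]
  exact sq_le_sq' (by linarith [neg_abs_le (x i)]) ((le_abs_self _).trans h1)

theorem psum_eq_add (x y : Vec n) : psum x y = x + had (compl x) y := by
  ext i; simp; ring

namespace IsSmoothDR

variable {L : ℝ} {F : Vec n → ℝ} {G : Vec n → Vec n}

theorem grad_anti (H : IsSmoothDR L F G) {x y : Vec n} (hx : x ∈ cube n) (hy : y ∈ cube n)
    (hxy : ∀ i, x i ≤ y i) (i : Fin n) : G y i ≤ G x i := by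
  simpa using gradient_antitone H.smooth H.dr hx hy hxy i

theorem le_inner (H : IsSmoothDR L F G) {x v : Vec n} (hx : x ∈ cube n) (hxv : x + v ∈ cube n)
    (hv : ∀ i, 0 ≤ v i) : F (x + v) - F x ≤ inner ℝ (G x) v := by
  simpa using increment_le_inner H.smooth H.dr hx hxv hv

theorem inner_le (H : IsSmoothDR L F G) {x v : Vec n} (hx : x ∈ cube n) (hxv : x + v ∈ cube n)
    (hv : ∀ i, 0 ≤ v i) : inner ℝ (G (x + v)) v ≤ F (x + v) - F x := by
  obtain ⟨c, hc, h⟩ := exists_mean_value H.smooth hx hxv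
  rw [h]
  refine inner_le_inner_of_coord (fun i _ => ?_) hv
  refine H.grad_anti (add_smul_mem_cube hx hxv ⟨hc.1.le, hc.2.le⟩) hxv (fun j => ?_) i
  have := hv j
  simp only [PiLp.add_apply, PiLp.smul_apply, smul_eq_mul]
  nlinarith [hc.2]

/-- Concavity along nonnegative directions. -/
theorem concave (H : IsSmoothDR L F G) {x v : Vec n} (hx : x ∈ cube n) (hxv : x + v ∈ cube n)
    (hv : ∀ i, 0 ≤ v i) {s : ℝ} (hs : s ∈ Set.Icc (0 : ℝ) 1) :
    (1 - s) * F x + s * F (x + v) ≤ F (x + s • v) := by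
  have hm := add_smul_mem_cube hx hxv hs
  have h1 := H.inner_le hx hm (fun i => by simpa using mul_nonneg hs.1 (hv i))
  have e : x + s • v + (1 - s) • v = x + v := by rw [add_assoc, ← add_smul]; simp
  have h2 := H.le_inner (v := (1 - s) • v) hm (by rw [e]; exact hxv)
    (fun i => by simpa using mul_nonneg (sub_nonneg.2 hs.2) (hv i))
  rw [e, real_inner_smul_right] at h2
  rw [real_inner_smul_right] at h1
  nlinarith [hs.1, hs.2, mul_le_mul_of_nonneg_left h1 (sub_nonneg.2 hs.2),
    mul_le_mul_of_nonneg_left h2 hs.1]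

/-- Diminishing returns for vector increments. -/
theorem increment_anti (H : IsSmoothDR L F G) {x y v : Vec n} (hx : x ∈ cube n)
    (hyv : y + v ∈ cube n) (hxy : ∀ i, x i ≤ y i) (hv : ∀ i, 0 ≤ v i) :
    F (y + v) - F y ≤ F (x + v) - F x := by
  have hy : y ∈ cube n := fun i => ⟨(hx i).1.trans (hxy i), by
    have := (hyv i).2
    simp only [PiLp.add_apply] at this
    linarith [hv i]⟩
  have hxv : x + v ∈ cube n := fun i => ⟨by simpa using add_nonneg (hx i).1 (hv i), by
    have := (hyv i).2
    simp only [PiLp.add_apply] at this ⊢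
    linarith [hxy i]⟩
  have hd : ∀ c ∈ Set.Icc (0 : ℝ) 1, HasDerivWithinAt
      (fun c : ℝ => F (x + c • v) - F (y + c • v))
      (inner ℝ (G (x + c • v)) v - inner ℝ (G (y + c • v)) v) (Set.Icc 0 1) c := fun c hc =>
    (hasDerivWithinAt_segment H.smooth hx hxv hc).sub (hasDerivWithinAt_segment H.smooth hy hyv hc)
  obtain ⟨c, hc, h⟩ := exists_hasDerivAt_eq_slope _ _ (zero_lt_one)
    (fun c hc => (hd c hc).continuousWithinAt)
    (fun c hc => (hd c ⟨hc.1.le, hc.2.le⟩).hasDerivAt (Icc_mem_nhds hc.1 hc.2))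
  have h1 : inner ℝ (G (y + c • v)) v ≤ inner ℝ (G (x + c • v)) v := by
    refine inner_le_inner_of_coord (fun i _ => ?_) hv
    have hc' : c ∈ Set.Icc (0 : ℝ) 1 := ⟨hc.1.le, hc.2.le⟩
    exact H.grad_anti (add_smul_mem_cube hx hxv hc') (add_smul_mem_cube hy hyv hc')
      (fun j => by simpa using hxy j) i
  simp only [one_smul, zero_smul, add_zero, sub_zero, div_one] at h
  linarith

/-- If `y` has all coordinates at most `c`, then adding `y` probabilistically loses at most the
fraction `c` of the value. -/
theorem psum_lower (H : IsSmoothDR L F G) {x y : Vec n} (hx : x ∈ cube n) (hy : y ∈ cube n) {c : ℝ}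
    (hc : c ∈ Set.Icc (0 : ℝ) 1) (hyc : ∀ i, y i ≤ c) : (1 - c) * F x ≤ F (psum y x) := by
  rcases hc.1.eq_or_lt with h0 | h0
  · have : psum y x = x := by
      ext i
      have : y i = 0 := le_antisymm (by rw [h0]; exact hyc i) (hy i).1
      simp [this]
    rw [this, ← h0]; simp
  · set v : Vec n := WithLp.toLp 2 (fun i => (1 - x i) * (y i / c)) with hv
    have hyc' : ∀ i, 0 ≤ y i / c ∧ y i / c ≤ 1 := fun i =>
      ⟨div_nonneg (hy i).1 h0.le, (div_le_one h0).2 (hyc i)⟩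
    have hv0 : ∀ i, 0 ≤ v i := fun i => mul_nonneg (sub_nonneg.2 (hx i).2) (hyc' i).1
    have hxv : x + v ∈ cube n := fun i => by
      have h1 := hx i
      have h2 := hyc' i
      refine ⟨by simpa using add_nonneg h1.1 (hv0 i), ?_⟩
      have : v i ≤ (1 - x i) * 1 := mul_le_mul_of_nonneg_left h2.2 (sub_nonneg.2 h1.2)
      simp only [PiLp.add_apply]
      linarith
    have h1 := H.concave hx hxv hv0 hc
    have h2 := mul_nonneg hc.1 (H.nonneg _ hxv)
    have e : x + c • v = psum y x := by
      ext i
      simp only [hv, PiLp.add_apply, PiLp.smul_apply, smul_eq_mul, psum_apply]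
      field_simp
      ring
    rw [e] at h1
    linarith

/-- One-step form of the lower bound on `F (y ⊕ x)` when `y` is built up from small steps `h w`:
the first-order term in `w` is kept. -/
theorem psum_step (H : IsSmoothDR L F G) {x w : Vec n} (hx : x ∈ cube n) (hw : w ∈ cube n) {h : ℝ}
    (hh : h ∈ Set.Icc (0 : ℝ) 1) :
    (1 - h) * F x + h * F (psum x w) ≤ F (psum (h • w) x) := by
  have := H.concave (v := had (compl x) w) hx (by rw [← psum_eq_add]; exact psum_mem_cube hx hw)
    (fun i => (had_mem_cube (compl_mem_cube hx) hw i).1) hh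
  rw [← psum_eq_add] at this
  convert this using 2
  ext i; simp; ring

/-- The linear gap at `z` towards `o` bounds `F (z ⊕ o) + F (z ⊙ o) - 2 F z`. -/
theorem gap_ge (H : IsSmoothDR L F G) {z o : Vec n} (hz : z ∈ cube n) (ho : o ∈ cube n) :
    F (psum z o) + F (had z o) - 2 * F z ≤ inner ℝ (G z) (o - z) := by
  have h1 := H.le_inner (v := had (compl z) o) hz (by rw [← psum_eq_add]; exact psum_mem_cube hz ho)
    (fun i => (had_mem_cube (compl_mem_cube hz) ho i).1)
  have e : had z o + had z (compl o) = z := by ext i; simp; ring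
  have h2 := H.inner_le (x := had z o) (v := had z (compl o)) (had_mem_cube hz ho)
    (by rw [e]; exact hz) (fun i => (had_mem_cube hz (compl_mem_cube ho) i).1)
  rw [e] at h2
  rw [← psum_eq_add] at h1
  have e2 : o - z = had (compl z) o - had z (compl o) := by ext i; simp; ring
  rw [e2, inner_sub_right]
  linarith

theorem psum_add_had_le (H : IsSmoothDR L F G) {z o : Vec n} (hz : z ∈ cube n) (ho : o ∈ cube n) :
    F (psum z o) + F (had z o) ≤ F z + F o := by
  have e : had z o + had (compl z) o = o := by ext i; simp; ring
  have h := H.increment_anti (x := had z o) (y := z) (v := had (compl z) o) (had_mem_cube hz ho)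
    (by rw [← psum_eq_add]; exact psum_mem_cube hz ho)
    (fun i => by simpa using mul_le_of_le_one_right (hz i).1 (ho i).2)
    (fun i => (had_mem_cube (compl_mem_cube hz) ho i).1)
  rw [e, ← psum_eq_add] at h
  linarith

/-- Restricting `o` to the complement of `z` loses at most `F (z ⊙ o)`. -/
theorem compl_had_ge (H : IsSmoothDR L F G) {z o : Vec n} (hz : z ∈ cube n) (ho : o ∈ cube n) :
    F o - F (had z o) ≤ F (had (compl z) o) := by
  have e : had (compl z) o + had z o = o := by ext i; simp; ring
  have h := H.increment_anti (x := 0) (y := had (compl z) o) (v := had z o) zero_mem_cube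
    (by rw [e]; exact ho) (fun i => (had_mem_cube (compl_mem_cube hz) ho i).1)
    (fun i => (had_mem_cube hz ho i).1)
  rw [e, zero_add] at h
  linarith [H.nonneg 0 zero_mem_cube]

/-- Adding a vector `(1 - z) ⊙ u` that avoids `z` to `x ≤ o` such that the increment is
`(1 - z) ⊙ (1 - o) ⊙ u` loses at most a fraction of `F (z ⊕ o)`. -/
theorem avoid_lower (H : IsSmoothDR L F G) {x z o u : Vec n} (hx : x ∈ cube n) (hz : z ∈ cube n)
    (ho : o ∈ cube n) (hu : u ∈ cube n) (hxo : ∀ i, x i ≤ o i) {c : ℝ}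
    (hc : c ∈ Set.Icc (0 : ℝ) 1) (huc : ∀ i, u i ≤ c) :
    F x - c * F (psum z o) ≤ F (x + had (had (compl z) (compl o)) u) := by
  have hzo := psum_mem_cube hz ho
  have e : psum z o + had (had (compl z) (compl o)) u = psum u (psum z o) := by
    ext i; simp; ring
  have h := H.increment_anti (x := x) (y := psum z o) (v := had (had (compl z) (compl o)) u) hx
    (by rw [e]; exact psum_mem_cube hu hzo)
    (fun i => by
      have h1 := hz i
      have h2 := (ho i).2
      have := hxo i
      simp only [psum_apply]
      nlinarith)
    (fun i => (had_mem_cube (had_mem_cube (compl_mem_cube hz) (compl_mem_cube ho)) hu i).1)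
  rw [e] at h
  have := H.psum_lower hzo hu hc huc
  linarith

end IsSmoothDR

/-! ### Geometry of the feasible region -/

namespace IsInstance

variable {γ L : ℝ} {P : Set (Vec n)} {O : Oracle n}

theorem zero_mem (I : IsInstance γ L P O) : (0 : Vec n) ∈ P := by
  obtain ⟨x, hx⟩ := I.convexBody.2.2
  have hx' := interior_subset hx
  exact I.downClosed x hx' 0 (fun i => by simpa using (I.subset_cube hx' i).1)

theorem norm_sub_le (I : IsInstance γ L P O) {x y : Vec n} (hx : x ∈ P) (hy : y ∈ P) :
    ‖x - y‖ ≤ Metric.diam P := by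
  rw [← dist_eq_norm]
  exact Metric.dist_le_diam_of_mem I.convexBody.1.isBounded hx hy

theorem norm_le (I : IsInstance γ L P O) {x : Vec n} (hx : x ∈ P) : ‖x‖ ≤ Metric.diam P := by
  simpa using I.norm_sub_le hx I.zero_mem

theorem eq_zero_or_nonneg (I : IsInstance γ L P O) : n = 0 ∨ 0 ≤ L := by
  rcases Nat.eq_zero_or_pos n with h | h
  · exact Or.inl h
  right
  let i : Fin n := ⟨0, h⟩
  have h1 : EuclideanSpace.single i (1 : ℝ) ∈ cube n := by
    have := (single_mem_cube_iff (zero_mem_cube (n := n)) i 1).2 (by simp)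
    simpa using this
  have h2 := I.smooth.2 _ h1 _ zero_mem_cube
  have h3 : ‖EuclideanSpace.single i (1 : ℝ) - 0‖ = 1 := by simp
  rw [h3, mul_one] at h2
  exact (norm_nonneg _).trans h2

theorem smoothness_term_le (I : IsInstance γ L P O) {v : Vec n} {c : ℝ}
    (hv : ‖v‖ ≤ c * Metric.diam P) : L * ‖v‖ ^ 2 ≤ c ^ 2 * (L * Metric.diam P ^ 2) := by
  rcases I.eq_zero_or_nonneg with h | h
  · subst h
    have h1 : Metric.diam P = 0 := Metric.diam_subsingleton (Set.subsingleton_of_subsingleton)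
    have h2 : v = 0 := Subsingleton.elim _ _
    simp [h1, h2]
  · have := pow_le_pow_left₀ (norm_nonneg v) hv 2
    nlinarith

theorem smoothness_nonneg (I : IsInstance γ L P O) : 0 ≤ L * Metric.diam P ^ 2 := by
  rcases I.eq_zero_or_nonneg with h | h
  · subst h
    have h1 : Metric.diam P = 0 := Metric.diam_subsingleton (Set.subsingleton_of_subsingleton)
    simp [h1]
  · positivity

theorem lower_bound (I : IsInstance γ L P O) {x v : Vec n} (hx : x ∈ cube n)
    (hxv : x + v ∈ cube n) {c : ℝ} (hv : ‖v‖ ≤ c * Metric.diam P) :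
    O.value x + inner ℝ (O.grad x) v - c ^ 2 * (L * Metric.diam P ^ 2) ≤ O.value (x + v) := by
  have h1 := I.smooth.lower_bound hx hxv
  have h2 := I.smoothness_term_le hv
  linarith

theorem isSmoothDR (I : IsInstance 1 L P O) : IsSmoothDR L O.value O.grad :=
  ⟨I.nonneg, I.smooth, I.weaklyDR⟩

theorem exists_max (I : IsInstance γ L P O) : ∃ o ∈ P, ∀ y ∈ P, O.value y ≤ O.value o := by
  have hc : ContinuousOn O.value P := fun x hx =>
    (I.smooth.1 x (I.subset_cube hx)).continuousWithinAt.mono I.subset_cube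
  obtain ⟨o, ho, h⟩ := I.convexBody.1.exists_isMaxOn ⟨0, I.zero_mem⟩ hc
  exact ⟨o, ho, fun y hy => h hy⟩

/-- The unconstrained linear optimization oracle finds a maximizer. -/
theorem lin_zero (I : IsInstance γ L P O) (c : Vec n) :
    ∃ w, O.lin c 0 0 = some w ∧ w ∈ P ∧ ∀ y ∈ P, inner ℝ c y ≤ inner ℝ c w := by
  rcases h : O.lin c 0 0 with _ | w
  · have := (I.metaSolver c 0 0).1 h 0 I.zero_mem
    simp at this
  · obtain ⟨h1, -, h2⟩ := (I.metaSolver c 0 0).2 w h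
    exact ⟨w, rfl, h1, fun y hy => h2 y hy (by simp)⟩

/-- A step of the linear oracle under a constraint that is satisfied by some point of `P`. -/
theorem lin_of_feasible (I : IsInstance γ L P O) (c a : Vec n) {b : ℝ} {y : Vec n} (hy : y ∈ P)
    (hb : b ≤ inner ℝ a y) :
    ∃ w, O.lin c a b = some w ∧ w ∈ P ∧ b ≤ inner ℝ a w ∧
      ∀ y ∈ P, b ≤ inner ℝ a y → inner ℝ c y ≤ inner ℝ c w := by
  rcases h : O.lin c a b with _ | w
  · exact absurd ((I.metaSolver c a b).1 h y hy) (not_lt.2 hb)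
  · exact ⟨w, rfl, (I.metaSolver c a b).2 w h⟩

/-- A point below a combination of points of `P` with total weight at most one stays in `P`. -/
theorem mem_of_le_smul (I : IsInstance γ L P O) {p y : Vec n} (hp : p ∈ P) {c : ℝ}
    (hc : c ≤ 1) (hy0 : ∀ i, 0 ≤ y i) (hy : ∀ i, y i ≤ c * p i) : y ∈ P :=
  I.downClosed p hp y fun i => ⟨hy0 i, (hy i).trans
    (mul_le_of_le_one_left (I.subset_cube hp i).1 hc)⟩

theorem exists_smul_add (I : IsInstance γ L P O) {p w : Vec n} (hp : p ∈ P) (hw : w ∈ P)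
    {a b : ℝ} (ha : 0 ≤ a) (hb : 0 < b) :
    ∃ q ∈ P, ∀ i, a * p i + b * w i = (a + b) * q i := by
  have hab : 0 < a + b := by linarith
  refine ⟨(a / (a + b)) • p + (b / (a + b)) • w, I.convexBody.2.1 hp hw (by positivity)
    (by positivity) (by field_simp), fun i => ?_⟩
  simp only [PiLp.add_apply, PiLp.smul_apply, smul_eq_mul]
  field_simp

end IsInstance

/-! ### Double greedy -/

/-- The proportion in which double greedy divides a step between raising the lower vector and
lowering the upper one, where `a` and `b` are the rates at which these moves change the value. -/
def dgRatio (a b : ℝ) : ℝ := if 0 < a then (if 0 < b then a / (a + b) else 1) else 0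

theorem dgRatio_mem (a b : ℝ) : dgRatio a b ∈ Set.Icc (0 : ℝ) 1 := by
  unfold dgRatio
  split_ifs with h1 h2
  · constructor
    · positivity
    · rw [div_le_one (by positivity)]; linarith
  · simp
  · simp

/-- The gain of both vectors pays for the loss of the comparison point. -/
theorem dgRatio_gain {a b g s d r : ℝ} (hgb : -b ≤ g) (hga : g ≤ a) (hs : 0 ≤ s) (hr : 0 ≤ r)
    (hd1 : d ≤ dgRatio a b * s) (hd2 : -((1 - dgRatio a b) * s) ≤ d) :
    0 ≤ a * (dgRatio a b * s) + r ^ 2 * (b * ((1 - dgRatio a b) * s)) + 2 * r * (g * d) := by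
  unfold dgRatio at *
  split_ifs at * with h1 h2
  · have hab : 0 < a + b := by linarith
    set p := a / (a + b) with hp
    have hp1 : 1 - p = b / (a + b) := by rw [hp]; field_simp; ring
    have key : -(a * b / (a + b) * s) ≤ g * d := by
      rcases le_total 0 d with hd | hd
      · have : -b * d ≤ g * d := mul_le_mul_of_nonneg_right hgb hd
        have h3 : b * d ≤ b * (p * s) := mul_le_mul_of_nonneg_left hd1 h2.le
        have h4 : b * (p * s) = a * b / (a + b) * s := by rw [hp]; ring
        linarith
      · have : a * d ≤ g * d := mul_le_mul_of_nonpos_right hga hd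
        have h3 : a * -((1 - p) * s) ≤ a * d := mul_le_mul_of_nonneg_left hd2 h1.le
        have h4 : a * ((1 - p) * s) = a * b / (a + b) * s := by rw [hp1]; ring
        linarith
    have h5 : a * (p * s) + r ^ 2 * (b * ((1 - p) * s)) - 2 * r * (a * b / (a + b) * s) =
        (a - r * b) ^ 2 / (a + b) * s := by
      rw [hp1, hp]; field_simp; ring
    have h6 : 0 ≤ (a - r * b) ^ 2 / (a + b) * s := by positivity
    have h7 := mul_le_mul_of_nonneg_left key (by positivity : 0 ≤ 2 * r)
    linarith
  · simp only [one_mul, sub_self, zero_mul, neg_zero, mul_zero, add_zero] at *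
    have hb : 0 ≤ -b := by linarith
    have : 0 ≤ g * d := mul_nonneg (hb.trans hgb) hd2
    positivity
  · simp only [zero_mul, sub_zero, one_mul, mul_zero, zero_add] at *
    have ha : a ≤ 0 := not_lt.1 h1
    have hb : 0 ≤ b := by linarith
    have : 0 ≤ g * d := mul_nonneg_of_nonpos_of_nonpos (hga.trans ha) hd1
    positivity

/-- State of double greedy on the box `[0, z]` after `k` steps of length `h`: the comparison point,
initially `q`, has been moved to a point `m` between the lower vector `x` and the upper vector `y`;
`e` bounds the error of one step. -/
def DGInv (F : Vec n → ℝ) (z q : Vec n) (h e : ℝ) (k : ℕ) (x y : Vec n) : Prop :=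
  ∃ m : Vec n, (∀ i, 0 ≤ x i ∧ x i ≤ m i ∧ m i ≤ y i ∧ y i ≤ z i ∧ y i - x i = (1 - k * h) * z i) ∧
    ∀ r : ℝ, 0 ≤ r → F 0 + r ^ 2 * F z + 2 * r * F q - k * ((1 + r) ^ 2 * e) ≤
      F x + r ^ 2 * F y + 2 * r * F m

theorem DGInv.zero {F : Vec n → ℝ} {z q : Vec n} {h e : ℝ} (hq : ∀ i, 0 ≤ q i ∧ q i ≤ z i) :
    DGInv F z q h e 0 0 z :=
  ⟨q, fun i => ⟨by simp, by simpa using (hq i).1, (hq i).2, le_rfl, by simp⟩, fun r _ => by simp⟩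

theorem DGInv.mem_cube {F : Vec n → ℝ} {z q : Vec n} {h e : ℝ} {k : ℕ} {x y : Vec n}
    (hz : z ∈ cube n) (hi : DGInv F z q h e k x y) : x ∈ cube n ∧ y ∈ cube n := by
  obtain ⟨m, hm, -⟩ := hi
  exact ⟨fun i => ⟨(hm i).1, by linarith [hm i, (hz i).2]⟩,
    fun i => ⟨by linarith [hm i], by linarith [hm i, (hz i).2]⟩⟩

theorem DGInv.lower_mem {γ L : ℝ} {P : Set (Vec n)} {O : Oracle n} (I : IsInstance γ L P O)
    {F : Vec n → ℝ} {z q : Vec n} {h e : ℝ} {k : ℕ} {x y : Vec n}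
    (hz : z ∈ P) (hi : DGInv F z q h e k x y) : x ∈ P := by
  obtain ⟨m, hm, -⟩ := hi
  exact I.downClosed z hz x fun i => ⟨(hm i).1, by linarith [hm i]⟩

theorem DGInv.step {L : ℝ} {P : Set (Vec n)} {O : Oracle n} (I : IsInstance 1 L P O)
    {z q : Vec n} (hz : z ∈ P) {h : ℝ} (hh : 0 ≤ h) {k : ℕ} (hk : (k + 1) * h ≤ 1) {x y : Vec n}
    (hi : DGInv O.value z q h (h ^ 2 * (L * Metric.diam P ^ 2)) k x y) {p : Fin n → ℝ}
    (hp : ∀ i, p i = dgRatio (O.grad x i) (0 - O.grad y i)) :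
    DGInv O.value z q h (h ^ 2 * (L * Metric.diam P ^ 2)) (k + 1)
      (WithLp.toLp 2 fun i => x i + p i * (h * z i))
      (WithLp.toLp 2 fun i => y i - (1 - p i) * (h * z i)) := by
  have H := I.isSmoothDR
  have hzc := I.subset_cube hz
  obtain ⟨hxc, hyc⟩ := hi.mem_cube hzc
  obtain ⟨m, hm, hF⟩ := hi
  have hp01 : ∀ i, 0 ≤ p i ∧ p i ≤ 1 := fun i => by rw [hp i]; exact dgRatio_mem _ _
  have hmc : m ∈ cube n := fun i => ⟨by linarith [hm i], by linarith [hm i, (hzc i).2]⟩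
  set x' : Vec n := WithLp.toLp 2 fun i => x i + p i * (h * z i) with hx'
  set y' : Vec n := WithLp.toLp 2 fun i => y i - (1 - p i) * (h * z i) with hy'
  set m' : Vec n := WithLp.toLp 2 fun i => max (x' i) (min (m i) (y' i)) with hm'
  have hs : ∀ i, 0 ≤ h * z i := fun i => mul_nonneg hh (hzc i).1
  have hps : ∀ i, 0 ≤ p i * (h * z i) := fun i => mul_nonneg (hp01 i).1 (hs i)
  have hqs : ∀ i, 0 ≤ (1 - p i) * (h * z i) := fun i =>
    mul_nonneg (sub_nonneg.2 (hp01 i).2) (hs i)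
  have ex : ∀ i, x' i = x i + p i * (h * z i) := fun i => rfl
  have ey : ∀ i, y' i = y i - (1 - p i) * (h * z i) := fun i => rfl
  have em : ∀ i, m' i = max (x' i) (min (m i) (y' i)) := fun i => rfl
  have hxy' : ∀ i, y' i - x' i = (1 - ((k + 1 : ℕ) : ℝ) * h) * z i := fun i => by
    rw [ex, ey]; push_cast; linarith [(hm i).2.2.2.2]
  have hxy'' : ∀ i, x' i ≤ y' i := fun i => by
    have : 0 ≤ (1 - ((k + 1 : ℕ) : ℝ) * h) * z i :=
      mul_nonneg (by push_cast; linarith) (hzc i).1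
    linarith [hxy' i]
  have hb : ∀ i, x' i ≤ m' i ∧ m' i ≤ y' i := fun i => by
    rw [em]
    exact ⟨le_max_left _ _, max_le (hxy'' i) (min_le_right _ _)⟩
  have hd : ∀ i, m' i - m i ≤ p i * (h * z i) ∧ -((1 - p i) * (h * z i)) ≤ m' i - m i := by
    intro i
    have h1 := hm i
    rw [em]
    constructor
    · have : max (x' i) (min (m i) (y' i)) ≤ m i + p i * (h * z i) := by
        refine max_le (by rw [ex]; linarith) ((min_le_left _ _).trans (by linarith [hps i]))
      linarith
    · have : m i - (1 - p i) * (h * z i) ≤ min (m i) (y' i) := by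
        refine le_min (by linarith [hqs i]) (by rw [ey]; linarith)
      linarith [le_max_right (x' i) (min (m i) (y' i))]
  have hbase : ∀ i, 0 ≤ x' i ∧ y' i ≤ z i := fun i => by
    rw [ex, ey]; exact ⟨by linarith [hps i, hm i], by linarith [hqs i, hm i]⟩
  have hx'c : x' ∈ cube n := fun i => ⟨(hbase i).1, by
    linarith [hxy'' i, hbase i, (hzc i).2]⟩
  have hy'c : y' ∈ cube n := fun i => ⟨by linarith [hxy'' i, hbase i], by
    linarith [hbase i, (hzc i).2]⟩
  have hm'c : m' ∈ cube n := fun i => ⟨by linarith [hb i, hbase i], by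
    linarith [hbase i, hb i, (hzc i).2]⟩
  refine ⟨m', fun i => ⟨(hbase i).1, (hb i).1, (hb i).2, (hbase i).2, hxy' i⟩, fun r hr => ?_⟩
  have hnorm : ∀ v : Vec n, (∀ i, |v i| ≤ h * z i) → ‖v‖ ≤ h * Metric.diam P := by
    intro v hv
    have h1 : ‖v‖ ≤ ‖h • z‖ := norm_le_norm_of_abs_le (by simpa using hv)
    rw [norm_smul, Real.norm_of_nonneg hh] at h1
    exact h1.trans (mul_le_mul_of_nonneg_left (I.norm_le hz) hh)
  have bx := I.lower_bound (v := x' - x) hxc (by simpa using hx'c) (hnorm _ fun i => by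
    have : (x' - x) i = p i * (h * z i) := by simp [ex]
    rw [this, abs_of_nonneg (hps i)]
    exact mul_le_of_le_one_left (hs i) (hp01 i).2)
  have bY := I.lower_bound (v := y' - y) hyc (by simpa using hy'c) (hnorm _ fun i => by
    have : (y' - y) i = -((1 - p i) * (h * z i)) := by simp [ey]
    rw [this, abs_neg, abs_of_nonneg (hqs i)]
    exact mul_le_of_le_one_left (hs i) (by linarith [hp01 i]))
  have bm := I.lower_bound (v := m' - m) hmc (by simpa using hm'c) (hnorm _ fun i => by
    have : (m' - m) i = m' i - m i := by simp
    rw [this, abs_le]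
    have h1 := hd i
    have h2 := hs i
    have h3 := hp01 i
    constructor <;> nlinarith)
  simp only [add_sub_cancel] at bx bY bm
  have hsum : 0 ≤ inner ℝ (O.grad x) (x' - x) + r ^ 2 * inner ℝ (O.grad y) (y' - y) +
      2 * r * inner ℝ (O.grad m) (m' - m) := by
    rw [inner_eq_sum, inner_eq_sum, inner_eq_sum, Finset.mul_sum, Finset.mul_sum,
      ← Finset.sum_add_distrib, ← Finset.sum_add_distrib]
    refine Finset.sum_nonneg fun i _ => ?_
    have h1 := H.grad_anti hxc hmc (fun j => (hm j).2.1) i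
    have h2 := H.grad_anti hmc hyc (fun j => (hm j).2.2.1) i
    have h3 := dgRatio_gain (a := O.grad x i) (b := 0 - O.grad y i) (g := O.grad m i)
      (s := h * z i) (d := m' i - m i) (r := r) (by linarith) h1 (hs i) hr
      (by rw [← hp i]; exact (hd i).1) (by rw [← hp i]; exact (hd i).2)
    rw [← hp i] at h3
    have e1 : (x' - x) i = p i * (h * z i) := by simp [ex]
    have e2 : (y' - y) i = -((1 - p i) * (h * z i)) := by simp [ey]
    have e3 : (m' - m) i = m' i - m i := by simp
    rw [e1, e2, e3]
    linarith
  have h0 := hF r hr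
  have b2 := mul_le_mul_of_nonneg_left bY (sq_nonneg r)
  have b3 := mul_le_mul_of_nonneg_left bm (by positivity : 0 ≤ 2 * r)
  push_cast
  nlinarith

/-- Guarantee of double greedy, for all weights `r` at once. -/
theorem DGInv.final {F : Vec n → ℝ} {z q : Vec n} {h e : ℝ} {N : ℕ} (hN : N * h = 1) {x y : Vec n}
    (hi : DGInv F z q h e N x y) {r : ℝ} (hr : 0 ≤ r) :
    F 0 + r ^ 2 * F z + 2 * r * F q - N * ((1 + r) ^ 2 * e) ≤ (1 + r) ^ 2 * F x := by
  obtain ⟨m, hm, hF⟩ := hi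
  have e1 : m = x := by
    ext i; have := hm i; rw [hN] at this; linarith
  have e2 : y = x := by
    ext i; have := hm i; rw [hN] at this; linarith
  have := hF r hr
  rw [e1, e2] at this
  linarith

/-! ### Local search -/

/-- `z` is a point of `P` that is locally optimal towards `o`, up to an error `e`, in the form in
which local optimality is used. -/
def LocalOpt (F : Vec n → ℝ) (P : Set (Vec n)) (o : Vec n) (e : ℝ) (z : Vec n) : Prop :=
  z ∈ P ∧ F (psum z o) + F (had z o) ≤ 2 * F z + e

/-- State of the Frank-Wolfe local search in `{y ∈ P | b ≤ ⟨a, y⟩}` after `k` steps: the current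
point is `x`, and the best point found so far is `q`, with linear gap at most `g`. -/
def LSInv (F : Vec n → ℝ) (G : Vec n → Vec n) (P : Set (Vec n)) (a : Vec n) (b h e : ℝ) (k : ℕ)
    (x : Vec n) (g : ℝ) (q : Vec n) : Prop :=
  (x ∈ P ∧ b ≤ inner ℝ a x) ∧ k * (h * g - h ^ 2 * e) ≤ F x ∧
    (0 < k → q ∈ P ∧ b ≤ inner ℝ a q ∧
      ∀ y ∈ P, b ≤ inner ℝ a y → inner ℝ (G q) (y - q) ≤ g)

section

variable {γ L : ℝ} {P : Set (Vec n)} {O : Oracle n}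

theorem LSInv.step (I : IsInstance γ L P O) {a x q s : Vec n} {b h g g' : ℝ} {k : ℕ} {q' : Vec n}
    (hh : h ∈ Set.Icc (0 : ℝ) 1)
    (hi : LSInv O.value O.grad P a b h (L * Metric.diam P ^ 2) k x g q)
    (hs : s ∈ P) (hsb : b ≤ inner ℝ a s)
    (hmax : ∀ y ∈ P, b ≤ inner ℝ a y → inner ℝ (O.grad x) y ≤ inner ℝ (O.grad x) s)
    (hg : (g' = inner ℝ (O.grad x) (s - x) ∧ q' = x ∧ (0 < k → g' ≤ g)) ∨
      (0 < k ∧ g' = g ∧ q' = q ∧ g ≤ inner ℝ (O.grad x) (s - x))) :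
    LSInv O.value O.grad P a b h (L * Metric.diam P ^ 2) (k + 1) (x + h • (s - x)) g' q' := by
  obtain ⟨⟨hxP, hxb⟩, hF, hq⟩ := hi
  have hm : x + h • (s - x) ∈ P := I.convexBody.2.1.add_smul_sub_mem hxP hs hh
  have hb := I.lower_bound (v := h • (s - x)) (c := h) (I.subset_cube hxP) (I.subset_cube hm) (by
    rw [norm_smul, Real.norm_of_nonneg hh.1]
    exact mul_le_mul_of_nonneg_left (I.norm_sub_le hs hxP) hh.1)
  rw [real_inner_smul_right] at hb
  have hgap : g' ≤ inner ℝ (O.grad x) (s - x) := by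
    rcases hg with h | h
    · exact h.1.le
    · exact h.2.1.le.trans h.2.2.2
  have hkg : (k : ℝ) * g' ≤ k * g := by
    rcases Nat.eq_zero_or_pos k with h0 | h0
    · simp [h0]
    · refine mul_le_mul_of_nonneg_left ?_ (Nat.cast_nonneg k)
      rcases hg with h | h
      · exact h.2.2 h0
      · exact h.2.1.le
  refine ⟨⟨hm, ?_⟩, ?_, fun _ => ?_⟩
  · rw [inner_add_right, real_inner_smul_right, inner_sub_right]
    nlinarith [hh.1, hh.2, mul_le_mul_of_nonneg_left hsb hh.1,
      mul_le_mul_of_nonneg_left hxb (sub_nonneg.2 hh.2)]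
  · push_cast
    nlinarith [mul_le_mul_of_nonneg_left hgap hh.1, mul_le_mul_of_nonneg_left hkg hh.1]
  · rcases hg with ⟨h1, h2, -⟩ | ⟨h0, h1, h2, -⟩
    · subst h2
      refine ⟨hxP, hxb, fun y hy hyb => ?_⟩
      rw [h1, inner_sub_right, inner_sub_right]
      linarith [hmax y hy hyb]
    · rw [h1, h2]
      exact hq h0

/-- The values along the search never exceed `F o`, so that after `N²` steps the smallest linear gap
is at most `h (F o + e)`, and `gap_ge` applies. -/
theorem LSInv.localOpt {L : ℝ} (I : IsInstance 1 L P O) {a x q o : Vec n} {b h g : ℝ} {N : ℕ}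
    (hN : N * h = 1) (hi : LSInv O.value O.grad P a b h (L * Metric.diam P ^ 2) (N * N) x g q)
    (ho : o ∈ P) (hmax : ∀ y ∈ P, O.value y ≤ O.value o) (hob : b ≤ inner ℝ a o) :
    LocalOpt O.value P o (h * (O.value o + L * Metric.diam P ^ 2)) q := by
  obtain ⟨⟨hxP, -⟩, hF, hq⟩ := hi
  have hN0 : 0 < N := Nat.pos_of_ne_zero (by rintro rfl; simp at hN)
  have hN0' : (0 : ℝ) < N := Nat.cast_pos.2 hN0
  obtain ⟨hqP, -, hgap⟩ := hq (Nat.mul_pos hN0 hN0)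
  have h1 := hF.trans (hmax x hxP)
  have hh : h = 1 / N := by field_simp; linarith
  have h2 : g ≤ h * (O.value o + L * Metric.diam P ^ 2) := by
    rw [hh] at h1 ⊢
    push_cast at h1
    have : (N : ℝ) * N * (1 / N * g - (1 / N) ^ 2 * (L * Metric.diam P ^ 2)) =
      N * g - L * Metric.diam P ^ 2 := by field_simp
    rw [this] at h1
    rw [one_div, inv_mul_eq_div, le_div_iff₀ hN0']
    linarith
  have h3 := I.isSmoothDR.gap_ge (I.subset_cube hqP) (I.subset_cube ho)
  exact ⟨hqP, by linarith [hgap o ho hob]⟩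

/-! ### Continuous greedy aided by a local optimum -/

/-- `y` is a nonnegative vector below a combination of points of `P` of total weight `c`. -/
def BelowWeight (P : Set (Vec n)) (c : ℝ) (y : Vec n) : Prop :=
  (∀ i, 0 ≤ y i) ∧ ∃ p ∈ P, ∀ i, y i ≤ c * p i

theorem BelowWeight.zero (I : IsInstance γ L P O) (c : ℝ) : BelowWeight P c 0 :=
  ⟨by simp, 0, I.zero_mem, by simp⟩

theorem BelowWeight.mem (I : IsInstance γ L P O) {c : ℝ} {y : Vec n} (hy : BelowWeight P c y)
    (hc : c ≤ 1) : y ∈ P := by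
  obtain ⟨h0, p, hp, h1⟩ := hy
  exact I.mem_of_le_smul hp hc h0 h1

theorem BelowWeight.mono (I : IsInstance γ L P O) {c c' : ℝ} {y : Vec n} (hy : BelowWeight P c y)
    (hc : c ≤ c') : BelowWeight P c' y := by
  obtain ⟨h0, p, hp, h1⟩ := hy
  exact ⟨h0, p, hp, fun i => (h1 i).trans
    (mul_le_mul_of_nonneg_right hc (I.subset_cube hp i).1)⟩

theorem BelowWeight.add (I : IsInstance γ L P O) {c h : ℝ} (hc : 0 ≤ c) (hh : 0 < h)
    {y y' w : Vec n} (hy : BelowWeight P c y) (hw : w ∈ P) (h0 : ∀ i, 0 ≤ y' i)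
    (hy' : ∀ i, y' i ≤ y i + h * w i) : BelowWeight P (c + h) y' := by
  obtain ⟨-, p, hp, h1⟩ := hy
  obtain ⟨q, hq, h2⟩ := I.exists_smul_add hp hw hc hh
  exact ⟨h0, q, hq, fun i => by linarith [hy' i, h1 i, h2 i]⟩

end

section

variable {L : ℝ} {P : Set (Vec n)} {O : Oracle n}

/-- State after `k` steps of the first phase, which avoids `z`: the solution is
`y = (1 - z) ⊙ u`. -/
def AvoidInv (F : Vec n → ℝ) (z o : Vec n) (h e : ℝ) (k : ℕ) (u y : Vec n) : Prop :=
  u ∈ cube n ∧ y = had (compl z) u ∧ (∀ i, u i ≤ 1 - (1 - h) ^ k) ∧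
    (1 - (1 - h) ^ k) * (F o - F (had z o) - F (psum z o)) + k * h * (1 - h) ^ k * F (psum z o)
      - k * (h ^ 2 * e) ≤ F y

theorem AvoidInv.zero {F : Vec n → ℝ} {z o : Vec n} {h e : ℝ} (hF : 0 ≤ F 0) :
    AvoidInv F z o h e 0 0 0 :=
  ⟨zero_mem_cube, by ext i; simp, by simp, by simpa using hF⟩

theorem one_sub_pow_mem {h : ℝ} (hh : h ∈ Set.Icc (0 : ℝ) 1) (k : ℕ) :
    1 - (1 - h) ^ k ∈ Set.Icc (0 : ℝ) 1 := by
  have h1 : 0 ≤ (1 - h) ^ k := pow_nonneg (by linarith [hh.2]) k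
  have h2 : (1 - h) ^ k ≤ 1 := pow_le_one₀ (by linarith [hh.2]) (by linarith [hh.1])
  constructor <;> linarith

/-- The bound `1 - (1 - h)^k` on the coordinates is preserved by a measured greedy step. -/
theorem psum_smul_le {u w : Vec n} {h : ℝ} {k : ℕ} (hh : h ∈ Set.Icc (0 : ℝ) 1)
    (hw : w ∈ cube n) (hu : ∀ i, u i ≤ 1 - (1 - h) ^ k) (i : Fin n) :
    u i + h * ((1 - u i) * w i) ≤ 1 - (1 - h) ^ (k + 1) := by
  have h1 := hu i
  have h2 := hw i
  have h0 : 0 ≤ (1 - h) ^ k := pow_nonneg (by linarith [hh.2]) k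
  have h3 : 0 ≤ 1 - h * w i := by
    have : h * w i ≤ 1 := mul_le_one₀ hh.2 h2.1 h2.2
    linarith
  have h4 : 1 - (u i + h * ((1 - u i) * w i)) = (1 - u i) * (1 - h * w i) := by ring
  have h5 : (1 - h) ^ (k + 1) ≤ (1 - u i) * (1 - h * w i) := by
    rw [pow_succ]
    apply mul_le_mul (by linarith) _ (by linarith [hh.2]) (by linarith)
    have := mul_le_mul_of_nonneg_left h2.2 hh.1
    linarith
  linarith

theorem norm_had_le {x w : Vec n} (hx : x ∈ cube n) (hw : w ∈ cube n) : ‖had x w‖ ≤ ‖w‖ :=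
  norm_le_norm_of_abs_le fun i => by
    rw [had_apply, abs_of_nonneg (mul_nonneg (hx i).1 (hw i).1)]
    exact mul_le_of_le_one_left (hw i).1 (hx i).2

theorem step_mem_cube {u w : Vec n} {h : ℝ} (hh : h ∈ Set.Icc (0 : ℝ) 1) (hu : u ∈ cube n)
    (hw : w ∈ cube n) : (WithLp.toLp 2 fun i => u i + h * ((1 - u i) * w i) : Vec n) ∈ cube n := by
  intro i
  have h1 := hu i
  have h2 := hw i
  have h3 : 0 ≤ (1 - u i) * w i := mul_nonneg (by linarith) h2.1
  have h4 : (1 - u i) * w i ≤ 1 - u i := mul_le_of_le_one_right (by linarith) h2.2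
  change 0 ≤ u i + h * ((1 - u i) * w i) ∧ u i + h * ((1 - u i) * w i) ≤ 1
  have h5 := mul_nonneg hh.1 h3
  have h6 : h * ((1 - u i) * w i) ≤ (1 - u i) * w i := mul_le_of_le_one_left h3 hh.2
  constructor <;> linarith

theorem AvoidInv.step (I : IsInstance 1 L P O) {z o u y w : Vec n} {h : ℝ} {k : ℕ}
    (hh : h ∈ Set.Icc (0 : ℝ) 1) (hz : z ∈ cube n) (ho : o ∈ P)
    (hi : AvoidInv O.value z o h (L * Metric.diam P ^ 2) k u y) {c : Vec n}
    (hc : c = had (had (compl z) (compl u)) (O.grad y))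
    (hw : w ∈ P) (hmax : ∀ y ∈ P, inner ℝ c y ≤ inner ℝ c w) {u' y' : Vec n}
    (hu' : u' = WithLp.toLp 2 fun i => u i + h * ((1 - u i) * w i))
    (hy' : y' = WithLp.toLp 2 fun i => (1 - z i) * u' i) :
    AvoidInv O.value z o h (L * Metric.diam P ^ 2) (k + 1) u' y' := by
  have H := I.isSmoothDR
  obtain ⟨hu, hy, huc, hF⟩ := hi
  have hoc := I.subset_cube ho
  have hwc := I.subset_cube hw
  have hcz := compl_mem_cube hz
  have hcu := compl_mem_cube hu
  have hu'c : u' ∈ cube n := by rw [hu']; exact step_mem_cube hh hu hwc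
  have hy'c : y' ∈ cube n := by rw [hy']; exact had_mem_cube hcz hu'c
  have hyc : y ∈ cube n := by rw [hy]; exact had_mem_cube hcz hu
  have e1 : y' = y + h • had (had (compl z) (compl u)) w := by
    ext i; simp [hy', hu', hy]; ring
  have hb := I.lower_bound (v := h • had (had (compl z) (compl u)) w) (c := h) hyc
    (by rw [← e1]; exact hy'c) (by
      rw [norm_smul, Real.norm_of_nonneg hh.1]
      exact mul_le_mul_of_nonneg_left
        ((norm_had_le (had_mem_cube hcz hcu) hwc).trans (I.norm_le hw)) hh.1)
  rw [← e1, real_inner_smul_right] at hb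
  have e2 : ∀ v, inner ℝ c v = inner ℝ (O.grad y) (had (had (compl z) (compl u)) v) := by
    intro v
    rw [hc, inner_eq_sum, inner_eq_sum]
    exact Finset.sum_congr rfl fun i _ => by simp; ring
  have h1 := hmax o ho
  rw [e2, e2] at h1
  have e3 : y + had (had (compl z) (compl u)) o = had (compl z) (psum u o) := by
    ext i; simp [hy]; ring
  have h2 := H.le_inner (v := had (had (compl z) (compl u)) o) hyc
    (by rw [e3]; exact had_mem_cube hcz (psum_mem_cube hu hoc))
    (fun i => (had_mem_cube (had_mem_cube hcz hcu) hoc i).1)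
  have e4 : had (compl z) o + had (had (compl z) (compl o)) u = had (compl z) (psum u o) := by
    ext i; simp; ring
  have h3 := H.avoid_lower (x := had (compl z) o) (had_mem_cube hcz hoc) hz hoc hu
    (fun i => by simpa using mul_le_of_le_one_left (hoc i).1 (hcz i).2)
    (one_sub_pow_mem hh k) huc
  rw [e4, ← e3] at h3
  have h4 := H.compl_had_ge hz hoc
  have h5 : O.value o - O.value (had z o) - (1 - (1 - h) ^ k) * O.value (psum z o) - O.value y ≤
      inner ℝ (O.grad y) (had (had (compl z) (compl u)) w) := by linarith
  have h6 := mul_le_mul_of_nonneg_left h5 hh.1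
  have h7 := mul_le_mul_of_nonneg_left hF (sub_nonneg.2 hh.2)
  have h8 := I.smoothness_nonneg
  have h9 := H.nonneg _ (psum_mem_cube hz hoc)
  have hp : 0 ≤ (1 - h) ^ k := pow_nonneg (by linarith [hh.2]) k
  refine ⟨hu'c, hy', fun i => by rw [hu']; exact psum_smul_le hh hwc huc i, ?_⟩
  have h10 : 0 ≤ h * (h * ((1 - h) ^ k * O.value (psum z o))) := by have := hh.1; positivity
  have h11 : 0 ≤ (k : ℝ) * (h * (h ^ 2 * (L * Metric.diam P ^ 2))) := by have := hh.1; positivity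
  push_cast
  rw [pow_succ]
  nlinarith

/-- After the first phase the value at `o` has dropped by at most a fraction of `F (z ⊕ o)`. -/
theorem AvoidInv.psum_ge {F : Vec n → ℝ} {G : Vec n → Vec n} (H : IsSmoothDR L F G)
    {z o u y : Vec n} {h e : ℝ} {k : ℕ} (hh : h ∈ Set.Icc (0 : ℝ) 1) (hz : z ∈ cube n)
    (ho : o ∈ cube n) (hi : AvoidInv F z o h e k u y) :
    F o - (1 - (1 - h) ^ k) * F (psum z o) ≤ F (psum y o) := by
  obtain ⟨hu, hy, huc, -⟩ := hi
  have h3 := H.avoid_lower ho hz ho hu (fun i => le_rfl) (one_sub_pow_mem hh k) huc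
  have e : o + had (had (compl z) (compl o)) u = psum y o := by
    ext i; simp [hy]; ring
  rwa [e] at h3

theorem AvoidInv.le {F : Vec n → ℝ} {z o u y : Vec n} {h e : ℝ} {k : ℕ} (hz : z ∈ cube n)
    (hi : AvoidInv F z o h e k u y) (i : Fin n) : y i ≤ 1 - (1 - h) ^ k := by
  obtain ⟨hu, hy, huc, -⟩ := hi
  rw [hy]
  exact (mul_le_of_le_one_left (hu i).1 (compl_mem_cube hz i).2).trans (huc i)

/-- State after `k` steps of the second phase, with the guesses `U` and `Y`; `V` is the guaranteed
value of `F (y ⊕ o)`, and `E` its next increment. The first phase had `m` steps and ended with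
value at least `f`. -/
def ReachInv (F : Vec n → ℝ) (o : Vec n) (h e : ℝ) (m : ℕ) (U Y f : ℝ) (k : ℕ) (y : Vec n)
    (V E : ℝ) : Prop :=
  V = (1 - h) ^ k * U + k * h * (1 - h) ^ (k + m - 1) * Y ∧ E = h * (1 - h) ^ (k + m) * Y ∧
    (∀ i, 0 ≤ y i ∧ y i ≤ 1 - (1 - h) ^ (k + m)) ∧ V ≤ F (psum y o) ∧
    (1 - h) ^ k * f + k * h * (1 - h) ^ (k - 1) * U +
      h ^ 2 * (k * (k - 1) / 2) * (1 - h) ^ (k + m) * Y - k * (h ^ 2 * e) ≤ F y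

theorem ReachInv.mem_cube {F : Vec n → ℝ} {o : Vec n} {h e : ℝ} {m : ℕ} {U Y f : ℝ} {k : ℕ}
    {y : Vec n} {V E : ℝ} (hh : h ∈ Set.Icc (0 : ℝ) 1) (hi : ReachInv F o h e m U Y f k y V E) :
    y ∈ cube n := fun i =>
  ⟨(hi.2.2.1 i).1, (hi.2.2.1 i).2.trans (one_sub_pow_mem hh _).2⟩

/-- With correct guesses, the point `o` satisfies the constraint of the local search. -/
theorem ReachInv.feasible {F : Vec n → ℝ} {G : Vec n → Vec n} (H : IsSmoothDR L F G)
    {o : Vec n} {h e : ℝ} {m : ℕ} {U Y f : ℝ} {k : ℕ} {y : Vec n} {V E : ℝ}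
    (hh : h ∈ Set.Icc (0 : ℝ) 1) (ho : o ∈ cube n) (hi : ReachInv F o h e m U Y f k y V E) :
    V - F y ≤ inner ℝ (had (compl y) (G y)) o := by
  have hy := hi.mem_cube hh
  have h1 := H.le_inner (v := had (compl y) o) hy
    (by rw [← psum_eq_add]; exact psum_mem_cube hy ho)
    (fun i => (had_mem_cube (compl_mem_cube hy) ho i).1)
  rw [← psum_eq_add] at h1
  have e2 : inner ℝ (had (compl y) (G y)) o = inner ℝ (G y) (had (compl y) o) := by
    rw [inner_eq_sum, inner_eq_sum]
    exact Finset.sum_congr rfl fun i _ => by simp; ring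
  rw [e2]
  linarith [hi.2.2.2.1]

theorem ReachInv.step (I : IsInstance 1 L P O) {o y w : Vec n} {h : ℝ} {m : ℕ} {U Y f : ℝ} {k : ℕ}
    {V E : ℝ} (hh : h ∈ Set.Icc (0 : ℝ) 1) (ho : o ∈ cube n) (hY : 0 ≤ Y)
    (hi : ReachInv O.value o h (L * Metric.diam P ^ 2) m U Y f k y V E)
    (hw : w ∈ P) (hwb : V - O.value y ≤ inner ℝ (had (compl y) (O.grad y)) w)
    (hwo : Y ≤ O.value (psum w o)) :
    ReachInv O.value o h (L * Metric.diam P ^ 2) m U Y f (k + 1)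
      (WithLp.toLp 2 fun i => y i + h * ((1 - y i) * w i)) ((1 - h) * V + E) ((1 - h) * E) := by
  have H := I.isSmoothDR
  have hy := hi.mem_cube hh
  obtain ⟨hV, hE, hyc, hVF, hF⟩ := hi
  have hwc := I.subset_cube hw
  set y' : Vec n := WithLp.toLp 2 fun i => y i + h * ((1 - y i) * w i) with hy'
  have hy'c : y' ∈ cube n := step_mem_cube hh hy hwc
  have e1 : y' = y + h • had (compl y) w := by ext i; simp [hy']
  have hb := I.lower_bound (v := h • had (compl y) w) (c := h) hy
    (by rw [← e1]; exact hy'c) (by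
      rw [norm_smul, Real.norm_of_nonneg hh.1]
      exact mul_le_mul_of_nonneg_left
        ((norm_had_le (compl_mem_cube hy) hwc).trans (I.norm_le hw)) hh.1)
  rw [← e1, real_inner_smul_right] at hb
  have e2 : inner ℝ (had (compl y) (O.grad y)) w = inner ℝ (O.grad y) (had (compl y) w) := by
    rw [inner_eq_sum, inner_eq_sum]
    exact Finset.sum_congr rfl fun i _ => by simp; ring
  rw [e2] at hwb
  have hp : ∀ j, 0 ≤ (1 - h) ^ j := fun j => pow_nonneg (by linarith [hh.2]) j
  have hpow : (k : ℝ) * h * (1 - h) ^ (k + m - 1) * (1 - h) = k * h * (1 - h) ^ (k + m) := by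
    rcases Nat.eq_zero_or_pos k with h0 | h0
    · simp [h0]
    · rw [mul_assoc _ _ (1 - h), ← pow_succ, Nat.sub_add_cancel (by omega)]
  have hpow' : (k : ℝ) * h * (1 - h) ^ (k - 1) * (1 - h) = k * h * (1 - h) ^ k := by
    rcases Nat.eq_zero_or_pos k with h0 | h0
    · simp [h0]
    · rw [mul_assoc _ _ (1 - h), ← pow_succ, Nat.sub_add_cancel (by omega)]
  refine ⟨?_, ?_, fun i => ⟨(hy'c i).1, ?_⟩, ?_, ?_⟩
  · rw [hV, hE]
    have e3 : k + 1 + m - 1 = k + m := by omega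
    rw [e3, pow_succ]
    push_cast
    linear_combination Y * hpow
  · rw [hE]
    have e3 : k + 1 + m = k + m + 1 := by omega
    rw [e3, pow_succ]; ring
  · have := psum_smul_le hh hwc (fun i => (hyc i).2) i
    rw [show k + 1 + m = k + m + 1 by omega]
    exact this
  · have h1 := H.psum_step (psum_mem_cube hy ho) hwc hh
    have h2 := H.psum_lower (x := psum w o) (psum_mem_cube hwc ho) hy (one_sub_pow_mem hh (k + m))
      (fun i => (hyc i).2)
    have e3 : psum (psum y o) w = psum y (psum w o) := by ext i; simp; ring
    have e4 : psum (h • w) (psum y o) = psum y' o := by ext i; simp [hy']; ring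
    rw [e3, e4] at h1
    have h3 := mul_le_mul_of_nonneg_left hVF (sub_nonneg.2 hh.2)
    have h4 := mul_le_mul_of_nonneg_left h2 hh.1
    have h5 := mul_le_mul_of_nonneg_left (mul_le_mul_of_nonneg_left hwo (hp (k + m))) hh.1
    rw [hE]
    linarith
  · have h6 := mul_le_mul_of_nonneg_left hwb hh.1
    have h7 := mul_le_mul_of_nonneg_left hF (sub_nonneg.2 hh.2)
    have h8 := I.smoothness_nonneg
    have h11 : 0 ≤ (k : ℝ) * (h * (h ^ 2 * (L * Metric.diam P ^ 2))) := by
      have := hh.1; positivity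
    -- the closed form of `V` only uses the weaker exponent `k + m`
    have h12 : (1 - h) ^ k * U + k * h * (1 - h) ^ (k + m) * Y ≤ V := by
      rw [hV, ← hpow]
      have h13 : 0 ≤ (k : ℝ) * h * (1 - h) ^ (k + m - 1) * Y := by
        have := hp (k + m - 1); have := hh.1; positivity
      nlinarith [mul_nonneg h13 hh.1]
    have h14 := mul_le_mul_of_nonneg_left h12 hh.1
    have h15 : 0 ≤ h * (k * h * (h * ((1 - h) ^ (k + m) * Y))) := by
      have := hh.1; have := hp (k + m); positivity
    rw [show k + 1 + m = k + m + 1 by omega, Nat.add_sub_cancel, pow_succ (1 - h) (k + m), pow_succ (1 - h) k]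
    push_cast
    have h16 : (1 - h) * ((1 - h) ^ k * f + k * h * (1 - h) ^ (k - 1) * U +
        h ^ 2 * (k * (k - 1) / 2) * (1 - h) ^ (k + m) * Y - k * (h ^ 2 * (L * Metric.diam P ^ 2)))
        = (1 - h) ^ k * (1 - h) * f + k * h * (1 - h) ^ k * U +
        h ^ 2 * (k * (k - 1) / 2) * ((1 - h) ^ (k + m) * (1 - h)) * Y -
        (1 - h) * (k * (h ^ 2 * (L * Metric.diam P ^ 2))) := by
      linear_combination U * hpow'
    rw [h16] at h7
    nlinarith

end

/-! ### The discretized coefficients and their limits -/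

/-- Discretized form of the coefficient `A_1`, for `N` steps of which `m` are in the first phase. -/
def discA (N m : ℕ) (h : ℝ) : ℝ :=
  (1 - h) ^ (N - m) * (1 - (1 - h) ^ m) + ((N - m : ℕ) : ℝ) * h * (1 - h) ^ (N - m - 1)

/-- Discretized form of the coefficient `B_1`. -/
def discB (N m : ℕ) (h : ℝ) : ℝ := -((1 - h) ^ (N - m) * (1 - (1 - h) ^ m))

/-- Discretized form of the coefficient `C_1`. -/
def discC (N m : ℕ) (h : ℝ) : ℝ :=
  (1 - h) ^ (N - m) * (-(1 - (1 - h) ^ m) + m * h * (1 - h) ^ m) -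
    ((N - m : ℕ) : ℝ) * h * (1 - h) ^ (N - m - 1) * (1 - (1 - h) ^ m) +
    h ^ 2 * (((N - m : ℕ) : ℝ) * (((N - m : ℕ) : ℝ) - 1) / 2) * (1 - h) ^ (N - m + m)

theorem coefA_one (t : ℝ) : coefA 1 t = Real.exp (t - 1) * (2 - t) - Real.exp (-1) := by
  simp [coefA]

theorem coefB_one (t : ℝ) : coefB 1 t = Real.exp (-1) - Real.exp (t - 1) := by
  simp [coefB]

theorem coefC_one (t : ℝ) :
    coefC 1 t = Real.exp (-1) * (2 - 2 * Real.exp t + t * Real.exp t + (1 - t) ^ 2 / 2) := by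
  simp [coefC]

theorem coefD_one (r : ℝ) : coefD 1 r = (2 * r + r ^ 2 / 2) / (r + 1) ^ 2 := by
  simp only [coefD, Real.one_rpow]; congr 1 <;> ring

theorem coefE_one (r : ℝ) : coefE 1 r = (r ^ 2 / 2) / (r + 1) ^ 2 := by
  simp only [coefE, Real.one_rpow]; congr 1 <;> ring

theorem one_sub_pow_approx {h : ℝ} (hh : h ∈ Set.Icc (0 : ℝ) 1) (k : ℕ) :
    |(1 - h) ^ k - Real.exp (-(k * h))| ≤ k * h * h := by
  have e : Real.exp (-(k * h)) = Real.exp (-h) ^ k := by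
    rw [← Real.exp_nat_mul]; congr 1; ring
  have h1 : 1 - h ≤ Real.exp (-h) := by linarith [Real.add_one_le_exp (-h)]
  have h2 : Real.exp (-h) - (1 - h) ≤ h * h := by
    have := (abs_le.1 (Real.abs_exp_sub_one_sub_id_le (x := -h)
      (by rw [abs_neg, abs_of_nonneg hh.1]; exact hh.2))).2
    nlinarith
  have h3 : Real.exp (-h) ≤ 1 := Real.exp_le_one_iff.2 (by linarith [hh.1])
  have h0 : 0 ≤ 1 - h := by linarith [hh.2]
  rw [e]
  induction k with
  | zero => simp
  | succ k ih =>
    have h4 : (1 - h) ^ k ≤ 1 := pow_le_one₀ h0 (by linarith [hh.1])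
    have h5 : 0 ≤ (1 - h) ^ k := pow_nonneg h0 k
    have h6 : (1 - h) ^ (k + 1) - Real.exp (-h) ^ (k + 1) =
        Real.exp (-h) * ((1 - h) ^ k - Real.exp (-h) ^ k) -
          (Real.exp (-h) - (1 - h)) * (1 - h) ^ k := by ring
    rw [h6]
    have := Real.exp_pos (-h)
    have i1 := ih (by
      rw [← Real.exp_nat_mul]; congr 1; ring)
    refine (abs_sub _ _).trans ?_
    rw [abs_mul, abs_mul, abs_of_pos this, abs_of_nonneg (sub_nonneg.2 h1), abs_of_nonneg h5]
    have a1 := mul_le_mul h3 i1 (abs_nonneg _) zero_le_one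
    have a2 := mul_le_mul h2 h4 h5 (mul_nonneg hh.1 hh.1)
    push_cast
    linarith

/-- Discretizations of arbitrarily high fineness with a fixed ratio of phase lengths approximate
the coefficients at `γ = 1`, uniformly in the further refinement `M`. -/
theorem exists_disc_approx {t ε : ℝ} (ht : t ∈ Set.Ioo (0 : ℝ) 1) (hε : 0 < ε) :
    ∃ N₀ m₀ : ℕ, 0 < N₀ ∧ m₀ ≤ N₀ ∧ ∀ M : ℕ, 0 < M → ∀ h : ℝ, ((N₀ * M : ℕ) : ℝ) * h = 1 →
      h ≤ ε ∧ |discA (N₀ * M) (m₀ * M) h - coefA 1 t| ≤ ε ∧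
        |discB (N₀ * M) (m₀ * M) h - coefB 1 t| ≤ ε ∧
        |discC (N₀ * M) (m₀ * M) h - coefC 1 t| ≤ ε := by
  set l : Filter (ℕ × ℕ) := atTop ×ˢ ⊤ with hl
  set N : ℕ × ℕ → ℕ := fun p => p.1 * (p.2 + 1) with hN
  set m : ℕ × ℕ → ℕ := fun p => ⌊t * p.1⌋₊ * (p.2 + 1) with hm
  set h : ℕ × ℕ → ℝ := fun p => 1 / (N p : ℝ) with hh
  have hfst : Tendsto (fun p : ℕ × ℕ => p.1) l atTop := tendsto_fst
  have hpos : ∀ᶠ p in l, 0 < p.1 := hfst.eventually (eventually_gt_atTop 0)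
  have hml : ∀ p : ℕ × ℕ, ⌊t * p.1⌋₊ ≤ p.1 := fun p =>
    Nat.floor_le_of_le (mul_le_of_le_one_left (Nat.cast_nonneg _) ht.2.le)
  have hmN : ∀ p, m p ≤ N p := fun p => Nat.mul_le_mul_right _ (hml p)
  have hh0 : ∀ p, 0 ≤ h p := fun p => by positivity
  have hhle : ∀ᶠ p in l, h p ≤ 1 / (p.1 : ℝ) := by
    filter_upwards [hpos] with p hp
    have : (0 : ℝ) < p.1 := Nat.cast_pos.2 hp
    refine one_div_le_one_div_of_le this ?_
    simp only [hN]
    push_cast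
    nlinarith [Nat.cast_nonneg (α := ℝ) p.2]
  have hinv : Tendsto (fun p : ℕ × ℕ => 1 / (p.1 : ℝ)) l (𝓝 0) :=
    tendsto_one_div_atTop_nhds_zero_nat.comp hfst
  have hlim : Tendsto h l (𝓝 0) :=
    tendsto_of_tendsto_of_tendsto_of_le_of_le' tendsto_const_nhds hinv
      (Eventually.of_forall hh0) hhle
  have hNh : ∀ᶠ p in l, (N p : ℝ) * h p = 1 := by
    filter_upwards [hpos] with p hp
    have : (N p : ℝ) ≠ 0 := Nat.cast_ne_zero.2 (Nat.mul_pos hp (Nat.succ_pos _)).ne'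
    simp only [hh]
    field_simp
  have hmh : Tendsto (fun p => (m p : ℝ) * h p) l (𝓝 t) := by
    have h1 : Tendsto (fun p : ℕ × ℕ => (⌊t * (p.1 : ℝ)⌋₊ : ℝ) / (p.1 : ℝ)) l (𝓝 t) :=
      (tendsto_nat_floor_mul_div_atTop ht.1.le).comp (tendsto_natCast_atTop_atTop.comp hfst)
    refine h1.congr' ?_
    filter_upwards [hpos] with p hp
    have : (p.1 : ℝ) ≠ 0 := Nat.cast_ne_zero.2 hp.ne'
    simp only [hh, hm, hN]
    push_cast
    field_simp
  have hKh : Tendsto (fun p => ((N p - m p : ℕ) : ℝ) * h p) l (𝓝 (1 - t)) := by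
    refine (tendsto_const_nhds.sub hmh).congr' ?_
    filter_upwards [hNh] with p hp
    rw [Nat.cast_sub (hmN p), sub_mul, hp]
  have hle1 : ∀ᶠ p in l, h p ≤ 1 := by
    filter_upwards [hlim.eventually (ge_mem_nhds zero_lt_one)] with p hp using hp
  have hpow : ∀ (k : ℕ × ℕ → ℕ) (s : ℝ), Tendsto (fun p => (k p : ℝ) * h p) l (𝓝 s) →
      Tendsto (fun p => (1 - h p) ^ k p) l (𝓝 (Real.exp (-s))) := by
    intro k s hk
    have h1 : Tendsto (fun p => Real.exp (-(k p * h p))) l (𝓝 (Real.exp (-s))) :=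
      (Real.continuous_exp.tendsto _).comp hk.neg
    have h2 : Tendsto (fun p => (k p : ℝ) * h p * h p) l (𝓝 0) := by
      simpa using hk.mul hlim
    have h3 : Tendsto (fun p => (1 - h p) ^ k p - Real.exp (-(k p * h p))) l (𝓝 0) := by
      refine squeeze_zero_norm' ?_ h2
      filter_upwards [hle1] with p hp
      exact one_sub_pow_approx ⟨hh0 p, hp⟩ _
    simpa using h3.add h1
  have pm := hpow m t hmh
  have pK := hpow (fun p => N p - m p) (1 - t) hKh
  have hK1 : ∀ᶠ p in l, 1 ≤ N p - m p := by
    have : ∀ᶠ p in l, 0 < ((N p - m p : ℕ) : ℝ) * h p :=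
      hKh.eventually (lt_mem_nhds (by linarith [ht.2]))
    filter_upwards [this] with p hp
    rcases Nat.eq_zero_or_pos (N p - m p) with h0 | h0
    · rw [h0] at hp; simp at hp
    · exact h0
  have pK1 := hpow (fun p => N p - m p - 1) (1 - t) (by
    have := hKh.sub hlim
    rw [sub_zero] at this
    refine this.congr' ?_
    filter_upwards [hK1] with p hp
    rw [Nat.cast_sub hp]; push_cast; ring)
  have pN := hpow (fun p => N p - m p + m p) 1 (by
    have := hKh.add hmh
    rw [sub_add_cancel] at this
    refine this.congr fun p => ?_
    push_cast; ring)
  have hq : Tendsto (fun p => h p ^ 2 * (((N p - m p : ℕ) : ℝ) * (((N p - m p : ℕ) : ℝ) - 1) / 2))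
      l (𝓝 ((1 - t) * (1 - t) / 2)) := by
    have := (hKh.mul (hKh.sub hlim)).div_const 2
    rw [sub_zero] at this
    exact this.congr fun p => by ring
  have e1 : Real.exp (-(1 - t)) = Real.exp (t - 1) := by congr 1; ring
  have e2 : Real.exp (t - 1) * Real.exp (-t) = Real.exp (-1) := by
    rw [← Real.exp_add]; congr 1; ring
  have e3 : Real.exp (t - 1) = Real.exp (-1) * Real.exp t := by
    rw [← Real.exp_add]; congr 1; ring
  rw [e1] at pK pK1
  have tA : Tendsto (fun p => discA (N p) (m p) (h p)) l (𝓝 (coefA 1 t)) := by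
    have := (pK.mul (tendsto_const_nhds (x := (1 : ℝ)).sub pm)).add (hKh.mul pK1)
    have e : coefA 1 t = Real.exp (t - 1) * (1 - Real.exp (-t)) + (1 - t) * Real.exp (t - 1) := by
      rw [coefA_one]; linear_combination e2
    rw [e]
    exact this
  have tB : Tendsto (fun p => discB (N p) (m p) (h p)) l (𝓝 (coefB 1 t)) := by
    have := (pK.mul (tendsto_const_nhds (x := (1 : ℝ)).sub pm)).neg
    have e : coefB 1 t = -(Real.exp (t - 1) * (1 - Real.exp (-t))) := by
      rw [coefB_one]; linear_combination -e2
    rw [e]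
    exact this
  have tC : Tendsto (fun p => discC (N p) (m p) (h p)) l (𝓝 (coefC 1 t)) := by
    have s1 := tendsto_const_nhds (x := (1 : ℝ)).sub pm
    have := ((pK.mul (s1.neg.add (hmh.mul pm))).sub ((hKh.mul pK1).mul s1)).add (hq.mul pN)
    have e : coefC 1 t = Real.exp (t - 1) * (-(1 - Real.exp (-t)) + t * Real.exp (-t)) -
        (1 - t) * Real.exp (t - 1) * (1 - Real.exp (-t)) +
        (1 - t) * (1 - t) / 2 * Real.exp (-1) := by
      rw [coefC_one]
      linear_combination (-2 : ℝ) * e2 + (2 - t) * e3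
    rw [e]
    exact this
  have close : ∀ (f : ℕ × ℕ → ℝ) (a : ℝ), Tendsto f l (𝓝 a) → ∀ᶠ p in l, |f p - a| ≤ ε :=
    fun f a hf => hf.eventually (Metric.closedBall_mem_nhds a hε)
  have fin := (close _ _ tA).and ((close _ _ tB).and ((close _ _ tC).and ((close _ _ hlim).and hpos)))
  obtain ⟨s, hs, s', hs', hss⟩ := Filter.mem_prod_iff.1 fin
  obtain ⟨N₀, hN₀⟩ := nonempty_of_mem hs
  have key : ∀ M : ℕ, (N₀, M) ∈ s ×ˢ s' := fun M => ⟨hN₀, by rw [mem_top.1 hs']; trivial⟩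
  refine ⟨N₀, ⌊t * N₀⌋₊, (hss (key 0)).2.2.2.2, hml (N₀, 0), fun M hM h' hh' => ?_⟩
  obtain ⟨a1, a2, a3, a4, a5⟩ := hss (key (M - 1))
  have eM : M - 1 + 1 = M := Nat.sub_add_cancel hM
  have eh : h (N₀, M - 1) = h' := by
    simp only [hh, hN, eM]
    have : ((N₀ * M : ℕ) : ℝ) ≠ 0 := by
      intro h0; rw [h0] at hh'; simp at hh'
    field_simp
    linarith
  simp only [eh] at a1 a2 a3 a4
  simp only [hN, hm, eM] at a1 a2 a3
  rw [sub_zero] at a4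
  exact ⟨(le_abs_self _).trans a4, a1, a2, a3⟩

/-! ### Combining the two candidates -/

/-- If both guesses are accurate and no direction was bad, one of the two candidates, the value `d`
of double greedy and the value `y` of the aided greedy, is large. Here `v` is the optimal value,
`q` and `p` are the values at `z ⊕ o` and `z ⊙ o`, and `s` is the scale of the guesses. -/
theorem candidate_bound {N m : ℕ} {h v p q e s U Y f y d z α r t ε : ℝ}
    (hN : (N : ℝ) * h = 1) (hmN : m ≤ N) (hp : p ∈ Set.Icc 0 v) (hq : q ∈ Set.Icc 0 (2 * v))
    (he : 0 ≤ e) (hs : s ≤ v + e) (hU : v - (1 - (1 - h) ^ m) * q - h * s ≤ U)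
    (hY : q - ε * v - h * s ≤ Y) (hε : 0 ≤ ε)
    (hf : (1 - (1 - h) ^ m) * (v - p - q) + m * h * (1 - h) ^ m * q - m * (h ^ 2 * e) ≤ f)
    (hy : (1 - h) ^ (N - m) * f + ((N - m : ℕ) : ℝ) * h * (1 - h) ^ (N - m - 1) * U +
      h ^ 2 * (((N - m : ℕ) : ℝ) * (((N - m : ℕ) : ℝ) - 1) / 2) * (1 - h) ^ (N - m + m) * Y -
      ((N - m : ℕ) : ℝ) * (h ^ 2 * e) ≤ y)
    (hz : q + p ≤ 2 * z + h * (v + e))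
    (hd : r ^ 2 * z + 2 * r * p - N * ((1 + r) ^ 2 * (h ^ 2 * e)) ≤ (1 + r) ^ 2 * d)
    (hα : α ∈ Set.Icc (0 : ℝ) 1) (hr : 0 ≤ r)
    (hB : 0 ≤ (1 - α) * coefB 1 t + α * coefD 1 r) (hC : 0 ≤ (1 - α) * coefC 1 t + α * coefE 1 r)
    (aA : |discA N m h - coefA 1 t| ≤ ε) (aB : |discB N m h - coefB 1 t| ≤ ε)
    (aC : |discC N m h - coefC 1 t| ≤ ε) :
    (1 - α) * coefA 1 t * v - 5 * ε * v - 3 * (h * (v + e)) ≤ max d y := by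
  have hN0 : (0 : ℝ) < N := by
    rcases Nat.eq_zero_or_pos N with h0 | h0
    · rw [h0] at hN; simp at hN
    · exact_mod_cast h0
  have hN1 : (1 : ℝ) ≤ N := by exact_mod_cast Nat.cast_pos.1 hN0
  have hh : h ∈ Set.Icc (0 : ℝ) 1 := by
    have : h = 1 / N := by field_simp; linarith
    rw [this]
    exact ⟨by positivity, by rw [div_le_one hN0]; exact hN1⟩
  have hv : 0 ≤ v := hp.1.trans hp.2
  have hve : 0 ≤ v + e := by linarith
  have hpw : ∀ k, 0 ≤ (1 - h) ^ k ∧ (1 - h) ^ k ≤ 1 := fun k =>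
    ⟨pow_nonneg (by linarith [hh.2]) k, pow_le_one₀ (by linarith [hh.2]) (by linarith [hh.1])⟩
  set K := N - m with hK
  have hKm : (K : ℝ) + m = N := by rw [hK, Nat.cast_sub hmN]; ring
  have hKh : (K : ℝ) * h ≤ 1 := by
    rw [← hN, ← hKm]; nlinarith [hh.1, Nat.cast_nonneg (α := ℝ) m]
  have hKh0 : 0 ≤ (K : ℝ) * h := mul_nonneg (Nat.cast_nonneg _) hh.1
  -- the aided greedy
  have hyA : discA N m h * v + discB N m h * p + discC N m h * q - ε * v - 3 * (h * (v + e)) ≤ y := by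
    have w1 : 0 ≤ (K : ℝ) * h * (1 - h) ^ (K - 1) := mul_nonneg hKh0 (hpw _).1
    have w1' : (K : ℝ) * h * (1 - h) ^ (K - 1) ≤ 1 := mul_le_one₀ hKh (hpw _).1 (hpw _).2
    have w2 : 0 ≤ h ^ 2 * (K * ((K : ℝ) - 1) / 2) * (1 - h) ^ (K + m) := by
      refine mul_nonneg (mul_nonneg (sq_nonneg h) (div_nonneg ?_ two_pos.le)) (hpw _).1
      rcases Nat.eq_zero_or_pos K with h0 | h0
      · simp [h0]
      · have : (1 : ℝ) ≤ K := by exact_mod_cast h0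
        exact mul_nonneg (Nat.cast_nonneg _) (by linarith)
    have w2' : h ^ 2 * (K * ((K : ℝ) - 1) / 2) * (1 - h) ^ (K + m) ≤ 1 := by
      refine mul_le_one₀ ?_ (hpw _).1 (hpw _).2
      have h1 : ((K : ℝ) * h) * (K * h) ≤ 1 := mul_le_one₀ hKh hKh0 hKh
      have h2 : 0 ≤ (K : ℝ) * h * h := mul_nonneg hKh0 hh.1
      have h3 : h ^ 2 * (K * ((K : ℝ) - 1) / 2) = (K * h * (K * h) - K * h * h) / 2 := by ring
      linarith
    have b1 := mul_le_mul_of_nonneg_left hU w1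
    have b2 := mul_le_mul_of_nonneg_left hY w2
    have b3 := mul_le_mul_of_nonneg_left hf (hpw K).1
    have hse : h * s ≤ h * (v + e) := mul_le_mul_of_nonneg_left hs hh.1
    have hse0 : 0 ≤ h * (v + e) := mul_nonneg hh.1 hve
    have c1 : (K : ℝ) * h * (1 - h) ^ (K - 1) * (h * s) ≤ h * (v + e) :=
      (mul_le_mul_of_nonneg_left hse w1).trans (mul_le_of_le_one_left hse0 w1')
    have c2 : h ^ 2 * (K * ((K : ℝ) - 1) / 2) * (1 - h) ^ (K + m) * (ε * v + h * s) ≤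
        ε * v + h * (v + e) :=
      (mul_le_mul_of_nonneg_left (by linarith) w2).trans
        (mul_le_of_le_one_left (by positivity) w2')
    have c3 : (1 - h) ^ K * (m * (h ^ 2 * e)) + K * (h ^ 2 * e) ≤ h * (v + e) := by
      have h1 : 0 ≤ (m : ℝ) * (h ^ 2 * e) := by positivity
      have h2 : (m : ℝ) * (h ^ 2 * e) + K * (h ^ 2 * e) = h * e := by
        linear_combination (h ^ 2 * e) * hKm + h * e * hN
      have h3 := mul_le_of_le_one_left h1 (hpw K).2
      have h4 := mul_nonneg hh.1 hv
      linarith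
    have e1 : discA N m h * v + discB N m h * p + discC N m h * q =
        (1 - h) ^ K * ((1 - (1 - h) ^ m) * (v - p - q) + m * h * (1 - h) ^ m * q) +
        (K : ℝ) * h * (1 - h) ^ (K - 1) * (v - (1 - (1 - h) ^ m) * q) +
        h ^ 2 * (K * ((K : ℝ) - 1) / 2) * (1 - h) ^ (K + m) * q := by
      unfold discA discB discC
      rw [← hK]
      ring
    rw [e1]
    generalize (K : ℝ) * h * (1 - h) ^ (K - 1) = X at *
    generalize h ^ 2 * (K * ((K : ℝ) - 1) / 2) * (1 - h) ^ (K + m) = Z at *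
    linarith
  -- double greedy
  have hdD : coefD 1 r * p + coefE 1 r * q - 3 * (h * (v + e)) ≤ d := by
    have hr1 : 0 < (r + 1) ^ 2 := by positivity
    have e1 : coefD 1 r * p + coefE 1 r * q =
        (2 * r * p + r ^ 2 / 2 * p + r ^ 2 / 2 * q) / (r + 1) ^ 2 := by
      rw [coefD_one, coefE_one]; ring
    have h1 : (N : ℝ) * ((1 + r) ^ 2 * (h ^ 2 * e)) = (1 + r) ^ 2 * (h * e) := by
      linear_combination (1 + r) ^ 2 * (h * e) * hN
    rw [h1] at hd
    rw [e1, sub_le_iff_le_add, div_le_iff₀ hr1]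
    have h2 := mul_le_mul_of_nonneg_left hz (by positivity : 0 ≤ r ^ 2 / 2)
    have h3 : 0 ≤ h * (v + e) := mul_nonneg hh.1 hve
    have h4 : 0 ≤ h * v := mul_nonneg hh.1 hv
    have h5 : r ^ 2 / 2 * (h * (v + e)) ≤ (r + 1) ^ 2 * (h * (v + e)) :=
      mul_le_mul_of_nonneg_right (by nlinarith) h3
    have h6 : (1 + r) ^ 2 * (h * e) ≤ (r + 1) ^ 2 * (h * (v + e)) := by
      have : (1 + r) ^ 2 = (r + 1) ^ 2 := by ring
      rw [this]
      exact mul_le_mul_of_nonneg_left (by linarith) hr1.le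
    have h7 : 0 ≤ (r + 1) ^ 2 * (h * (v + e)) := mul_nonneg hr1.le h3
    linarith
  have m1 := mul_le_mul_of_nonneg_left (hyA.trans (le_max_right d y)) (sub_nonneg.2 hα.2)
  have m2 := mul_le_mul_of_nonneg_left (hdD.trans (le_max_left d y)) hα.1
  have a1 := abs_le.1 aA
  have a2 := abs_le.1 aB
  have a3 := abs_le.1 aC
  have k1 : coefA 1 t * v + coefB 1 t * p + coefC 1 t * q - 4 * ε * v ≤
      discA N m h * v + discB N m h * p + discC N m h * q := by
    have i1 := mul_le_mul_of_nonneg_right a1.1 hv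
    have i2 := mul_le_mul_of_nonneg_right a2.1 hp.1
    have i3 := mul_le_mul_of_nonneg_right a3.1 hq.1
    have i4 := mul_le_mul_of_nonneg_left hp.2 hε
    have i5 := mul_le_mul_of_nonneg_left hq.2 hε
    linarith
  have k2 := mul_le_mul_of_nonneg_left k1 (sub_nonneg.2 hα.2)
  have k3 := mul_nonneg hB hp.1
  have k4 := mul_nonneg hC hq.1
  have k5 : 0 ≤ α * (ε * v) := mul_nonneg hα.1 (mul_nonneg hε hv)
  linarith

/-! ### Bounds for the approximation factor -/

theorem Phi_le_of_forall {γ c : ℝ} (hne : (feasible γ).Nonempty)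
    (h : ∀ p ∈ feasible γ, (1 - p.1) * coefA γ p.2.2 ≤ c) : Phi γ ≤ c :=
  csSup_le (hne.image _) (by rintro _ ⟨p, hp, rfl⟩; exact h p hp)

theorem le_Phi {γ c : ℝ} (h : ∀ p ∈ feasible γ, (1 - p.1) * coefA γ p.2.2 ≤ c)
    {p : ℝ × ℝ × ℝ} (hp : p ∈ feasible γ) : (1 - p.1) * coefA γ p.2.2 ≤ Phi γ :=
  le_csSup ⟨c, by rintro _ ⟨p, hp, rfl⟩; exact h p hp⟩ ⟨p, hp, rfl⟩

/-- Weak duality for the program defining `Φ_γ`. -/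
theorem weak_duality {γ lam mu c : ℝ} (hl : 0 ≤ lam) (hm : 0 ≤ mu)
    (h1 : ∀ t ∈ Set.Ioo (0 : ℝ) 1, coefA γ t + lam * coefB γ t + mu * coefC γ t ≤ c)
    (h2 : ∀ r : ℝ, 0 ≤ r → lam * coefD γ r + mu * coefE γ r ≤ c) :
    ∀ p ∈ feasible γ, (1 - p.1) * coefA γ p.2.2 ≤ c := by
  rintro ⟨α, r, t⟩ ⟨hα, hr, ht, hB, hC⟩
  dsimp only at *
  have i1 := mul_le_mul_of_nonneg_left (h1 t ht) (sub_nonneg.2 hα.2)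
  have i2 := mul_le_mul_of_nonneg_left (h2 r hr) hα.1
  have i3 := mul_nonneg hl hB
  have i4 := mul_nonneg hm hC
  linarith

theorem exp_364 : |Real.exp (0.364 : ℝ) - 1.4390737| ≤ 0.000001 := by
  have := Real.exp_bound (x := (0.364 : ℝ)) (by norm_num [abs_of_pos]) (n := 9) (by norm_num)
  rw [abs_le] at this ⊢
  norm_num [Finset.sum_range_succ, Nat.factorial] at this ⊢
  constructor <;> linarith

theorem exp_neg_one_bounds : (0.3678794 : ℝ) ≤ Real.exp (-1) ∧ Real.exp (-1) ≤ 0.3678795 := by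
  have h1 := Real.exp_one_gt_d9
  have h2 := Real.exp_one_lt_d9
  have h3 : Real.exp (-1) * Real.exp 1 = 1 := by rw [← Real.exp_add]; simp
  have h4 := Real.exp_pos (-1)
  constructor <;> nlinarith

/-- A feasible triple close to the numerical optimum. -/
theorem witness_mem_feasible : ((0.1951 : ℝ), (2.12 : ℝ), (0.364 : ℝ)) ∈ feasible 1 := by
  obtain ⟨a1, a2⟩ := abs_le.1 exp_364
  obtain ⟨b1, b2⟩ := exp_neg_one_bounds
  have e : Real.exp (0.364 - 1) = Real.exp (-1) * Real.exp 0.364 := by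
    rw [← Real.exp_add]; congr 1; ring
  refine ⟨⟨by norm_num, by norm_num⟩, by norm_num, ⟨by norm_num, by norm_num⟩, ?_, ?_⟩
  · dsimp only
    rw [coefB_one, coefD_one, e]
    norm_num
    norm_num at a1 a2 b1 b2
    nlinarith
  · dsimp only
    rw [coefC_one, coefE_one]
    norm_num
    norm_num at a1 a2 b1 b2
    nlinarith

/-- The elementary inequality `(1 - s) e^s ≤ 1 - 0.35 s²` near `0`. -/
theorem one_sub_mul_exp_le {s : ℝ} (h1 : -0.3875 ≤ s) (h2 : s ≤ 0.6125) :
    (1 - s) * Real.exp s ≤ 1 - 0.35 * s ^ 2 := by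
  have := Real.exp_bound (x := s) (by rw [abs_le]; constructor <;> linarith) (n := 4) (by norm_num)
  have h3 := (abs_le.1 this).2
  simp only [Finset.sum_range_succ, Nat.factorial, Finset.range_zero, Finset.sum_empty] at h3
  have h4 : |s| ^ 4 = s ^ 4 := by
    rw [show (4 : ℕ) = 2 * 2 by norm_num, pow_mul, sq_abs, ← pow_mul]
  rw [h4] at h3
  norm_num at h3
  have h5 : Real.exp s ≤ 1 + s + s ^ 2 / 2 + s ^ 3 / 6 + s ^ 4 * (5 / 96) := by linarith
  have h6 := mul_le_mul_of_nonneg_left h5 (by linarith : 0 ≤ 1 - s)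
  have h7 : 1 - 0.35 * s ^ 2 - (1 - s) * (1 + s + s ^ 2 / 2 + s ^ 3 / 6 + s ^ 4 * (5 / 96)) =
      s ^ 2 * (0.15 + s / 3 + s ^ 2 / 6 - s ^ 2 * (5 / 96) * (1 - s)) := by ring
  have h8 : 0 ≤ 0.15 + s / 3 + s ^ 2 / 6 - s ^ 2 * (5 / 96) * (1 - s) := by
    nlinarith [mul_nonneg (sub_nonneg.2 h1) (sub_nonneg.2 h2), sq_nonneg s,
      mul_nonneg (sq_nonneg s) (sub_nonneg.2 h1)]
  have h9 := mul_nonneg (sq_nonneg s) h8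
  linarith

/-- The constraint of the dual program that belongs to `t`, for multipliers `0.588` and `0.04` close
to the numerical optimum. The critical term `e^t (1.332 - 0.96 t)` is a multiple of `(1 - s) e^s`
for `s = t - 0.3875`. -/
theorem dual_bound_t {t : ℝ} (ht : t ∈ Set.Ioo (0 : ℝ) 1) :
    coefA 1 t + 0.588 * coefB 1 t + 0.04 * coefC 1 t ≤ 0.4019 := by
  obtain ⟨b1, b2⟩ := exp_neg_one_bounds
  have e1 : Real.exp (t - 1) = Real.exp (-1) * Real.exp t := by
    rw [← Real.exp_add]; congr 1; ring
  have e2 : Real.exp t = Real.exp 0.3875 * Real.exp (t - 0.3875) := by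
    rw [← Real.exp_add]; congr 1; ring
  have h1 := one_sub_mul_exp_le (s := t - 0.3875) (by linarith [ht.1]) (by linarith [ht.2])
  have h2 : Real.exp 0.3875 ≤ 1.4734 := by
    have := (abs_le.1 (Real.exp_bound (x := (0.3875 : ℝ)) (by norm_num [abs_of_pos])
      (n := 6) (by norm_num))).2
    norm_num [Finset.sum_range_succ, Nat.factorial] at this ⊢
    linarith
  have h3 : Real.exp t * (1.332 - 0.96 * t) ≤
      0.96 * (1.4734 * (1 - 0.35 * (t - 0.3875) ^ 2)) := by
    have : Real.exp t * (1.332 - 0.96 * t) =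
        0.96 * (Real.exp 0.3875 * ((1 - (t - 0.3875)) * Real.exp (t - 0.3875))) := by
      rw [e2]; ring
    rw [this]
    refine mul_le_mul_of_nonneg_left ?_ (by norm_num)
    refine (mul_le_mul_of_nonneg_left h1 (Real.exp_pos _).le).trans ?_
    exact mul_le_mul_of_nonneg_right h2 (by nlinarith [ht.1, ht.2])
  rw [coefA_one, coefB_one, coefC_one, e1]
  have h4 : Real.exp (-1) * Real.exp t * (2 - t) - Real.exp (-1) +
      0.588 * (Real.exp (-1) - Real.exp (-1) * Real.exp t) +
      0.04 * (Real.exp (-1) * (2 - 2 * Real.exp t + t * Real.exp t + (1 - t) ^ 2 / 2)) =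
      Real.exp (-1) * (Real.exp t * (1.332 - 0.96 * t) - 0.332 + 0.02 * (1 - t) ^ 2) := by ring
  rw [h4]
  have h5 : Real.exp t * (1.332 - 0.96 * t) - 0.332 + 0.02 * (1 - t) ^ 2 ≤ 1.0923 := by
    nlinarith [sq_nonneg (t - 0.364)]
  have h6 := mul_le_mul_of_nonneg_left h5 (Real.exp_pos (-1)).le
  linarith

/-- The constraint of the dual program that belongs to `r`, for the same multipliers. -/
theorem dual_bound_r {r : ℝ} (hr : 0 ≤ r) : 0.588 * coefD 1 r + 0.04 * coefE 1 r ≤ 0.4019 := by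
  rw [coefD_one, coefE_one, ← mul_div_assoc, ← mul_div_assoc, ← add_div,
    div_le_iff₀ (by positivity)]
  nlinarith [sq_nonneg (r - 2.11)]

theorem coefA_one_le_of_feasible : ∀ p ∈ feasible 1, (1 - p.1) * coefA 1 p.2.2 ≤ 0.4019 :=
  weak_duality (lam := 0.588) (mu := 0.04) (by norm_num) (by norm_num) (fun _ => dual_bound_t)
    (fun _ => dual_bound_r)

theorem Phi_one_lt : Phi 1 < 0.402 :=
  lt_of_le_of_lt (Phi_le_of_forall ⟨_, witness_mem_feasible⟩ coefA_one_le_of_feasible)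
    (by norm_num)

theorem le_Phi_one : 0.401 ≤ Phi 1 := by
  refine le_trans ?_ (le_Phi coefA_one_le_of_feasible witness_mem_feasible)
  obtain ⟨a1, a2⟩ := abs_le.1 exp_364
  obtain ⟨b1, b2⟩ := exp_neg_one_bounds
  have e : Real.exp (0.364 - 1) = Real.exp (-1) * Real.exp 0.364 := by
    rw [← Real.exp_add]; congr 1; ring
  dsimp only
  rw [coefA_one, e]
  norm_num
  norm_num at a1 a2 b1 b2
  nlinarith

theorem exists_feasible_near {ε : ℝ} (hε : 0 < ε) :
    ∃ p ∈ feasible 1, Phi 1 - ε ≤ (1 - p.1) * coefA 1 p.2.2 := by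
  obtain ⟨_, ⟨p, hp, rfl⟩, h⟩ := exists_lt_of_lt_csSup
    (Set.Nonempty.image (fun p : ℝ × ℝ × ℝ => (1 - p.1) * coefA 1 p.2.2) ⟨_, witness_mem_feasible⟩)
    (show Phi 1 - ε < sSup _ by unfold Phi; linarith)
  exact ⟨p, hp, h.le⟩

/-- For `γ < 1`, the point `t = 0`, which belongs to the closure of the feasible set, already gives
more than `γ e^{-γ}`. -/
theorem exists_feasible_gt {γ : ℝ} (h0 : 0 < γ) (h1 : γ < 1) :
    ∃ p ∈ feasible γ, γ * Real.exp (-γ) < (1 - p.1) * coefA γ p.2.2 := by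
  have hne : γ ≠ 1 := h1.ne
  have h1' : 0 < 1 - γ := by linarith
  have A0 : γ * Real.exp (-γ) < coefA γ 0 := by
    have e : coefA γ 0 = Real.exp (-γ) * ((Real.exp (γ * (1 - γ)) - 1) / (1 - γ)) := by
      have e1 : Real.exp (-γ ^ 2) = Real.exp (-γ) * Real.exp (γ * (1 - γ)) := by
        rw [← Real.exp_add]; congr 1; ring
      simp only [coefA, if_neg hne, e1, mul_zero, zero_sub, Real.exp_zero]
      field_simp
      ring
    rw [e, mul_comm]
    refine mul_lt_mul_of_pos_left ?_ (Real.exp_pos _)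
    rw [lt_div_iff₀ h1']
    linarith [Real.add_one_lt_exp (mul_pos h0 h1').ne']
  have B0 : coefB γ 0 = 0 := by simp [coefB]
  have C0 : 0 < coefC γ 0 := by
    have e : coefC γ 0 = Real.exp (-γ) * (γ / (1 - γ) ^ 2 *
        (1 - (1 - γ * (1 - γ)) * Real.exp (γ * (1 - γ)))) := by
      simp only [coefC, if_neg hne, mul_zero, Real.exp_zero, sub_zero, mul_one, sub_self, zero_div,
        zero_mul, add_zero, zero_add]
      field_simp
      ring
    rw [e]
    refine mul_pos (Real.exp_pos _) (mul_pos (by positivity) ?_)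
    have hu : 0 < γ * (1 - γ) := mul_pos h0 h1'
    have h2 := Real.add_one_lt_exp (neg_ne_zero.2 hu.ne')
    have h3 : Real.exp (-(γ * (1 - γ))) * Real.exp (γ * (1 - γ)) = 1 := by
      rw [← Real.exp_add]; simp
    have h4 := mul_lt_mul_of_pos_right h2 (Real.exp_pos (γ * (1 - γ)))
    linarith
  have hD : 0 < coefD γ 1 := by
    have := Real.rpow_pos_of_pos h0 (3 / 2)
    unfold coefD
    positivity
  have hE : 0 ≤ coefE γ 1 := by
    have := Real.rpow_pos_of_pos h0 (3 / 2)
    unfold coefE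
    positivity
  have hα : ∀ᶠ α : ℝ in 𝓝[>] 0, γ * Real.exp (-γ) < (1 - α) * coefA γ 0 := by
    have : ContinuousAt (fun α : ℝ => (1 - α) * coefA γ 0) 0 := by fun_prop
    exact nhdsWithin_le_nhds (this.eventually (lt_mem_nhds (by simpa using A0)))
  obtain ⟨α, hα1, hα2⟩ := (hα.and (Ioo_mem_nhdsGT zero_lt_one)).exists
  have cA : ContinuousAt (fun t => (1 - α) * coefA γ t) 0 := by
    simp only [coefA, if_neg hne]; fun_prop
  have cB : ContinuousAt (fun t => (1 - α) * coefB γ t + α * coefD γ 1) 0 := by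
    simp only [coefB]; fun_prop
  have cC : ContinuousAt (fun t => (1 - α) * coefC γ t + α * coefE γ 1) 0 := by
    simp only [coefC, if_neg hne]; fun_prop
  have eA := cA.eventually (lt_mem_nhds hα1)
  have eB := cB.eventually (lt_mem_nhds (show 0 < (1 - α) * coefB γ 0 + α * coefD γ 1 by
    rw [B0]; have := mul_pos hα2.1 hD; linarith))
  have eC := cC.eventually (lt_mem_nhds (show 0 < (1 - α) * coefC γ 0 + α * coefE γ 1 by
    have := mul_nonneg hα2.1.le hE
    have := mul_pos (sub_pos.2 hα2.2) C0
    linarith))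
  have ev : ∀ᶠ t in 𝓝[>] (0 : ℝ), _ := nhdsWithin_le_nhds (eA.and (eB.and eC))
  obtain ⟨t, ⟨hA, hB, hC⟩, ht⟩ := (ev.and (Ioo_mem_nhdsGT zero_lt_one)).exists
  exact ⟨(α, 1, t), ⟨⟨hα2.1.le, hα2.2.le⟩, zero_le_one, ht, hB.le, hC.le⟩, hA⟩

theorem exp_mul_le_convex {g : ℝ} (h0 : 0 ≤ g) (h1 : g ≤ 1) (u : ℝ) :
    Real.exp (g * u) ≤ g * Real.exp u + (1 - g) := by
  have := convexOn_exp.2 (Set.mem_univ u) (Set.mem_univ 0) h0 (sub_nonneg.2 h1) (by ring)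
  simpa using this

/-- Linearization of `A_γ(t)` in `a = e^{γ t - γ}` by the weighted inequality of arithmetic and
geometric means, with a free parameter `c`. -/
theorem coefA_le {γ : ℝ} (h0 : 0 < γ) (h1 : γ < 1) (t c : ℝ) :
    coefA γ t ≤ Real.exp (γ * t - γ) * ((Real.exp (γ * (1 - γ) * c) - 1) / (1 - γ)) +
      (Real.exp (-(γ ^ 2 * c)) - Real.exp (-γ ^ 2)) / γ := by
  have h1' : 0 < 1 - γ := by linarith
  have e1 : Real.exp (-γ ^ 2) * Real.exp (γ ^ 2 * t) =
      Real.exp (-(γ ^ 2 * c)) * Real.exp (γ * (γ * t - γ + γ * c)) := by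
    rw [← Real.exp_add, ← Real.exp_add]; congr 1; ring
  have e2 : Real.exp (-(γ ^ 2 * c)) * Real.exp (γ * t - γ + γ * c) =
      Real.exp (γ * t - γ) * Real.exp (γ * (1 - γ) * c) := by
    rw [← Real.exp_add, ← Real.exp_add]; congr 1; ring
  have h2 := mul_le_mul_of_nonneg_left (exp_mul_le_convex h0.le h1.le (γ * t - γ + γ * c))
    (Real.exp_pos (-(γ ^ 2 * c))).le
  rw [← e1, mul_add, mul_left_comm, e2] at h2
  have e3 : coefA γ t = (Real.exp (-γ ^ 2) * Real.exp (γ ^ 2 * t) -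
      (1 - γ) * Real.exp (-γ ^ 2) - γ * Real.exp (γ * t - γ)) / (γ * (1 - γ)) := by
    simp only [coefA, if_neg h1.ne]
    field_simp
    ring
  have e4 : Real.exp (γ * t - γ) * ((Real.exp (γ * (1 - γ) * c) - 1) / (1 - γ)) +
      (Real.exp (-(γ ^ 2 * c)) - Real.exp (-γ ^ 2)) / γ =
      (γ * (Real.exp (γ * t - γ) * Real.exp (γ * (1 - γ) * c)) +
        Real.exp (-(γ ^ 2 * c)) * (1 - γ) -
      (1 - γ) * Real.exp (-γ ^ 2) - γ * Real.exp (γ * t - γ)) / (γ * (1 - γ)) := by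
    field_simp
    ring
  rw [e3, e4]
  refine div_le_div_of_nonneg_right ?_ (by positivity)
  linarith

theorem exp_neg_mul_le_one {γ : ℝ} (h0 : 0 ≤ γ) :
    Real.exp (-γ) * (1 + γ + γ ^ 2 / 2 + γ ^ 3 / 6) ≤ 1 := by
  have h1 := Real.sum_le_exp_of_nonneg h0 4
  simp only [Finset.sum_range_succ, Nat.factorial, Finset.range_zero, Finset.sum_empty] at h1
  norm_num at h1
  have h2 : Real.exp (-γ) * Real.exp γ = 1 := by rw [← Real.exp_add]; simp
  have h3 := mul_le_mul_of_nonneg_left h1 (Real.exp_pos (-γ)).le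
  linarith

theorem exp_le_quadratic {u : ℝ} (h0 : 0 ≤ u) (h1 : u ≤ 1) : Real.exp u ≤ 1 + u + u ^ 2 := by
  have := (abs_le.1 (Real.abs_exp_sub_one_sub_id_le (x := u) (by rwa [abs_of_nonneg h0]))).2
  linarith

/-- The dual constraint that belongs to `t`, for the multipliers `1 - e^{-γ}` and `0`. -/
theorem coefA_add_coefB_le {γ : ℝ} (h0 : 0 < γ) (h1 : γ < 1) {t : ℝ} (ht : t ∈ Set.Ioo (0 : ℝ) 1) :
    coefA γ t + (1 - Real.exp (-γ)) * coefB γ t ≤ 1 - Real.exp (-γ) := by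
  have h1' : 0 < 1 - γ := by linarith
  have hP := exp_neg_mul_le_one h0.le
  set a := Real.exp (γ * t - γ) with ha
  set q := Real.exp (-γ) with hq
  have hq0 : 0 < q := Real.exp_pos _
  have haq : q ≤ a := Real.exp_le_exp.2 (by nlinarith [ht.1])
  -- both sides are linear in `a`, so the value at `a = q` and the slopes are compared
  suffices key : ∃ c : ℝ, (Real.exp (γ * (1 - γ) * c) - 1) / (1 - γ) ≤ (1 - q) / γ ∧
      q * ((Real.exp (γ * (1 - γ) * c) - 1) / (1 - γ)) +
        (Real.exp (-(γ ^ 2 * c)) - Real.exp (-γ ^ 2)) / γ ≤ 1 - q by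
    obtain ⟨c, k1, k2⟩ := key
    have k3 := coefA_le h0 h1 t c
    have k4 := mul_le_mul_of_nonneg_left k1 (sub_nonneg.2 haq)
    have e : (1 - q) * coefB γ t = -((a - q) * ((1 - q) / γ)) := by
      simp only [coefB, ← ha, ← hq]; ring
    rw [e]
    linarith
  -- the tangent point `c = 1` is exact at `a = q`, but its slope is too large for `γ` near `1`, where
  -- `c = 1 / 2` takes over
  rcases le_total γ 0.55 with hγ | hγ
  · refine ⟨1, ?_, ?_⟩
    · rw [mul_one, div_le_div_iff₀ h1' h0]
      have hu : γ * (1 - γ) ≤ 1 := by nlinarith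
      have h2 := exp_le_quadratic (mul_pos h0 h1').le hu
      have h3 : (Real.exp (γ * (1 - γ)) - 1) * γ ≤ (γ * (1 - γ) + (γ * (1 - γ)) ^ 2) * γ :=
        mul_le_mul_of_nonneg_right (by linarith) h0.le
      have h4 : γ * γ * (1 + γ * (1 - γ)) ≤ 1 - q := by
        have hPp : 0 < 1 + γ + γ ^ 2 / 2 + γ ^ 3 / 6 := by positivity
        have h5 : q ≤ 1 / (1 + γ + γ ^ 2 / 2 + γ ^ 3 / 6) := by rwa [le_div_iff₀ hPp]
        have h6 : 1 / (1 + γ + γ ^ 2 / 2 + γ ^ 3 / 6) ≤ 1 - γ * γ * (1 + γ * (1 - γ)) := by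
          rw [div_le_iff₀ hPp]
          have h7 : (1 - γ * γ * (1 + γ * (1 - γ))) * (1 + γ + γ ^ 2 / 2 + γ ^ 3 / 6) - 1 =
              γ * (1 - γ / 2 - 11 / 6 * γ ^ 2 - γ ^ 3 / 2 + γ ^ 4 / 3 + γ ^ 5 / 3 + γ ^ 6 / 6) := by
            ring
          have h8 : 0 ≤ 1 - γ / 2 - 11 / 6 * γ ^ 2 - γ ^ 3 / 2 + γ ^ 4 / 3 + γ ^ 5 / 3 +
              γ ^ 6 / 6 := by
            have i1 : γ ^ 2 ≤ 0.55 ^ 2 := pow_le_pow_left₀ h0.le hγ 2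
            have i2 : γ ^ 3 ≤ 0.55 ^ 3 := pow_le_pow_left₀ h0.le hγ 3
            have i3 : 0 ≤ γ ^ 4 := by positivity
            have i4 : 0 ≤ γ ^ 5 := by positivity
            have i5 : 0 ≤ γ ^ 6 := by positivity
            norm_num at i1 i2
            linarith
          have h9 := mul_nonneg h0.le h8
          linarith
        linarith
      have h10 := mul_le_mul_of_nonneg_right h4 h1'.le
      nlinarith
    · rw [mul_one, mul_one]
      have e1 : Real.exp (-(γ ^ 2)) - Real.exp (-γ ^ 2) = 0 := by simp
      rw [e1, zero_div, add_zero, ← mul_div_assoc, div_le_iff₀ h1']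
      have e2 : q * Real.exp (γ * (1 - γ)) = Real.exp (γ * -γ) := by
        rw [hq, ← Real.exp_add]; congr 1; ring
      have h2 := exp_mul_le_convex h0.le h1.le (-γ)
      rw [← hq] at h2
      nlinarith
  · refine ⟨1 / 2, ?_⟩
    have hv : γ * (1 - γ) * (1 / 2) ≤ 1 / 8 := by nlinarith [sq_nonneg (γ - 1 / 2)]
    have hv0 : 0 ≤ γ * (1 - γ) * (1 / 2) := by positivity
    have h2 := exp_le_quadratic hv0 (by linarith)
    have hs : (Real.exp (γ * (1 - γ) * (1 / 2)) - 1) / (1 - γ) ≤ 0.5625 * γ := by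
      rw [div_le_iff₀ h1']
      nlinarith [mul_le_mul_of_nonneg_left hv hv0]
    have hPp : 0 < 1 + γ + γ ^ 2 / 2 + γ ^ 3 / 6 := by positivity
    have h5 : q ≤ 1 / (1 + γ + γ ^ 2 / 2 + γ ^ 3 / 6) := by rwa [le_div_iff₀ hPp]
    constructor
    · refine hs.trans ?_
      rw [le_div_iff₀ h0]
      have h6 : 1 / (1 + γ + γ ^ 2 / 2 + γ ^ 3 / 6) ≤ 1 - 0.5625 * γ * γ := by
        rw [div_le_iff₀ hPp]
        have h7 : (1 - 0.5625 * γ * γ) * (1 + γ + γ ^ 2 / 2 + γ ^ 3 / 6) - 1 =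
            γ * (1 + γ / 2 + γ ^ 2 / 6 - 0.5625 * γ * (1 + γ + γ ^ 2 / 2 + γ ^ 3 / 6)) := by ring
        have h8 : 0 ≤ 1 + γ / 2 + γ ^ 2 / 6 - 0.5625 * γ * (1 + γ + γ ^ 2 / 2 + γ ^ 3 / 6) := by
          have i1 : γ ^ 2 ≤ 1 := pow_le_one₀ h0.le h1.le
          have i2 : γ ^ 3 ≤ 1 := pow_le_one₀ h0.le h1.le
          have i3 : γ ^ 4 ≤ 1 := pow_le_one₀ h0.le h1.le
          nlinarith
        have h9 := mul_nonneg h0.le h8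
        linarith
      linarith
    · have h6 := mul_le_mul_of_nonneg_left hs hq0.le
      have h7 : (Real.exp (-(γ ^ 2 * (1 / 2))) - Real.exp (-γ ^ 2)) / γ ≤
          (γ / 2) / (1 + γ ^ 2 / 2) := by
        have e1 : Real.exp (-γ ^ 2) = Real.exp (-(γ ^ 2 * (1 / 2))) *
            Real.exp (-(γ ^ 2 * (1 / 2))) := by
          rw [← Real.exp_add]; congr 1; ring
        set x := Real.exp (-(γ ^ 2 * (1 / 2))) with hx
        have hx0 : 0 < x := Real.exp_pos _
        have hx1 : 1 - x ≤ γ ^ 2 / 2 := by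
          linarith [Real.add_one_le_exp (-(γ ^ 2 * (1 / 2)))]
        have hx2 : x * (1 + γ ^ 2 / 2) ≤ 1 := by
          have h8 : x * Real.exp (γ ^ 2 * (1 / 2)) = 1 := by rw [hx, ← Real.exp_add]; simp
          have h9 := mul_le_mul_of_nonneg_left (Real.add_one_le_exp (γ ^ 2 * (1 / 2))) hx0.le
          linarith
        rw [e1, div_le_div_iff₀ h0 (by positivity)]
        have h8 : (x - x * x) * (1 + γ ^ 2 / 2) = (x * (1 + γ ^ 2 / 2)) * (1 - x) := by ring
        rw [h8]
        have hx3 : 0 ≤ 1 - x := by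
          have : x ≤ 1 := Real.exp_le_one_iff.2 (by nlinarith [sq_nonneg γ])
          linarith
        have h9 := mul_le_mul_of_nonneg_right hx2 hx3
        nlinarith
      have h8 : 1 / (1 + γ + γ ^ 2 / 2 + γ ^ 3 / 6) * (1 + 0.5625 * γ) +
          (γ / 2) / (1 + γ ^ 2 / 2) ≤ 1 := by
        rw [div_mul_eq_mul_div, div_add_div _ _ hPp.ne' (by positivity), div_le_one (by positivity)]
        have h9 : (1 + γ + γ ^ 2 / 2 + γ ^ 3 / 6) * (1 + γ ^ 2 / 2) -
            (1 * (1 + 0.5625 * γ) * (1 + γ ^ 2 / 2) +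
              (1 + γ + γ ^ 2 / 2 + γ ^ 3 / 6) * (γ / 2)) =
            γ * (-0.0625 + (2 / 3 - 0.25 - 0.28125) * γ ^ 2 + γ ^ 3 / 6 + γ ^ 4 / 12) := by ring
        have i1 : 0.55 ^ 2 ≤ γ ^ 2 := pow_le_pow_left₀ (by norm_num) hγ 2
        have i2 : 0.55 ^ 3 ≤ γ ^ 3 := pow_le_pow_left₀ (by norm_num) hγ 3
        have i3 : 0 ≤ γ ^ 4 := by positivity
        norm_num at i1 i2
        have h10 : 0 ≤ -0.0625 + (2 / 3 - 0.25 - 0.28125) * γ ^ 2 + γ ^ 3 / 6 + γ ^ 4 / 12 := by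
          norm_num; linarith
        have h11 := mul_nonneg h0.le h10
        linarith
      have h9 := mul_le_mul_of_nonneg_right h5 (by positivity : 0 ≤ 1 + 0.5625 * γ)
      linarith

theorem coefD_le_one {γ : ℝ} (h0 : 0 < γ) (r : ℝ) (hr : 0 ≤ r) : coefD γ r ≤ 1 := by
  have h1 := Real.rpow_pos_of_pos h0 (3 / 2)
  unfold coefD
  rw [div_le_one (by positivity)]
  have h2 : γ / (1 + γ ^ 2) ≤ 1 := by
    rw [div_le_one (by positivity)]; nlinarith [sq_nonneg (γ - 1)]
  nlinarith [mul_le_mul_of_nonneg_right h2 (sq_nonneg r)]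

/-- For `γ < 1` the factor `Φ_γ` does not exceed the guarantee of the continuous greedy method for
monotone functions. -/
theorem feasible_le_of_lt_one {γ : ℝ} (h0 : 0 < γ) (h1 : γ < 1) :
    ∀ p ∈ feasible γ, (1 - p.1) * coefA γ p.2.2 ≤ 1 - Real.exp (-γ) := by
  have hq : 0 ≤ 1 - Real.exp (-γ) := by
    have : Real.exp (-γ) ≤ 1 := Real.exp_le_one_iff.2 (by linarith)
    linarith
  refine weak_duality (lam := 1 - Real.exp (-γ)) (mu := 0) hq le_rfl (fun t ht => ?_)
    (fun r hr => ?_)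
  · rw [zero_mul, add_zero]
    exact coefA_add_coefB_le h0 h1 ht
  · rw [zero_mul, add_zero]
    exact mul_le_of_le_one_right hq (coefD_le_one h0 r hr)

theorem Phi_le_of_lt_one {γ : ℝ} (h0 : 0 < γ) (h1 : γ < 1) : Phi γ ≤ 1 - Real.exp (-γ) := by
  obtain ⟨p, hp, -⟩ := exists_feasible_gt h0 h1
  exact Phi_le_of_forall ⟨p, hp⟩ (feasible_le_of_lt_one h0 h1)

theorem lt_Phi_of_lt_one {γ : ℝ} (h0 : 0 < γ) (h1 : γ < 1) : γ * Real.exp (-γ) < Phi γ := by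
  obtain ⟨p, hp, h⟩ := exists_feasible_gt h0 h1
  exact h.trans_le (le_Phi (feasible_le_of_lt_one h0 h1) hp)

/-! ### Total correctness with running times -/

/-- Started in `s`, the program `p` halts within `T` steps in a state satisfying `Q`. -/
def Run (O : Oracle n) (p : Prog) (s : State n) (T : ℕ) (Q : State n → Prop) : Prop :=
  ∃ s' t, Exec O p s s' t ∧ t ≤ T ∧ Q s'

namespace Run

variable {O : Oracle n} {s : State n} {Q R : State n → Prop}

theorem mono {p : Prog} {T T' : ℕ} (h : Run O p s T Q) (hT : T ≤ T') (hQ : ∀ s, Q s → R s) :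
    Run O p s T' R := by
  obtain ⟨s', t, h1, h2, h3⟩ := h
  exact ⟨s', t, h1, h2.trans hT, hQ _ h3⟩

theorem instr {a : Instr} (h : Q (a.step O s)) : Run O (.instr a) s 1 Q :=
  ⟨_, _, .instr a s, le_rfl, h⟩

theorem seq {p q : Prog} {T T' : ℕ} (h1 : Run O p s T R) (h2 : ∀ s', R s' → Run O q s' T' Q) :
    Run O (.seq p q) s (T + T') Q := by
  obtain ⟨s', t, e, ht, hr⟩ := h1
  obtain ⟨s'', t', e', ht', hq⟩ := h2 s' hr
  exact ⟨s'', t + t', .seq e e', by omega, hq⟩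

/-- Symbolic execution of one instruction in front of a program. -/
theorem instr_seq {a : Instr} {q : Prog} {T : ℕ} (h : Run O q (a.step O s) T Q) :
    Run O (.seq (.instr a) q) s (1 + T) Q :=
  seq (R := fun s' => s' = a.step O s) (instr rfl) (by rintro _ rfl; exact h)

theorem ite {b : Test} {p q : Prog} {T : ℕ} (h1 : b.holds s → Run O p s T Q)
    (h2 : ¬ b.holds s → Run O q s T Q) : Run O (.ite b p q) s (T + 1) Q := by
  by_cases hb : b.holds s
  · obtain ⟨s', t, e, ht, hq⟩ := h1 hb
    exact ⟨s', t + 1, .iteTrue hb e, by omega, hq⟩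
  · obtain ⟨s', t, e, ht, hq⟩ := h2 hb
    exact ⟨s', t + 1, .iteFalse hb e, by omega, hq⟩

/-- Rule for loops with an invariant that is indexed by the number of iterations still to be
done. -/
theorem while_desc {b : Test} {p : Prog} {T : ℕ} (J : ℕ → State n → Prop)
    (h0 : ∀ s, J 0 s → ¬ b.holds s ∧ Q s)
    (h1 : ∀ k s, J (k + 1) s → b.holds s ∧ Run O p s T (J k)) :
    ∀ (k : ℕ) (s : State n), J k s → Run O (.while b p) s (k * (T + 1) + 1) Q
  | 0, s, h => ⟨s, 1, .whileFalse (h0 s h).1, by omega, (h0 s h).2⟩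
  | k + 1, s, h => by
    obtain ⟨hb, s', t, e, ht, hj⟩ := h1 k s h
    obtain ⟨s'', t', e', ht', hq⟩ := while_desc J h0 h1 k s' hj
    exact ⟨s'', t + t' + 1, .whileTrue hb e e', by rw [add_mul]; omega, hq⟩

/-- Rule for loops that are executed exactly `K` times. -/
theorem loop {b : Test} {p : Prog} {T K : ℕ} (J : ℕ → State n → Prop) (hs : J 0 s)
    (hend : ∀ s, J K s → ¬ b.holds s) (hbody : ∀ k < K, ∀ s, J k s → b.holds s)
    (hstep : ∀ k < K, ∀ s, J k s → Run O p s T (J (k + 1))) :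
    Run O (.while b p) s (K * (T + 1) + 1) (J K) := by
  refine while_desc (Q := J K) (fun j s => j ≤ K ∧ J (K - j) s) (fun s h => ?_) (fun k s h => ?_) K s
    ⟨le_rfl, by simpa using hs⟩
  · have h2 : J K s := by simpa using h.2
    exact ⟨hend s h2, h2⟩
  · have hlt : K - (k + 1) < K := by omega
    refine ⟨hbody _ hlt s h.2, (hstep _ hlt s h.2).mono le_rfl fun s' h' => ⟨by omega, ?_⟩⟩
    have e : K - (k + 1) + 1 = K - k := by omega
    rwa [e] at h'

end Run

/-! ### Program fragments -/

/-- `for c := 0 to N - 1 do p`, with the counter in the natural-number cell `c`. -/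
def forLoop (c : ℕ) (N : NatExp) (p : Prog) : Prog :=
  .seq (.instr (.setNat (.lit c) (.lit 0)))
    (.while (.natLt (.cell (.lit c)) N)
      (.seq p (.instr (.setNat (.lit c) (.add (.cell (.lit c)) (.lit 1))))))

/-- The state `s` with the natural-number cell `c` set to `k`. -/
def State.setNat (s : State n) (c k : ℕ) : State n :=
  ⟨Function.update s.nat c k, s.real, s.vec⟩

/-- The state `s` with the real cell `c` set to `r`. -/
def State.setReal (s : State n) (c : ℕ) (r : ℝ) : State n :=
  ⟨s.nat, Function.update s.real c r, s.vec⟩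

/-- The state `s` with the vector cell `c` set to `x`. -/
def State.setVec (s : State n) (c : ℕ) (x : Vec n) : State n :=
  ⟨s.nat, s.real, Function.update s.vec c x⟩

section simps

variable (s : State n) (c k c' : ℕ) (r : ℝ) (x : Vec n)

@[simp] theorem State.setNat_nat : (s.setNat c k).nat c' = if c' = c then k else s.nat c' := by
  simp [State.setNat, Function.update_apply]
@[simp] theorem State.setNat_real : (s.setNat c k).real = s.real := rfl
@[simp] theorem State.setNat_vec : (s.setNat c k).vec = s.vec := rfl
@[simp] theorem State.setReal_nat : (s.setReal c r).nat = s.nat := rfl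
@[simp] theorem State.setReal_real :
    (s.setReal c r).real c' = if c' = c then r else s.real c' := by
  simp [State.setReal, Function.update_apply]
@[simp] theorem State.setReal_vec : (s.setReal c r).vec = s.vec := rfl
@[simp] theorem State.setVec_nat : (s.setVec c x).nat = s.nat := rfl
@[simp] theorem State.setVec_real : (s.setVec c x).real = s.real := rfl
@[simp] theorem State.setVec_vec : (s.setVec c x).vec c' = if c' = c then x else s.vec c' := by
  simp [State.setVec, Function.update_apply]

@[simp] theorem NatExp.eval_lit : (NatExp.lit k).eval s = k := rfl
@[simp] theorem NatExp.eval_dim : NatExp.dim.eval s = n := rfl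
@[simp] theorem NatExp.eval_cell (a : NatExp) : (NatExp.cell a).eval s = s.nat (a.eval s) := rfl
@[simp] theorem NatExp.eval_add (a b : NatExp) :
    (NatExp.add a b).eval s = a.eval s + b.eval s := rfl
@[simp] theorem NatExp.eval_sub (a b : NatExp) :
    (NatExp.sub a b).eval s = a.eval s - b.eval s := rfl
@[simp] theorem RealExp.eval_lit (q : ℚ) : (RealExp.lit q).eval s = q := rfl
@[simp] theorem RealExp.eval_cell (a : NatExp) :
    (RealExp.cell a).eval s = s.real (a.eval s) := rfl
@[simp] theorem RealExp.eval_add (a b : RealExp) :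
    (RealExp.add a b).eval s = a.eval s + b.eval s := rfl
@[simp] theorem RealExp.eval_sub (a b : RealExp) :
    (RealExp.sub a b).eval s = a.eval s - b.eval s := rfl
@[simp] theorem RealExp.eval_mul (a b : RealExp) :
    (RealExp.mul a b).eval s = a.eval s * b.eval s := rfl
@[simp] theorem RealExp.eval_div (a b : RealExp) :
    (RealExp.div a b).eval s = a.eval s / b.eval s := rfl
theorem RealExp.eval_coord (v i : NatExp) (j : Fin n) (h : i.eval s = j) :
    (RealExp.coord v i).eval s = s.vec (v.eval s) j := by
  simp [RealExp.eval, h]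
@[simp] theorem Test.holds_natLt (a b : NatExp) :
    (Test.natLt a b).holds s ↔ a.eval s < b.eval s := Iff.rfl
@[simp] theorem Test.holds_realLt (a b : RealExp) :
    (Test.realLt a b).holds s ↔ a.eval s < b.eval s := Iff.rfl

variable (O : Oracle n)

@[simp] theorem Instr.step_setNat (a e : NatExp) :
    (Instr.setNat a e).step O s = s.setNat (a.eval s) (e.eval s) := rfl
@[simp] theorem Instr.step_setReal (a : NatExp) (e : RealExp) :
    (Instr.setReal a e).step O s = s.setReal (a.eval s) (e.eval s) := rfl
@[simp] theorem Instr.step_setCoord (v i : NatExp) (e : RealExp) :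
    (Instr.setCoord v i e).step O s =
      s.setVec (v.eval s) (setCoordinate (s.vec (v.eval s)) (i.eval s) (e.eval s)) := rfl
@[simp] theorem Instr.step_value (a v : NatExp) :
    (Instr.value a v).step O s = s.setReal (a.eval s) (O.value (s.vec (v.eval s))) := rfl
@[simp] theorem Instr.step_grad (w v : NatExp) :
    (Instr.grad w v).step O s = s.setVec (w.eval s) (O.grad (s.vec (v.eval s))) := rfl
theorem Instr.step_lin_some (f w c' a : NatExp) (b : RealExp) {x : Vec n}
    (h : O.lin (s.vec (c'.eval s)) (s.vec (a.eval s)) (b.eval s) = some x) :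
    (Instr.lin f w c' a b).step O s = (s.setNat (f.eval s) 1).setVec (w.eval s) x := by
  simp [Instr.step, h, State.setNat, State.setVec]
theorem Instr.step_lin_none (f w c' a : NatExp) (b : RealExp)
    (h : O.lin (s.vec (c'.eval s)) (s.vec (a.eval s)) (b.eval s) = none) :
    (Instr.lin f w c' a b).step O s = s.setNat (f.eval s) 0 := by
  simp [Instr.step, h, State.setNat]

end simps

/-- Rule for counting loops; the invariant speaks about the state at the beginning of an iteration,
whose number is in the counter cell. -/
theorem Run.forLoop {O : Oracle n} {s : State n} {c : ℕ} {N : NatExp} {p : Prog} {T K : ℕ}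
    (J : ℕ → State n → Prop) (hs : J 0 (s.setNat c 0))
    (hN : ∀ k ≤ K, ∀ s, J k s → s.nat c = k → N.eval s = K)
    (hstep : ∀ k < K, ∀ s, J k s → s.nat c = k →
      Run O p s T (fun s' => s'.nat c = k ∧ J (k + 1) (s'.setNat c (k + 1)))) :
    Run O (WeakDR.forLoop c N p) s (K * (T + 2) + 2) (fun s' => s'.nat c = K ∧ J K s') := by
  have h1 := Run.loop (O := O) (s := s.setNat c 0) (K := K) (T := T + 1)
    (b := .natLt (.cell (.lit c)) N)
    (p := .seq p (.instr (.setNat (.lit c) (.add (.cell (.lit c)) (.lit 1)))))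
    (fun k s' => s'.nat c = k ∧ J k s') ⟨by simp, hs⟩
    (fun s' h => by simp [h.1, hN K le_rfl s' h.2 h.1])
    (fun k hk s' h => by simp [h.1, hN k hk.le s' h.2 h.1, hk])
    (fun k hk s' h => Run.seq (hstep k hk s' h.2 h.1) fun s'' h' => Run.instr (by
      simpa [h'.1] using h'.2))
  refine (Run.instr_seq (O := O) (s := s) (a := .setNat (.lit c) (.lit 0)) h1).mono ?_
    fun s h => h
  have : K * (T + 1 + 1) = K * (T + 2) := rfl
  omega

/-- `for i := 0 to n - 1 do v[i] := e`, with the counter in the natural-number cell `0`. -/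
def vecLoop (v : NatExp) (e : RealExp) : Prog :=
  forLoop 0 .dim (.instr (.setCoord v (.cell (.lit 0)) e))

theorem State.ext' {s s' : State n} (h1 : s.nat = s'.nat) (h2 : s.real = s'.real)
    (h3 : s.vec = s'.vec) : s = s' := by
  cases s; cases s'; simp_all

/-- Number of steps of a loop over the coordinates with one instruction in the body. -/
def coordTime (n : ℕ) : ℕ := n * 3 + 2

theorem Run.vecLoop {O : Oracle n} {s : State n} {v : NatExp} {e : RealExp} (d : ℕ)
    (f : Fin n → ℝ) (hv : ∀ k x, v.eval ((s.setNat 0 k).setVec d x) = d)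
    (he : ∀ (i : Fin n) (x : Vec n), x i = s.vec d i →
      e.eval ((s.setNat 0 i).setVec d x) = f i) :
    Run O (WeakDR.vecLoop v e) s (coordTime n)
      (fun s' => s' = (s.setNat 0 n).setVec d (WithLp.toLp 2 f)) := by
  have h1 := Run.forLoop (O := O) (s := s) (c := 0) (N := .dim)
    (p := .instr (.setCoord v (.cell (.lit 0)) e)) (T := 1) (K := n)
    (fun k s' => s' = (s.setNat 0 k).setVec d
      (WithLp.toLp 2 fun i : Fin n => if (i : ℕ) < k then f i else s.vec d i))
    (by
      refine State.ext' rfl rfl ?_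
      simp [State.setVec, State.setNat])
    (fun _ _ _ _ _ => rfl)
    (fun k hk s' hs' hc => by
      refine Run.instr ?_
      rw [hs']
      simp only [Instr.step_setCoord, hv, State.setVec_vec, if_true]
      refine ⟨by simp, ?_⟩
      have hek := he ⟨k, hk⟩ (WithLp.toLp 2 fun i : Fin n => if (i : ℕ) < k then f i else s.vec d i)
        (by simp)
      simp only at hek
      rw [hek]
      refine State.ext' ?_ rfl ?_
      · simp [State.setVec, State.setNat]
      · simp only [State.setVec, State.setNat, NatExp.eval_cell, NatExp.eval_lit,
          Function.update_self, Function.update_idem]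
        congr 1
        ext i
        simp only [setCoordinate]
        by_cases h : (i : ℕ) = k
        · subst h; simp
        · have h2 : (i : ℕ) < k + 1 ↔ (i : ℕ) < k := by omega
          simp [h, h2])
  refine h1.mono (by unfold coordTime; omega) fun s' h => ?_
  rw [h.2]
  congr 2
  funext i
  simp

/-- `r5 := Σ_i e`, with the counter in the natural-number cell `0`. -/
def sumLoop (e : RealExp) : Prog :=
  .seq (.instr (.setReal (.lit 5) (.lit 0)))
    (forLoop 0 .dim (.instr (.setReal (.lit 5) (.add (.cell (.lit 5)) e))))

theorem Run.sumLoop {O : Oracle n} {s : State n} {e : RealExp} (f : Fin n → ℝ)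
    (he : ∀ (i : Fin n) (r : ℝ), e.eval ((s.setNat 0 i).setReal 5 r) = f i) :
    Run O (WeakDR.sumLoop e) s (1 + coordTime n)
      (fun s' => s' = (s.setNat 0 n).setReal 5 (∑ i, f i)) := by
  refine Run.instr_seq ?_
  have h1 := Run.forLoop (O := O) (s := (Instr.setReal (.lit 5) (.lit 0)).step O s) (c := 0)
    (N := .dim)
    (p := .instr (.setReal (.lit 5) (.add (.cell (.lit 5)) e))) (T := 1) (K := n)
    (fun k s' => s' = (s.setNat 0 k).setReal 5 ((Finset.univ.filter fun i : Fin n => (i : ℕ) < k).sum f))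
    (by
      refine State.ext' rfl ?_ rfl
      simp [State.setReal, State.setNat])
    (fun _ _ _ _ _ => rfl)
    (fun k hk s' hs' hc => by
      refine Run.instr ?_
      rw [hs']
      simp only [Instr.step_setReal, RealExp.eval_add, NatExp.eval_lit, RealExp.eval_cell,
        State.setReal_real, if_true]
      have hek := he ⟨k, hk⟩ ((Finset.univ.filter fun i : Fin n => (i : ℕ) < k).sum f)
      simp only at hek
      rw [hek]
      refine ⟨by simp, State.ext' ?_ ?_ rfl⟩
      · simp [State.setReal, State.setNat]
      · simp only [State.setReal, State.setNat, Function.update_idem]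
        congr 1
        have : (Finset.univ.filter fun i : Fin n => (i : ℕ) < k + 1) =
            insert ⟨k, hk⟩ (Finset.univ.filter fun i : Fin n => (i : ℕ) < k) := by
          ext i
          simp only [Finset.mem_filter, Finset.mem_univ, true_and, Finset.mem_insert, Fin.ext_iff]
          omega
        rw [this, Finset.sum_insert (by simp), add_comm])
  refine h1.mono (by unfold coordTime; omega) fun s' h => ?_
  rw [h.2]
  rw [Finset.filter_true_of_mem fun i _ => i.2]

/-! ### Polynomial running times -/

/-- `f` is bounded by a polynomial in its two arguments. -/
def PolyBounded (f : ℕ → ℕ → ℕ) : Prop := ∃ c k : ℕ, ∀ a b, f a b ≤ c * (a + b + 1) ^ k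

namespace PolyBounded

variable {f g : ℕ → ℕ → ℕ}

theorem const (c : ℕ) : PolyBounded fun _ _ => c := ⟨c, 0, by simp⟩

theorem left : PolyBounded fun a _ => a := ⟨1, 1, fun a b => by simp; omega⟩

theorem right : PolyBounded fun _ b => b := ⟨1, 1, fun a b => by simp; omega⟩

theorem add (hf : PolyBounded f) (hg : PolyBounded g) : PolyBounded fun a b => f a b + g a b := by
  obtain ⟨c, k, h⟩ := hf
  obtain ⟨d, l, h'⟩ := hg
  refine ⟨c + d, k + l, fun a b => ?_⟩
  have h1 : (a + b + 1) ^ k ≤ (a + b + 1) ^ (k + l) := Nat.pow_le_pow_right (by omega) (by omega)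
  have h2 : (a + b + 1) ^ l ≤ (a + b + 1) ^ (k + l) := Nat.pow_le_pow_right (by omega) (by omega)
  rw [add_mul]
  exact add_le_add ((h a b).trans (Nat.mul_le_mul_left c h1))
    ((h' a b).trans (Nat.mul_le_mul_left d h2))

theorem mul (hf : PolyBounded f) (hg : PolyBounded g) : PolyBounded fun a b => f a b * g a b := by
  obtain ⟨c, k, h⟩ := hf
  obtain ⟨d, l, h'⟩ := hg
  refine ⟨c * d, k + l, fun a b => (Nat.mul_le_mul (h a b) (h' a b)).trans (le_of_eq ?_)⟩
  rw [pow_add]; ring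

theorem pow (hf : PolyBounded f) : ∀ k : ℕ, PolyBounded fun a b => f a b ^ k
  | 0 => by simpa using const 1
  | k + 1 => by simpa only [pow_succ] using (pow hf k).mul hf

/-- Running times that are polynomial in `n` and `⌈1 / δ⌉`, in terms of `n + 1 / δ`. -/
theorem exists_real_bound (hf : PolyBounded f) :
    ∃ K : ℕ, ∀ δ : ℝ, 0 < δ → δ < 1 → ∀ n : ℕ,
      (f n ⌈1 / δ⌉₊ : ℝ) ≤ K * ((n : ℝ) + 1 / δ) ^ K := by
  obtain ⟨c, k, h⟩ := hf
  refine ⟨c * 3 ^ k + k, fun δ h0 h1 n => ?_⟩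
  have hd : 1 ≤ 1 / δ := by rw [le_div_iff₀ h0]; linarith
  have hM := Nat.ceil_lt_add_one (a := 1 / δ) (by linarith)
  have hn : (0 : ℝ) ≤ n := Nat.cast_nonneg n
  have h2 : (f n ⌈1 / δ⌉₊ : ℝ) ≤ c * ((n : ℝ) + ⌈1 / δ⌉₊ + 1) ^ k := by
    exact_mod_cast h n ⌈1 / δ⌉₊
  have h3 : ((n : ℝ) + ⌈1 / δ⌉₊ + 1) ^ k ≤ (3 * (n + 1 / δ)) ^ k :=
    pow_le_pow_left₀ (by positivity) (by linarith) k
  have h4 : ((n : ℝ) + 1 / δ) ^ k ≤ (n + 1 / δ) ^ (c * 3 ^ k + k) :=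
    pow_le_pow_right₀ (by linarith) (by omega)
  have h5 : (0 : ℝ) ≤ (n + 1 / δ) ^ (c * 3 ^ k + k) := by positivity
  calc (f n ⌈1 / δ⌉₊ : ℝ) ≤ c * (3 * (n + 1 / δ)) ^ k :=
        h2.trans (mul_le_mul_of_nonneg_left h3 (Nat.cast_nonneg c))
    _ = c * 3 ^ k * (n + 1 / δ) ^ k := by rw [mul_pow]; ring
    _ ≤ c * 3 ^ k * (n + 1 / δ) ^ (c * 3 ^ k + k) := mul_le_mul_of_nonneg_left h4 (by positivity)
    _ ≤ _ := by
        push_cast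
        have : (0 : ℝ) ≤ (k : ℝ) * (n + 1 / δ) ^ (c * 3 ^ k + k) := by positivity
        linarith

end PolyBounded

theorem exists_bound_of_fixed {K : ℕ} {δ : ℝ} (h0 : 0 < δ) (h1 : δ < 1) :
    ∃ K' : ℕ, ∀ n : ℕ, (K : ℝ) * ((n : ℝ) + 1 / δ) ^ K ≤ K' * ((n : ℝ) + 1) ^ K' := by
  have hd : 1 ≤ 1 / δ := by rw [le_div_iff₀ h0]; linarith
  refine ⟨⌈(K : ℝ) * (1 / δ) ^ K⌉₊ + K, fun n => ?_⟩
  have hn : (0 : ℝ) ≤ n := Nat.cast_nonneg n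
  have h2 : ((n : ℝ) + 1 / δ) ^ K ≤ (1 / δ * (n + 1)) ^ K :=
    pow_le_pow_left₀ (by positivity) (by nlinarith) K
  have h3 : ((n : ℝ) + 1) ^ K ≤ (n + 1) ^ (⌈(K : ℝ) * (1 / δ) ^ K⌉₊ + K) :=
    pow_le_pow_right₀ (by linarith) (by omega)
  calc (K : ℝ) * ((n : ℝ) + 1 / δ) ^ K ≤ K * (1 / δ * (n + 1)) ^ K :=
        mul_le_mul_of_nonneg_left h2 (Nat.cast_nonneg K)
    _ = K * (1 / δ) ^ K * (n + 1) ^ K := by rw [mul_pow]; ring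
    _ ≤ K * (1 / δ) ^ K * (n + 1) ^ (⌈(K : ℝ) * (1 / δ) ^ K⌉₊ + K) :=
        mul_le_mul_of_nonneg_left h3 (by positivity)
    _ ≤ _ := by
        refine mul_le_mul_of_nonneg_right ?_ (by positivity)
        push_cast
        linarith [Nat.le_ceil ((K : ℝ) * (1 / δ) ^ K), Nat.cast_nonneg (α := ℝ) K]

/-! ### Step length -/

/-- Content of a real cell. -/
abbrev rc (k : ℕ) : RealExp := .cell (.lit k)

/-- Content of a natural-number cell. -/
abbrev nc (k : ℕ) : NatExp := .cell (.lit k)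

/-- The coordinate of the vector cell `v` that a coordinate loop is working on. -/
def cv (v : ℕ) : RealExp := .coord (.lit v) (.cell (.lit 0))

theorem cv_eval (s : State n) (v : ℕ) (i : Fin n) (h : s.nat 0 = i) :
    (cv v).eval s = s.vec v i := RealExp.eval_coord s _ _ i h

@[simp] theorem cv_eval_setVec (s : State n) (v d : ℕ) (i : Fin n) (x : Vec n) :
    (cv v).eval ((s.setNat 0 i).setVec d x) = if v = d then x i else s.vec v i := by
  rw [cv_eval _ v i (by simp)]
  simp only [State.setVec_vec, State.setNat_vec]
  split_ifs <;> rfl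

@[simp] theorem cv_eval_setReal (s : State n) (v d : ℕ) (i : Fin n) (r : ℝ) :
    (cv v).eval ((s.setNat 0 i).setReal d r) = s.vec v i := by
  rw [cv_eval _ v i (by simp)]; rfl

/-- Computes `N = a M` and `m = b M` for `M = ⌈1 / δ⌉`, and the step length `h = 1 / N`. The
results are left in the natural-number cells `1` and `2` and in the real cell `2`. -/
def initProg (a b : ℕ) : Prog :=
  .seq (.while (.realLt (rc 14) (.lit 1))
    (.seq (.instr (.setReal (.lit 14) (.add (rc 14) (rc 1))))
    (.seq (.instr (.setReal (.lit 15) (.add (rc 15) (.lit a))))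
    (.seq (.instr (.setNat (.lit 1) (.add (nc 1) (.lit a))))
      (.instr (.setNat (.lit 2) (.add (nc 2) (.lit b))))))))
  (.instr (.setReal (.lit 2) (.div (.lit 1) (rc 15))))

/-- The state reached by `initProg`. -/
def initState (n : ℕ) (γ δ : ℝ) (a b M : ℕ) (h : ℝ) : State n where
  nat := fun k => if k = 1 then a * M else if k = 2 then b * M else 0
  real := fun k => if k = 0 then γ else if k = 1 then δ else if k = 2 then h else
    if k = 14 then M * δ else if k = 15 then a * M else 0
  vec := fun _ => 0

theorem Run.initProg {O : Oracle n} {γ δ : ℝ} (hδ : 0 < δ) (a b : ℕ) :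
    Run O (WeakDR.initProg a b) (State.init n γ δ) (⌈1 / δ⌉₊ * 5 + 2)
      (fun s => s = initState n γ δ a b ⌈1 / δ⌉₊ (1 / (a * ⌈1 / δ⌉₊ : ℝ))) := by
  have h1 := Run.loop (O := O) (s := State.init n γ δ) (K := ⌈1 / δ⌉₊) (T := 4)
    (b := .realLt (rc 14) (.lit 1))
    (p := .seq (.instr (.setReal (.lit 14) (.add (rc 14) (rc 1))))
      (.seq (.instr (.setReal (.lit 15) (.add (rc 15) (.lit a))))
      (.seq (.instr (.setNat (.lit 1) (.add (nc 1) (.lit a))))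
        (.instr (.setNat (.lit 2) (.add (nc 2) (.lit b)))))))
    (fun k s => s = initState n γ δ a b k 0)
    (by
      refine State.ext' ?_ ?_ rfl
      · funext k; simp [State.init, initState]
      · funext k; simp [State.init, initState])
    (by
      rintro s rfl
      have := (div_le_iff₀ hδ).1 (Nat.le_ceil (1 / δ))
      simpa [initState] using this)
    (by
      rintro k hk s rfl
      have h2 : (k : ℝ) < 1 / δ := Nat.lt_ceil.1 hk
      rw [lt_div_iff₀ hδ] at h2
      simpa [initState] using h2)
    (by
      rintro k hk s rfl
      refine Run.instr_seq (Run.instr_seq (Run.instr_seq (Run.instr ?_)))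
      refine State.ext' ?_ ?_ ?_
      · funext j
        simp [initState, State.setNat, Function.update_apply, State.setReal]
        split_ifs <;> first | rfl | omega
      · funext j
        simp [initState, State.setNat, Function.update_apply, State.setReal]
        split_ifs <;> first | rfl | omega | ring
      · rfl)
  refine (Run.seq h1 fun s' h => Run.instr (Q := fun s => s =
    initState n γ δ a b ⌈1 / δ⌉₊ (1 / (a * ⌈1 / δ⌉₊ : ℝ))) ?_).mono (by omega) fun _ h => h
  rw [h]
  refine State.ext' rfl ?_ rfl
  funext j
  simp [initState, State.setReal, Function.update_apply]
  split_ifs <;> first | rfl | omega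

/-! ### Continuous greedy for monotone functions -/

/-- One step of continuous greedy with the solution in vector cell `0`. -/
def greedyBody : Prog :=
  .seq (.instr (.grad (.lit 5) (.lit 0)))
  (.seq (.instr (.lin (.lit 4) (.lit 12) (.lit 5) (.lit 1) (.lit 0)))
    (vecLoop (.lit 0) (.add (cv 0) (.mul (rc 2) (cv 12)))))

/-- Continuous greedy. -/
def greedyProg : Prog := .seq (initProg 1 0) (forLoop 8 (nc 1) greedyBody)

/-- State of continuous greedy after `k` steps. -/
def GreedyInv (F : Vec n → ℝ) (P : Set (Vec n)) (γ v h e : ℝ) (k : ℕ) (y : Vec n) : Prop :=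
  BelowWeight P (k * h) y ∧ (1 - (1 - h * γ) ^ k) * v - k * (h ^ 2 * e) ≤ F y

theorem GreedyInv.step {γ L : ℝ} {P : Set (Vec n)} {O : Oracle n} (I : IsInstance γ L P O)
    (h0 : 0 < γ) (h1 : γ < 1) {h : ℝ} (hh : 0 < h) {k : ℕ} (hk : (k + 1) * h ≤ 1) {y w o : Vec n}
    (ho : o ∈ P) (hi : GreedyInv O.value P γ (O.value o) h (L * Metric.diam P ^ 2) k y)
    (hw : w ∈ P) (hmax : ∀ x ∈ P, inner ℝ (O.grad y) x ≤ inner ℝ (O.grad y) w) :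
    GreedyInv O.value P γ (O.value o) h (L * Metric.diam P ^ 2) (k + 1)
      (WithLp.toLp 2 fun i => y i + h * w i) := by
  obtain ⟨hb, hF⟩ := hi
  have hkh : (k : ℝ) * h ≤ 1 := by linarith
  have hyP := hb.mem I hkh
  have hyc := I.subset_cube hyP
  have hwc := I.subset_cube hw
  have hoc := I.subset_cube ho
  set y' : Vec n := WithLp.toLp 2 fun i => y i + h * w i with hy'
  have ey : y' = y + h • w := by ext i; simp [hy']
  have hb' : BelowWeight P (k * h + h) y' := hb.add I (by positivity) hh hw
    (fun i => add_nonneg (hyc i).1 (mul_nonneg hh.le (hwc i).1)) (fun i => le_rfl)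
  have hk1 : (k : ℝ) * h + h = ((k + 1 : ℕ) : ℝ) * h := by push_cast; ring
  rw [hk1] at hb'
  have hy'P := hb'.mem I (by push_cast; exact hk)
  refine ⟨hb', ?_⟩
  have hbd := I.lower_bound (v := h • w) (c := h) hyc (by rw [← ey]; exact I.subset_cube hy'P) (by
    rw [norm_smul, Real.norm_of_nonneg hh.le]
    exact mul_le_mul_of_nonneg_left (I.norm_le hw) hh.le)
  rw [← ey, real_inner_smul_right] at hbd
  -- the join of `y` and `o`
  set j : Vec n := WithLp.toLp 2 fun i => max (y i) (o i) with hj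
  have ej : ∀ i, j i = max (y i) (o i) := fun i => rfl
  have hjc : j ∈ cube n := fun i => by
    rw [ej]; exact ⟨(hyc i).1.trans (le_max_left _ _), max_le (hyc i).2 (hoc i).2⟩
  have d1 := increment_le_inner I.smooth I.weaklyDR (x := y) (v := j - y) hyc (by simpa using hjc)
    (fun i => by
      simp only [PiLp.sub_apply, ej, sub_nonneg]
      exact le_max_left _ _)
  have d2 : O.value o ≤ O.value j := by
    obtain ⟨c, hc, hm⟩ := exists_mean_value I.smooth (x := o) (v := j - o) hoc (by simpa using hjc)
    have hg := gradient_nonneg h1 I.smooth I.weaklyDR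
      (add_smul_mem_cube hoc (by simpa using hjc) ⟨hc.1.le, hc.2.le⟩ : o + c • (j - o) ∈ cube n)
    have hnn : 0 ≤ inner ℝ (O.grad (o + c • (j - o))) (j - o) := by
      rw [inner_eq_sum]
      refine Finset.sum_nonneg fun i _ => mul_nonneg (hg i) ?_
      simp only [PiLp.sub_apply, ej, sub_nonneg]
      exact le_max_right _ _
    rw [← hm, add_sub_cancel] at hnn
    linarith
  have d3 : inner ℝ (O.grad y) (j - y) ≤ inner ℝ (O.grad y) o := by
    rw [inner_eq_sum, inner_eq_sum]
    refine Finset.sum_le_sum fun i _ => mul_le_mul_of_nonneg_left ?_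
      (gradient_nonneg h1 I.smooth I.weaklyDR hyc i)
    simp only [PiLp.sub_apply, ej]
    have := max_le (a := y i) (b := o i) (c := y i + o i) (by linarith [(hoc i).1])
      (by linarith [(hyc i).1])
    linarith
  rw [add_sub_cancel] at d1
  have d4 : γ * (O.value o - O.value y) ≤ inner ℝ (O.grad y) w := by
    have := mul_le_mul_of_nonneg_left d2 h0.le
    linarith [hmax o ho]
  have d5 := mul_le_mul_of_nonneg_left d4 hh.le
  have hhγ : h * γ ≤ 1 := by
    have : 0 ≤ (k : ℝ) * h := by positivity
    have : h ≤ 1 := by linarith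
    nlinarith
  have d6 := mul_le_mul_of_nonneg_left hF (sub_nonneg.2 hhγ)
  have hL := I.smoothness_nonneg
  have d7 : 0 ≤ (h * γ) * (k * (h ^ 2 * (L * Metric.diam P ^ 2))) := by positivity
  rw [pow_succ]
  push_cast
  linarith

theorem Run.greedyProg {γ L : ℝ} {P : Set (Vec n)} {O : Oracle n} (I : IsInstance γ L P O)
    (h0 : 0 < γ) (h1 : γ < 1) {δ : ℝ} (hδ : 0 < δ) :
    Run O WeakDR.greedyProg (State.init n γ δ)
      (⌈1 / δ⌉₊ * 5 + 2 + (⌈1 / δ⌉₊ * (2 + coordTime n + 2) + 2)) (fun s => s.vec 0 ∈ P ∧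
        ∀ y ∈ P, Phi γ * O.value y - 1 * (δ * Metric.diam P ^ 2 * L) ≤ O.value (s.vec 0)) := by
  obtain ⟨o, ho, hmax⟩ := I.exists_max
  set N := ⌈1 / δ⌉₊ with hN
  have hN0 : 0 < N := Nat.ceil_pos.2 (by positivity)
  have hN0' : (0 : ℝ) < N := Nat.cast_pos.2 hN0
  set h : ℝ := 1 / N with hh
  have hhpos : 0 < h := by positivity
  have hNh : (N : ℝ) * h = 1 := by rw [hh]; field_simp
  have hhδ : h ≤ δ := by
    rw [hh, div_le_iff₀ hN0']
    have := (div_le_iff₀ hδ).1 (Nat.le_ceil (1 / δ))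
    linarith
  refine Run.seq (Run.initProg hδ 1 0) ?_
  rintro s rfl
  refine (Run.forLoop (K := N) (T := 2 + coordTime n) (fun k s => (s.nat 1 = N ∧ s.real 2 = h ∧
      s.vec 1 = 0) ∧ GreedyInv O.value P γ (O.value o) h (L * Metric.diam P ^ 2) k (s.vec 0))
    ⟨by simp [initState, hh, hN], ?_⟩ ?_ ?_).mono (by omega) ?_
  · refine ⟨BelowWeight.zero I _, ?_⟩
    simpa [initState] using I.nonneg 0 zero_mem_cube
  · rintro k hk s ⟨hs, -⟩ -
    simp [hs.1]
  · rintro k hk s ⟨⟨hs1, hs2, hs3⟩, hi⟩ hc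
    obtain ⟨w, hlin, hw, hwmax⟩ := I.lin_zero (O.grad (s.vec 0))
    refine (Run.instr_seq (Run.instr_seq ?_)).mono (le_of_eq (by ring : 1 + (1 + coordTime n) = _))
      fun _ h => h
    rw [Instr.step_lin_some (x := w) (h := by simpa [hs3] using hlin)]
    refine (Run.vecLoop (O := O) 0 (fun i => s.vec 0 i + h * w i) (by simp)
      (by simp +contextual [hs2])).mono le_rfl ?_
    rintro _ rfl
    have hk1 : ((k : ℝ) + 1) * h ≤ 1 := by
      have : ((k : ℝ) + 1) ≤ N := by exact_mod_cast hk
      exact (mul_le_mul_of_nonneg_right this hhpos.le).trans hNh.le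
    refine ⟨by simp [hc], ⟨by simp [hs1, hs2, hs3], ?_⟩⟩
    simpa using hi.step I h0 h1 hhpos hk1 ho hw hwmax
  · rintro s ⟨-, ⟨-, hb, hF⟩⟩
    refine ⟨hb.mem I hNh.le, fun y hy => ?_⟩
    have hv := I.nonneg _ (I.subset_cube ho)
    have e1 : (1 - h * γ) ^ N ≤ Real.exp (-γ) := by
      have : 1 - h * γ ≤ Real.exp (-(h * γ)) := by linarith [Real.add_one_le_exp (-(h * γ))]
      have hhγ : 0 ≤ 1 - h * γ := by
        have : h ≤ 1 := by
          have : (1 : ℝ) ≤ N := by exact_mod_cast hN0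
          rw [← hNh]; nlinarith
        nlinarith
      refine (pow_le_pow_left₀ hhγ this N).trans (le_of_eq ?_)
      rw [← Real.exp_nat_mul]
      congr 1
      linear_combination -γ * hNh
    have hPhi := Phi_le_of_lt_one h0 h1
    have hPhi0 : 0 ≤ Phi γ := (mul_nonneg h0.le (Real.exp_pos _).le).trans
      (lt_Phi_of_lt_one h0 h1).le
    have e2 : (N : ℝ) * (h ^ 2 * (L * Metric.diam P ^ 2)) = h * (L * Metric.diam P ^ 2) := by
      linear_combination h * (L * Metric.diam P ^ 2) * hNh
    have e3 := mul_le_mul_of_nonneg_right hhδ I.smoothness_nonneg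
    have e4 := mul_le_mul_of_nonneg_left (hmax y hy) hPhi0
    have e5 := mul_le_mul_of_nonneg_right hPhi hv
    have e6 := mul_le_mul_of_nonneg_right e1 hv
    linarith

/-! ### Fragments of the aided algorithm

Memory layout. Natural-number cells: `0` coordinate counter, `1` the number `N` of steps, `2` the
number `m` of steps of the first phase, `3` the number `N²`, `4` flag, `5`, `6`, `7` head, tail and
end of the current level of the queue, `8` to `12` loop counters. Real cells: `2` step length `h`,
`3` scale `S` of the guesses, `4` best value, `5` accumulator, `7` best gap, `8` right-hand side of
the linear constraint, `9` and `10` guaranteed value and its increment, `11` and `12` guesses, `13`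
the power `(1 - h)^m`, `16` value of a candidate. Vector cells: `0` best point, `1` zero, `2` the
local optimum `z`, `3` to `7` double greedy, `8` to `11` greedy, `12` to `15` local search, and from
`20` on the queue. -/

/-- The states `s` and `s'` agree outside the given natural-number, real and vector cells. -/
def SameExcept (A B C : Set ℕ) (s s' : State n) : Prop :=
  (∀ k, k ∉ A → s'.nat k = s.nat k) ∧ (∀ k, k ∉ B → s'.real k = s.real k) ∧
    ∀ k, k ∉ C → s'.vec k = s.vec k

theorem SameExcept.refl (A B C : Set ℕ) (s : State n) : SameExcept A B C s s :=
  ⟨fun _ _ => rfl, fun _ _ => rfl, fun _ _ => rfl⟩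

theorem SameExcept.trans {A B C : Set ℕ} {s s' s'' : State n} (h : SameExcept A B C s s')
    (h' : SameExcept A B C s' s'') : SameExcept A B C s s'' :=
  ⟨fun k hk => (h'.1 k hk).trans (h.1 k hk), fun k hk => (h'.2.1 k hk).trans (h.2.1 k hk),
    fun k hk => (h'.2.2 k hk).trans (h.2.2 k hk)⟩

theorem SameExcept.mono {A B C A' B' C' : Set ℕ} {s s' : State n} (h : SameExcept A B C s s')
    (hA : A ⊆ A') (hB : B ⊆ B') (hC : C ⊆ C') : SameExcept A' B' C' s s' :=
  ⟨fun k hk => h.1 k fun hm => hk (hA hm), fun k hk => h.2.1 k fun hm => hk (hB hm),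
    fun k hk => h.2.2 k fun hm => hk (hC hm)⟩

theorem SameExcept.setNat {A B C : Set ℕ} {s s' : State n} (h : SameExcept A B C s s') {c : ℕ}
    (hc : c ∈ A) (k : ℕ) : SameExcept A B C s (s'.setNat c k) :=
  ⟨fun j hj => by
    have : j ≠ c := fun e => hj (e ▸ hc)
    simpa [this] using h.1 j hj, h.2.1, h.2.2⟩

theorem SameExcept.setReal {A B C : Set ℕ} {s s' : State n} (h : SameExcept A B C s s') {c : ℕ}
    (hc : c ∈ B) (r : ℝ) : SameExcept A B C s (s'.setReal c r) :=
  ⟨h.1, fun j hj => by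
    have : j ≠ c := fun e => hj (e ▸ hc)
    simpa [this] using h.2.1 j hj, h.2.2⟩

theorem SameExcept.setVec {A B C : Set ℕ} {s s' : State n} (h : SameExcept A B C s s') {c : ℕ}
    (hc : c ∈ C) (x : Vec n) : SameExcept A B C s (s'.setVec c x) :=
  ⟨h.1, h.2.1, fun j hj => by
    have : j ≠ c := fun e => hj (e ▸ hc)
    simpa [this] using h.2.2 j hj⟩

/-- Copies the vector cell `v` to the vector cell `d`. -/
def copyVec (d v : ℕ) : Prog := vecLoop (.lit d) (cv v)

theorem Run.copyVec {O : Oracle n} {s : State n} (d v : ℕ) :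
    Run O (WeakDR.copyVec d v) s (coordTime n)
      (fun s' => s' = (s.setNat 0 n).setVec d (s.vec v)) :=
  Run.vecLoop d (fun i => s.vec v i) (by simp) (fun i x hx => by
    rw [cv_eval_setVec]
    split_ifs with h
    · rw [hx, h]
    · rfl)

/-- A program that only overwrites the coordinate counter. -/
def skip : Prog := .instr (.setNat (.lit 0) (.lit 0))

theorem Run.skip {O : Oracle n} {s : State n} :
    Run O WeakDR.skip s 1 (fun s' => s' = s.setNat 0 0) := Run.instr (by simp)

/-- Records the vector cell `v` as the best point if its value is larger than the best value. -/
def recordBest (v : ℕ) : Prog :=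
  .seq (.instr (.value (.lit 16) (.lit v)))
    (.ite (.realLt (rc 4) (rc 16))
      (.seq (.instr (.setReal (.lit 4) (rc 16))) (copyVec 0 v)) skip)

theorem Run.recordBest {O : Oracle n} {s : State n} {v : ℕ} {P : Set (Vec n)}
    (h1 : s.vec 0 ∈ P) (h2 : s.vec v ∈ P) (h3 : s.real 4 = O.value (s.vec 0)) :
    Run O (WeakDR.recordBest v) s (coordTime n + 3) (fun s' =>
      SameExcept {0} {4, 16} {0} s s' ∧ s'.vec 0 ∈ P ∧ s'.real 4 = O.value (s'.vec 0) ∧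
        max (O.value (s.vec v)) (O.value (s.vec 0)) ≤ O.value (s'.vec 0)) := by
  refine (Run.instr_seq (Run.ite (T := 1 + coordTime n) (fun hb => ?_) (fun hb => ?_))).mono
    (by omega) fun _ h => h
  · refine Run.instr_seq ((Run.copyVec 0 v).mono le_rfl ?_)
    rintro _ rfl
    simp [h3] at hb
    refine ⟨((((SameExcept.refl _ _ _ s).setReal (by simp) _).setReal (by simp) _).setNat
      (by simp) _).setVec (by simp) _, by simpa using h2, by simp, by simp [hb.le]⟩
  · refine Run.skip.mono (by omega) ?_
    rintro _ rfl
    simp [h3] at hb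
    exact ⟨((SameExcept.refl _ _ _ s).setReal (by simp) _).setNat (by simp) _,
      by simpa using h1, by simpa using h3, by simp [hb]⟩

/-! ### Local search -/

/-- Replaces the best point of the local search by the current one. -/
def lsUpdate : Prog := .seq (.instr (.setReal (.lit 7) (rc 5))) (copyVec 14 15)

/-- One Frank-Wolfe step. -/
def lsBody : Prog :=
  .seq (.instr (.grad (.lit 5) (.lit 15)))
  (.seq (.instr (.lin (.lit 4) (.lit 13) (.lit 5) (.lit 11) (rc 8)))
  (.seq (sumLoop (.mul (cv 5) (.sub (cv 13) (cv 15))))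
  (.seq (.ite (.natLt (nc 9) (.lit 1)) lsUpdate (.ite (.realLt (rc 5) (rc 7)) lsUpdate skip))
    (vecLoop (.lit 15) (.add (cv 15) (.mul (rc 2) (.sub (cv 13) (cv 15))))))))

/-- Local search from the point in cell `12` under the constraint `r8 ≤ ⟨v11, ·⟩`; the answer is
left in cell `14`. -/
def lsProg : Prog := .seq (copyVec 15 12) (forLoop 9 (nc 3) lsBody)

theorem Run.lsUpdate {O : Oracle n} {s : State n} :
    Run O WeakDR.lsUpdate s (1 + coordTime n) (fun s' =>
      s' = ((s.setReal 7 (s.real 5)).setNat 0 n).setVec 14 (s.vec 15)) := by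
  refine Run.instr_seq ((Run.copyVec 14 15).mono le_rfl ?_)
  rintro _ rfl
  simp

/-- Running time of one step of the local search. -/
def lsTime (n : ℕ) : ℕ := 3 * coordTime n + 6

theorem Run.lsBody {γ L : ℝ} {P : Set (Vec n)} {O : Oracle n} (I : IsInstance γ L P O)
    {s : State n} {h : ℝ} (hh : h ∈ Set.Icc (0 : ℝ) 1) {k : ℕ} (hs2 : s.real 2 = h)
    (hk : s.nat 9 = k)
    (hi : LSInv O.value O.grad P (s.vec 11) (s.real 8) h (L * Metric.diam P ^ 2) k
      (s.vec 15) (s.real 7) (s.vec 14)) :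
    Run O WeakDR.lsBody s (lsTime n) (fun s' => SameExcept {0, 4} {5, 7} {5, 13, 14, 15} s s' ∧
      LSInv O.value O.grad P (s.vec 11) (s.real 8) h (L * Metric.diam P ^ 2) (k + 1)
        (s'.vec 15) (s'.real 7) (s'.vec 14)) := by
  obtain ⟨w, hlin, hw, hwb, hwmax⟩ :=
    I.lin_of_feasible (O.grad (s.vec 15)) (s.vec 11) hi.1.1 hi.1.2
  refine (Run.instr_seq (T := 1 + ((1 + coordTime n) + (coordTime n + 3 + coordTime n)))
    (Run.instr_seq ?_)).mono (by unfold lsTime; omega) fun _ h => h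
  rw [Instr.step_lin_some (x := w) (h := by simpa using hlin)]
  refine Run.seq (Run.sumLoop
    (fun i => O.grad (s.vec 15) i * (w i - s.vec 15 i)) (fun i r => by simp)) ?_
  rintro _ rfl
  have hgap : ∑ i, O.grad (s.vec 15) i * (w i - s.vec 15 i) =
      inner ℝ (O.grad (s.vec 15)) (w - s.vec 15) := by
    rw [inner_eq_sum]; rfl
  simp only [NatExp.eval_lit, Instr.step_grad, hgap]
  set gap := inner ℝ (O.grad (s.vec 15)) (w - s.vec 15) with hgapdef
  set s1 : State n := (((((s.setVec 5 (O.grad (s.vec 15))).setNat 4 1).setVec 13 w).setNat 0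
    n).setReal 5 gap) with hs1
  have same1 : SameExcept {0, 4} {5, 7} {5, 13, 14, 15} s s1 :=
    (((((SameExcept.refl _ _ _ s).setVec (by simp) _).setNat (by simp) _).setVec
      (by simp) _).setNat (by simp) _).setReal (by simp) _
  refine Run.seq (R := fun s' => SameExcept {0, 4} {5, 7} {5, 13, 14, 15} s s' ∧
    s'.vec 15 = s.vec 15 ∧ s'.vec 13 = w ∧
    ((s'.real 7 = gap ∧ s'.vec 14 = s.vec 15 ∧ (0 < k → s'.real 7 ≤ s.real 7)) ∨
      (0 < k ∧ s'.real 7 = s.real 7 ∧ s'.vec 14 = s.vec 14 ∧ s.real 7 ≤ gap)))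
    ((Run.ite (T := 1 + coordTime n + 1) (fun hb => ?_) (fun hb => ?_)).mono (by omega)
      fun _ h => h) ?_
  · refine Run.lsUpdate.mono (by omega) ?_
    rintro _ rfl
    refine ⟨((same1.setReal (by simp) _).setNat (by simp) _).setVec (by simp) _, by simp [hs1],
      by simp [hs1], Or.inl ⟨by simp [hs1], by simp [hs1], fun h0 => ?_⟩⟩
    simp [hs1, hk] at hb
    omega
  · have hk0 : 0 < k := by
      simp [hs1, hk] at hb
      omega
    refine Run.ite (T := 1 + coordTime n) (fun hb' => ?_) (fun hb' => ?_)
    · refine Run.lsUpdate.mono (by omega) ?_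
      rintro _ rfl
      refine ⟨((same1.setReal (by simp) _).setNat (by simp) _).setVec (by simp) _, by simp [hs1],
        by simp [hs1], Or.inl ⟨by simp [hs1], by simp [hs1], fun h0 => ?_⟩⟩
      simp [hs1] at hb' ⊢
      exact hb'.le
    · refine Run.skip.mono (by omega) ?_
      rintro _ rfl
      refine ⟨same1.setNat (by simp) _, by simp [hs1], by simp [hs1],
        Or.inr ⟨hk0, by simp [hs1], by simp [hs1], ?_⟩⟩
      simpa [hs1] using hb'
  · rintro s2 ⟨hsame, h15, h13, hor⟩
    have h2 : s2.real 2 = h := by rw [hsame.2.1 2 (by simp), hs2]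
    refine (Run.vecLoop 15 (fun i => s.vec 15 i + h * (w i - s.vec 15 i)) (by simp)
      (fun i x hx => by simp [h2, h13, hx, h15])).mono le_rfl ?_
    rintro _ rfl
    refine ⟨(hsame.setNat (by simp) _).setVec (by simp) _, ?_⟩
    have hstep := hi.step I hh hw hwb hwmax hor
    have e : (WithLp.toLp 2 fun i => s.vec 15 i + h * (w i - s.vec 15 i) : Vec n) =
        s.vec 15 + h • (w - s.vec 15) := by
      ext i; simp
    simpa [e] using hstep

theorem Run.lsProg {γ L : ℝ} {P : Set (Vec n)} {O : Oracle n} (I : IsInstance γ L P O)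
    (hF : ∀ x ∈ P, 0 ≤ O.value x)
    {s : State n} {h : ℝ} (hh : h ∈ Set.Icc (0 : ℝ) 1) {N : ℕ} (hs2 : s.real 2 = h)
    (hs3 : s.nat 3 = N * N) (hstart : s.vec 12 ∈ P) (hb : s.real 8 ≤ inner ℝ (s.vec 11) (s.vec 12)) :
    Run O WeakDR.lsProg s (coordTime n + (N * N * (lsTime n + 2) + 2)) (fun s' =>
      SameExcept {0, 4, 9} {5, 7} {5, 13, 14, 15} s s' ∧
      LSInv O.value O.grad P (s.vec 11) (s.real 8) h (L * Metric.diam P ^ 2) (N * N)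
        (s'.vec 15) (s'.real 7) (s'.vec 14)) := by
  refine Run.seq (Run.copyVec 15 12) ?_
  rintro _ rfl
  refine (Run.forLoop (K := N * N) (T := lsTime n) (fun k s' =>
    SameExcept {0, 4, 9} {5, 7} {5, 13, 14, 15} s s' ∧
      LSInv O.value O.grad P (s.vec 11) (s.real 8) h (L * Metric.diam P ^ 2) k
        (s'.vec 15) (s'.real 7) (s'.vec 14)) ⟨?_, ?_⟩ ?_ ?_).mono le_rfl fun s' h => h.2
  · exact (((SameExcept.refl _ _ _ s).setNat (by simp) _).setVec (by simp) _).setNat (by simp) _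
  · refine ⟨by simpa using ⟨hstart, hb⟩, by simpa using hF _ hstart, fun h0 => absurd h0 (by simp)⟩
  · rintro k hk s' ⟨hs', -⟩ -
    simp [hs'.1 3 (by simp), hs3]
  · rintro k hk s' ⟨hs', hi⟩ hc
    have e11 := hs'.2.2 11 (by simp)
    have e8 := hs'.2.1 8 (by simp)
    rw [← e11, ← e8] at hi
    refine (Run.lsBody I hh (by rw [hs'.2.1 2 (by simp), hs2]) hc hi).mono le_rfl ?_
    rintro s'' ⟨hs'', hi'⟩
    rw [e11, e8] at hi'
    refine ⟨by rw [hs''.1 9 (by simp), hc], ⟨(hs'.trans (hs''.mono (by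
      intro k; simp; tauto) (by simp) (by simp))).setNat (by simp) _, by simpa using hi'⟩⟩

/-! ### Double greedy on the box below `z` -/

/-- The ratio of double greedy for one coordinate. -/
def dgCoord : Prog :=
  .ite (.realLt (.lit 0) (cv 5))
    (.ite (.realLt (.lit 0) (.sub (.lit 0) (cv 6)))
      (.instr (.setCoord (.lit 7) (nc 0) (.div (cv 5) (.add (cv 5) (.sub (.lit 0) (cv 6))))))
      (.instr (.setCoord (.lit 7) (nc 0) (.lit 1))))
    (.instr (.setCoord (.lit 7) (nc 0) (.lit 0)))

/-- One step of double greedy. -/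
def dgBody : Prog :=
  .seq (.instr (.grad (.lit 5) (.lit 3)))
  (.seq (.instr (.grad (.lit 6) (.lit 4)))
  (.seq (forLoop 0 .dim dgCoord)
  (.seq (vecLoop (.lit 3) (.add (cv 3) (.mul (cv 7) (.mul (rc 2) (cv 2)))))
    (vecLoop (.lit 4)
      (.sub (cv 4) (.mul (.sub (.lit 1) (cv 7)) (.mul (rc 2) (cv 2))))))))

/-- Double greedy on the box below the vector in cell `2`; the answer is left in cell `3`. -/
def dgProg : Prog := .seq (copyVec 3 1) (.seq (copyVec 4 2) (forLoop 8 (nc 1) dgBody))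

theorem Run.dgCoord {O : Oracle n} {s : State n} (i : Fin n) (hi : s.nat 0 = i) :
    Run O WeakDR.dgCoord s 3 (fun s' => s' = s.setVec 7
      (setCoordinate (s.vec 7) i (dgRatio (s.vec 5 i) (0 - s.vec 6 i)))) := by
  have h5 := cv_eval s 5 i hi
  have h6 := cv_eval s 6 i hi
  unfold dgRatio
  refine Run.ite (T := 2) (fun hb => ?_) (fun hb => ?_)
  · simp [h5] at hb
    refine Run.ite (T := 1) (fun hb' => Run.instr ?_) (fun hb' => Run.instr ?_)
    · simp [h6] at hb'
      simp [hb, hb', h5, h6, hi]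
    · simp [h6] at hb'
      simp [hb, not_lt.2 hb', hi]
  · simp [h5] at hb
    refine (Run.instr ?_).mono (by omega) fun _ h => h
    simp [hi, not_lt.2 hb]

/-- Running time of one step of double greedy. -/
def dgTime (n : ℕ) : ℕ := 2 + (n * 5 + 2) + 2 * coordTime n

theorem Run.dgBody {O : Oracle n} {s : State n} {p : Fin n → ℝ}
    (hp : ∀ i, p i = dgRatio (O.grad (s.vec 3) i) (0 - O.grad (s.vec 4) i)) :
    Run O WeakDR.dgBody s (dgTime n) (fun s' =>
      SameExcept {0} ∅ {3, 4, 5, 6, 7} s s' ∧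
      s'.vec 3 = WithLp.toLp 2 (fun i => s.vec 3 i + p i * (s.real 2 * s.vec 2 i)) ∧
      s'.vec 4 = WithLp.toLp 2 (fun i => s.vec 4 i - (1 - p i) * (s.real 2 * s.vec 2 i))) := by
  refine (Run.instr_seq (T := 1 + (n * 5 + 2 + (coordTime n + coordTime n)))
    (Run.instr_seq ?_)).mono (by unfold dgTime; omega) fun _ h => h
  simp only [Instr.step_grad, NatExp.eval_lit]
  set s1 := (s.setVec 5 (O.grad (s.vec 3))).setVec 6
    (O.grad ((s.setVec 5 (O.grad (s.vec 3))).vec 4)) with hs1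
  have same1 : SameExcept {0} ∅ {3, 4, 5, 6, 7} s s1 :=
    ((SameExcept.refl _ _ _ s).setVec (by simp) _).setVec (by simp) _
  refine Run.seq (Run.forLoop (K := n) (T := 3) (fun k s' =>
    SameExcept {0} ∅ {7} s1 s' ∧ ∀ i : Fin n, (i : ℕ) < k → s'.vec 7 i = p i)
    ⟨(SameExcept.refl _ _ _ s1).setNat (by simp) _, fun i hi => absurd hi (by simp)⟩
    (fun _ _ _ _ _ => rfl) ?_) ?_
  · rintro k hk s' ⟨hs', hpk⟩ hc
    refine (Run.dgCoord ⟨k, hk⟩ hc).mono le_rfl ?_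
    rintro _ rfl
    refine ⟨by simpa using hc, (hs'.setVec (by simp) _).setNat (by simp) _, fun i hi => ?_⟩
    have e5 : s'.vec 5 = O.grad (s.vec 3) := by rw [hs'.2.2 5 (by simp)]; simp [hs1]
    have e6 : s'.vec 6 = O.grad (s.vec 4) := by rw [hs'.2.2 6 (by simp)]; simp [hs1]
    simp only [State.setNat_vec, State.setVec_vec, if_true, setCoordinate]
    split_ifs with h
    · have : i = ⟨k, hk⟩ := Fin.ext h
      rw [e5, e6, ← hp, this]
    · exact hpk i (by omega)
  · rintro s2 ⟨-, hs2, hp2⟩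
    have hp2' : ∀ i, s2.vec 7 i = p i := fun i => hp2 i i.2
    have same2 : SameExcept {0} ∅ {3, 4, 5, 6, 7} s s2 :=
      same1.trans (hs2.mono le_rfl le_rfl (by simp))
    have e3 : s2.vec 3 = s.vec 3 := by rw [hs2.2.2 3 (by simp)]; simp [hs1]
    have e4 : s2.vec 4 = s.vec 4 := by rw [hs2.2.2 4 (by simp)]; simp [hs1]
    have e2 : s2.vec 2 = s.vec 2 := same2.2.2 2 (by simp)
    have er : s2.real 2 = s.real 2 := same2.2.1 2 (by simp)
    refine Run.seq (Run.vecLoop 3 (fun i => s.vec 3 i + p i * (s.real 2 * s.vec 2 i)) (by simp)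
      (fun i x hx => by simp [hx, e3, hp2', e2, er])) ?_
    rintro _ rfl
    refine (Run.vecLoop 4 (fun i => s.vec 4 i - (1 - p i) * (s.real 2 * s.vec 2 i)) (by simp)
      (fun i x hx => by
        simp at hx
        simp [hx, e4, hp2', e2, er])).mono le_rfl ?_
    rintro _ rfl
    exact ⟨(((same2.setNat (by simp) _).setVec (by simp) _).setNat (by simp) _).setVec (by simp) _,
      by simp, by simp⟩

theorem Run.dgProg {L : ℝ} {P : Set (Vec n)} {O : Oracle n} (I : IsInstance 1 L P O)
    {s : State n} {h : ℝ} (hh : 0 ≤ h) {N : ℕ} (hN : N * h = 1) (hs1 : s.nat 1 = N)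
    (hs2 : s.real 2 = h) (hv1 : s.vec 1 = 0) (hz : s.vec 2 ∈ P) {q : Vec n}
    (hq : ∀ i, 0 ≤ q i ∧ q i ≤ s.vec 2 i) :
    Run O WeakDR.dgProg s (2 * coordTime n + (N * (dgTime n + 2) + 2)) (fun s' =>
      SameExcept {0, 8} ∅ {3, 4, 5, 6, 7} s s' ∧
      DGInv O.value (s.vec 2) q h (h ^ 2 * (L * Metric.diam P ^ 2)) N (s'.vec 3) (s'.vec 4)) := by
  refine (Run.seq (Run.copyVec 3 1) (T' := coordTime n + (N * (dgTime n + 2) + 2)) ?_).mono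
    (by omega) fun _ h => h
  rintro _ rfl
  refine Run.seq (Run.copyVec 4 2) ?_
  rintro _ rfl
  refine (Run.forLoop (K := N) (T := dgTime n) (fun k s' =>
    SameExcept {0, 8} ∅ {3, 4, 5, 6, 7} s s' ∧
      DGInv O.value (s.vec 2) q h (h ^ 2 * (L * Metric.diam P ^ 2)) k (s'.vec 3) (s'.vec 4))
    ⟨?_, ?_⟩ ?_ ?_).mono le_rfl fun s' h => h.2
  · exact (((((SameExcept.refl _ _ _ s).setNat (by simp) _).setVec (by simp) _).setNat
      (by simp) _).setVec (by simp) _).setNat (by simp) _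
  · simpa [hv1] using DGInv.zero hq
  · rintro k hk s' ⟨hs', -⟩ -
    simp [hs'.1 1 (by simp), hs1]
  · rintro k hk s' ⟨hs', hi⟩ hc
    refine (Run.dgBody (fun i => rfl)).mono le_rfl ?_
    rintro s'' ⟨hs'', h3, h4⟩
    have hk1 : ((k : ℝ) + 1) * h ≤ 1 := by
      have : ((k : ℝ) + 1) ≤ N := by exact_mod_cast hk
      exact (mul_le_mul_of_nonneg_right this hh).trans hN.le
    have e2 : s'.vec 2 = s.vec 2 := hs'.2.2 2 (by simp)
    have er : s'.real 2 = h := by rw [hs'.2.1 2 (by simp), hs2]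
    refine ⟨by rw [hs''.1 8 (by simp), hc], (hs'.trans (hs''.mono (by simp) le_rfl
      le_rfl)).setNat (by simp) _, ?_⟩
    simp only [State.setNat_vec]
    rw [h3, h4, e2, er]
    exact hi.step I hz hh hk1 (fun i => rfl)

/-! ### The phase that avoids `z` -/

/-- One step of the greedy phase that avoids `z`. -/
def avoidBody : Prog :=
  .seq (.instr (.grad (.lit 5) (.lit 9)))
  (.seq (vecLoop (.lit 11)
    (.mul (.mul (.sub (.lit 1) (cv 2)) (.sub (.lit 1) (cv 8))) (cv 5)))
  (.seq (.instr (.lin (.lit 4) (.lit 12) (.lit 11) (.lit 1) (.lit 0)))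
  (.seq (vecLoop (.lit 8) (.add (cv 8) (.mul (rc 2) (.mul (.sub (.lit 1) (cv 8)) (cv 12)))))
  (.seq (vecLoop (.lit 9) (.mul (.sub (.lit 1) (cv 2)) (cv 8)))
    (.instr (.setReal (.lit 13) (.mul (.sub (.lit 1) (rc 2)) (rc 13))))))))

/-- The greedy phase that avoids the vector `z` in cell `2`; the answer is left in cell `9`. -/
def avoidProg : Prog :=
  .seq (copyVec 8 1) (.seq (copyVec 9 1) (.seq (.instr (.setReal (.lit 13) (.lit 1)))
    (forLoop 8 (nc 2) avoidBody)))

/-- Running time of one step of the first phase. -/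
def avoidTime (n : ℕ) : ℕ := 3 * coordTime n + 3

theorem Run.avoidProg {L : ℝ} {P : Set (Vec n)} {O : Oracle n} (I : IsInstance 1 L P O)
    {s : State n} {h : ℝ} (hh : h ∈ Set.Icc (0 : ℝ) 1) (hh0 : 0 < h) {m : ℕ}
    (hs1 : s.nat 2 = m) (hs2 : s.real 2 = h) (hv1 : s.vec 1 = 0) (hz : s.vec 2 ∈ P) {o : Vec n}
    (ho : o ∈ P) :
    Run O WeakDR.avoidProg s (2 * coordTime n + 1 + (m * (avoidTime n + 2) + 2)) (fun s' =>
      SameExcept {0, 4, 8} {13} {5, 8, 9, 11, 12} s s' ∧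
      AvoidInv O.value (s.vec 2) o h (L * Metric.diam P ^ 2) m (s'.vec 8) (s'.vec 9) ∧
      BelowWeight P (m * h) (s'.vec 9) ∧ s'.real 13 = (1 - h) ^ m) := by
  have hzc := I.subset_cube hz
  refine (Run.seq (Run.copyVec 8 1)
    (T' := coordTime n + (1 + (m * (avoidTime n + 2) + 2))) ?_).mono (by omega) fun _ h => h
  rintro _ rfl
  refine Run.seq (Run.copyVec 9 1) ?_
  rintro _ rfl
  refine Run.instr_seq ?_
  refine (Run.forLoop (K := m) (T := avoidTime n) (fun k s' =>
      SameExcept {0, 4, 8} {13} {5, 8, 9, 11, 12} s s' ∧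
      AvoidInv O.value (s.vec 2) o h (L * Metric.diam P ^ 2) k (s'.vec 8) (s'.vec 9) ∧
      BelowWeight P (k * h) (s'.vec 9) ∧ s'.real 13 = (1 - h) ^ k)
    ⟨?_, ?_, ?_, ?_⟩ ?_ ?_).mono le_rfl fun s' h => h.2
  · exact ((((((SameExcept.refl _ _ _ s).setNat (by simp) _).setVec (by simp) _).setNat
      (by simp) _).setVec (by simp) _).setReal (by simp) _).setNat (by simp) _
  · simpa [hv1] using AvoidInv.zero (I.nonneg 0 zero_mem_cube)
  · simpa [hv1] using BelowWeight.zero I 0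
  · simp
  · rintro k hk s' ⟨hs', -⟩ -
    simp [hs'.1 2 (by simp), hs1]
  · rintro k hk s' ⟨hs', hi, hbw, hpw⟩ hc
    have e2 : s'.vec 2 = s.vec 2 := hs'.2.2 2 (by simp)
    have e1 : s'.vec 1 = 0 := by rw [hs'.2.2 1 (by simp), hv1]
    have er : s'.real 2 = h := by rw [hs'.2.1 2 (by simp), hs2]
    set c : Vec n := had (had (compl (s.vec 2)) (compl (s'.vec 8))) (O.grad (s'.vec 9)) with hcdef
    obtain ⟨w, hlin, hw, hwmax⟩ := I.lin_zero c
    refine (Run.instr_seq (T := coordTime n + (1 + (coordTime n + (coordTime n + 1)))) ?_).mono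
      (by unfold avoidTime; omega) fun _ h => h
    refine Run.seq (Run.vecLoop 11 (fun i => c i) (by simp) (fun i x hx => by
      simp [hcdef, e2])) ?_
    rintro _ rfl
    refine Run.instr_seq ?_
    rw [Instr.step_lin_some (x := w) (h := by simpa [e1] using hlin)]
    set u' : Vec n := WithLp.toLp 2 fun i => s'.vec 8 i + h * ((1 - s'.vec 8 i) * w i) with hu'
    refine Run.seq (Run.vecLoop 8 (fun i => s'.vec 8 i + h * ((1 - s'.vec 8 i) * w i)) (by simp)
      (fun i x hx => by simp at hx; simp [er, hx])) ?_
    rintro _ rfl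
    refine Run.seq (Run.vecLoop 9 (fun i => (1 - s.vec 2 i) * u' i) (by simp)
      (fun i x hx => by simp [e2, hu'])) ?_
    rintro _ rfl
    refine Run.instr ?_
    refine ⟨by simp [hc], ?_, ?_, ?_, ?_⟩
    · refine SameExcept.setNat (SameExcept.setReal ?_ (by simp) _) (by simp) _
      exact (((((((((hs'.setVec (by simp) _).setNat (by simp) _).setVec (by simp) _).setNat
        (by simp) _).setVec (by simp) _).setNat (by simp) _).setVec (by simp) _).setNat
        (by simp) _).setVec (by simp) _)
    · simpa using hi.step I hh hzc ho hcdef hw hwmax hu' rfl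
    · have hwc := I.subset_cube hw
      have e9 : s'.vec 9 = had (compl (s.vec 2)) (s'.vec 8) := hi.2.1
      have := hbw.add I (by have := hh.1; positivity) hh0 hw
        (y' := WithLp.toLp 2 fun i => (1 - s.vec 2 i) * u' i) (fun i => by
          have h1 := step_mem_cube hh hi.1 hwc i
          exact mul_nonneg (by linarith [(hzc i).2]) h1.1) (fun i => by
          have h1 := hzc i
          have h2 := hi.1 i
          have h3 := hwc i
          have h4 : (1 - s.vec 2 i) * (1 - s'.vec 8 i) ≤ 1 :=
            mul_le_one₀ (by linarith) (by linarith) (by linarith)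
          have h5 : (1 - s.vec 2 i) * (1 - s'.vec 8 i) * (h * w i) ≤ h * w i :=
            mul_le_of_le_one_left (mul_nonneg hh.1 h3.1) h4
          rw [e9]
          simp only [hu', had_apply, compl_apply]
          linarith)
      have ek : (k : ℝ) * h + h = ((k + 1 : ℕ) : ℝ) * h := by push_cast; ring
      rw [ek] at this
      simpa using this
    · simp [er, hpw, pow_succ, mul_comm]

/-! ### The queue of local optima -/

/-- The global invariant of the aided algorithm: the parameters are in place, the best point and
its value are recorded, and the queue consists of points of `P`. -/
structure Glob (O : Oracle n) (P : Set (Vec n)) (N m : ℕ) (h S : ℝ) (s : State n) : Prop where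
  nat1 : s.nat 1 = N
  nat2 : s.nat 2 = m
  nat3 : s.nat 3 = N * N
  real2 : s.real 2 = h
  real3 : s.real 3 = S
  vec1 : s.vec 1 = 0
  best_mem : s.vec 0 ∈ P
  best_value : s.real 4 = O.value (s.vec 0)
  queue_mem : ∀ i < s.nat 6, s.vec (20 + i) ∈ P

/-- Progress from `s` to `s'`: the best value has not decreased, and the queue has only been
extended. -/
def Extends (O : Oracle n) (s s' : State n) : Prop :=
  O.value (s.vec 0) ≤ O.value (s'.vec 0) ∧ s.nat 6 ≤ s'.nat 6 ∧
    ∀ i < s.nat 6, s'.vec (20 + i) = s.vec (20 + i)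

theorem Extends.refl (O : Oracle n) (s : State n) : Extends O s s :=
  ⟨le_rfl, le_rfl, fun _ _ => rfl⟩

theorem Extends.trans {O : Oracle n} {s s' s'' : State n} (h : Extends O s s')
    (h' : Extends O s' s'') : Extends O s s'' :=
  ⟨h.1.trans h'.1, h.2.1.trans h'.2.1, fun i hi =>
    (h'.2.2 i (hi.trans_le h.2.1)).trans (h.2.2 i hi)⟩

/-- The algorithm has succeeded, in one of two senses: the best value has reached `τ`, or the queue
contains, at position `t₀` or later, a local optimum `z` for which `F (z ⊕ o)` is less than `b`. -/
def Success (O : Oracle n) (P : Set (Vec n)) (o : Vec n) (e τ b : ℝ) (t₀ : ℕ) (s : State n) :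
    Prop :=
  τ ≤ O.value (s.vec 0) ∨ ∃ i, t₀ ≤ i ∧ i < s.nat 6 ∧ LocalOpt O.value P o e (s.vec (20 + i)) ∧
    O.value (psum (s.vec (20 + i)) o) < b

theorem Success.mono {O : Oracle n} {P : Set (Vec n)} {o : Vec n} {e τ b b' : ℝ} {t₀ t₁ : ℕ}
    {s s' : State n} (hs : Success O P o e τ b t₀ s) (h : Extends O s s') (hb : b ≤ b')
    (ht : t₁ ≤ t₀) : Success O P o e τ b' t₁ s' := by
  rcases hs with hs | ⟨i, h1, h2, h3, h4⟩
  · exact Or.inl (hs.trans h.1)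
  · refine Or.inr ⟨i, ht.trans h1, h2.trans_le h.2.1, ?_⟩
    rw [h.2.2 i h2]
    exact ⟨h3, h4.trans_le hb⟩

section

variable {L : ℝ} {P : Set (Vec n)} {O : Oracle n} {N m : ℕ} {h S : ℝ} {s : State n}

theorem Glob.of_same (g : Glob O P N m h S s) {A B C : Set ℕ} {s' : State n}
    (hs : SameExcept A B C s s') (hA : 1 ∉ A ∧ 2 ∉ A ∧ 3 ∉ A ∧ 6 ∉ A)
    (hB : 2 ∉ B ∧ 3 ∉ B ∧ 4 ∉ B) (h0 : 0 ∉ C) (h1 : 1 ∉ C) (hC : ∀ k, 20 + k ∉ C) :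
    Glob O P N m h S s' ∧ Extends O s s' := by
  obtain ⟨a1, a2, a3, a4, a5, a6, a7, a8, a9⟩ := g
  have e6 := hs.1 6 hA.2.2.2
  have e0 := hs.2.2 0 h0
  refine ⟨⟨by rw [hs.1 1 hA.1, a1], by rw [hs.1 2 hA.2.1, a2], by rw [hs.1 3 hA.2.2.1, a3],
    by rw [hs.2.1 2 hB.1, a4], by rw [hs.2.1 3 hB.2.1, a5], by rw [hs.2.2 1 h1, a6],
    by rw [e0]; exact a7, by rw [hs.2.1 4 hB.2.2, e0, a8], fun i hi => ?_⟩,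
    ⟨by rw [e0], e6.ge, fun i _ => hs.2.2 _ (hC i)⟩⟩
  rw [hs.2.2 _ (hC i)]
  exact a9 i (by rwa [e6] at hi)

theorem Run.recordBest' (g : Glob O P N m h S s) {v : ℕ} (hv : s.vec v ∈ P) :
    Run O (WeakDR.recordBest v) s (coordTime n + 3) (fun s' =>
      SameExcept {0} {4, 16} {0} s s' ∧ (Glob O P N m h S s' ∧ Extends O s s') ∧
        O.value (s.vec v) ≤ O.value (s'.vec 0)) := by
  refine (Run.recordBest g.best_mem hv g.best_value).mono le_rfl ?_
  rintro s' ⟨hs, h1, h2, h3⟩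
  have e6 := hs.1 6 (by simp)
  have hC : ∀ i, s'.vec (20 + i) = s.vec (20 + i) := fun i => hs.2.2 _ (by simp)
  refine ⟨hs, ⟨⟨by rw [hs.1 1 (by simp), g.nat1], by rw [hs.1 2 (by simp), g.nat2],
    by rw [hs.1 3 (by simp), g.nat3], by rw [hs.2.1 2 (by simp), g.real2],
    by rw [hs.2.1 3 (by simp), g.real3], by rw [hs.2.2 1 (by simp), g.vec1], h1, h2,
    fun i hi => ?_⟩, (le_max_right _ _).trans h3, e6.ge, fun i _ => hC i⟩,
    (le_max_left _ _).trans h3⟩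
  rw [hC]
  exact g.queue_mem i (by rwa [e6] at hi)

/-- Appends the vector cell `v` to the queue. -/
def pushVec (v : ℕ) : Prog :=
  .seq (vecLoop (.add (.lit 20) (nc 6)) (cv v)) (.instr (.setNat (.lit 6) (.add (nc 6) (.lit 1))))

theorem Run.pushVec {v : ℕ} (hv : v < 20) :
    Run O (WeakDR.pushVec v) s (coordTime n + 1) (fun s' =>
      s' = ((s.setNat 0 n).setVec (20 + s.nat 6) (s.vec v)).setNat 6 (s.nat 6 + 1)) := by
  refine Run.seq (Run.vecLoop (20 + s.nat 6) (fun i => s.vec v i) (by simp) (fun i x hx => ?_)) ?_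
  · rw [cv_eval_setVec, if_neg (by omega)]
  · rintro _ rfl
    refine Run.instr ?_
    simp

theorem Glob.push (g : Glob O P N m h S s) {x : Vec n} (hx : x ∈ P) (k : ℕ) :
    Glob O P N m h S (((s.setNat 0 k).setVec (20 + s.nat 6) x).setNat 6 (s.nat 6 + 1)) ∧
      Extends O s (((s.setNat 0 k).setVec (20 + s.nat 6) x).setNat 6 (s.nat 6 + 1)) := by
  have hne : ∀ j, j < 20 → ¬ j = 20 + s.nat 6 := fun j hj => by omega
  refine ⟨⟨by simp [g.nat1], by simp [g.nat2], by simp [g.nat3], by simp [g.real2],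
    by simp [g.real3], by simp [hne 1, g.vec1], by simp [hne 0, g.best_mem],
    by simp [hne 0, g.best_value], fun i hi => ?_⟩, by simp [hne 0], by simp, fun i hi => ?_⟩
  · simp only [State.setNat_vec, State.setVec_vec, State.setNat_nat] at hi ⊢
    simp only [if_true] at hi
    split_ifs with h1
    · exact hx
    · exact g.queue_mem i (by omega)
  · simp only [State.setNat_vec, State.setVec_vec]
    rw [if_neg (by omega)]

/-! ### The phase that approaches the optimum -/

/-- The answer of the local search is appended to the queue, and the solution moves towards it. -/
def reachMove : Prog :=
  .seq lsProg
  (.seq (pushVec 14)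
  (.seq (vecLoop (.lit 10) (.add (cv 10) (.mul (rc 2) (.mul (.sub (.lit 1) (cv 10)) (cv 14)))))
  (.seq (.instr (.setReal (.lit 9) (.add (.mul (.sub (.lit 1) (rc 2)) (rc 9)) (rc 10))))
    (.instr (.setReal (.lit 10) (.mul (.sub (.lit 1) (rc 2)) (rc 10)))))))

/-- One step of the second phase, with the solution in cell `10`. The first call of the linear oracle
decides whether the constraint `V - F y ≤ ⟨(1 - y) ⊙ ∇F y, ·⟩` can be satisfied, and supplies the
starting point of the local search; if it cannot, the guesses are wrong and the step is skipped. -/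
def reachBody : Prog :=
  .seq (.instr (.grad (.lit 5) (.lit 10)))
  (.seq (vecLoop (.lit 11) (.mul (.sub (.lit 1) (cv 10)) (cv 5)))
  (.seq (.instr (.value (.lit 16) (.lit 10)))
  (.seq (.instr (.setReal (.lit 8) (.sub (rc 9) (rc 16))))
  (.seq (.instr (.lin (.lit 4) (.lit 12) (.lit 11) (.lit 11) (rc 8)))
    (.ite (.natLt (.lit 0) (nc 4)) reachMove skip)))))

/-- Running time of the local search. -/
def searchTime (n N : ℕ) : ℕ := coordTime n + (N * N * (lsTime n + 2) + 2)

/-- Running time of one step of the second phase. -/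
def reachTime (n N : ℕ) : ℕ := searchTime n N + 3 * coordTime n + 8

/-- One step of the second phase. If the guesses have been correct so far, then either the guarantee
on the solution is maintained, or a local optimum with a smaller value of `F (z ⊕ o)` has been
found. -/
theorem Run.reachBody (I : IsInstance 1 L P O) (hh : h ∈ Set.Icc (0 : ℝ) 1) (hh0 : 0 < h)
    (hN : N * h = 1) {o : Vec n} (ho : o ∈ P) (hmax : ∀ y ∈ P, O.value y ≤ O.value o)
    (g : Glob O P N m h S s) {c : ℝ} (hc : 0 ≤ c) (hc1 : c ≤ 1) (hb : BelowWeight P c (s.vec 10))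
    (τ : ℝ) :
    Run O WeakDR.reachBody s (reachTime n N) (fun s' =>
      SameExcept {0, 4, 6, 9} {5, 7, 8, 9, 10, 16} {1, 2, 9}ᶜ s s' ∧
      (Glob O P N m h S s' ∧ Extends O s s') ∧ s'.nat 6 ≤ s.nat 6 + 1 ∧
      BelowWeight P (c + h) (s'.vec 10) ∧
      ∀ (U Y f : ℝ) (k : ℕ), 0 ≤ Y →
        ReachInv O.value o h (L * Metric.diam P ^ 2) m U Y f k (s.vec 10) (s.real 9) (s.real 10) →
        Success O P o (h * (O.value o + L * Metric.diam P ^ 2)) τ Y (s.nat 6) s' ∨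
          ReachInv O.value o h (L * Metric.diam P ^ 2) m U Y f (k + 1) (s'.vec 10) (s'.real 9)
            (s'.real 10)) := by
  have H := I.isSmoothDR
  have hoc := I.subset_cube ho
  have hN0 : 0 < N := Nat.pos_of_ne_zero (by rintro rfl; simp at hN)
  have hyP := hb.mem I hc1
  have hyc := I.subset_cube hyP
  set y := s.vec 10 with hy
  set a : Vec n := had (compl y) (O.grad y) with ha
  set b : ℝ := s.real 9 - O.value y with hbdef
  refine (Run.instr_seq (T := coordTime n + (1 + (1 + (1 + (searchTime n N + (coordTime n + 1 +
    (coordTime n + (1 + 1))) + 1))))) ?_).mono (by unfold reachTime; omega) fun _ h => h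
  refine Run.seq (Run.vecLoop 11 (fun i => a i) (by simp) (fun i x hx => by
    simp [ha, hy])) ?_
  rintro _ rfl
  refine Run.instr_seq (Run.instr_seq ?_)
  simp only [Instr.step_grad, Instr.step_value, Instr.step_setReal, NatExp.eval_lit,
    RealExp.eval_sub, RealExp.eval_cell]
  set s1 : State n := ((((s.setVec 5 (O.grad (s.vec 10))).setNat 0 n).setVec 11
    (WithLp.toLp 2 fun i => a i)).setReal 16 (O.value ((((s.setVec 5 (O.grad
    (s.vec 10))).setNat 0 n).setVec 11 (WithLp.toLp 2 fun i => a i)).vec 10))) with hs1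
  have e9 : s1.real 9 = s.real 9 := by simp [hs1]
  have e16 : s1.real 16 = O.value y := by simp [hs1, hy]
  rw [e9, e16, ← hbdef]
  set s2 := s1.setReal 8 b with hs2
  have same2 : SameExcept {0} {8, 16} {5, 11} s s2 :=
    (((((SameExcept.refl _ _ _ s).setVec (by simp) _).setNat (by simp) _).setVec
      (by simp) _).setReal (by simp) _).setReal (by simp) _
  have e11 : s2.vec 11 = a := by simp [hs2, hs1]
  have e8 : s2.real 8 = b := by simp [hs2]
  -- with correct guesses the optimum is feasible for the local search
  have hfeas : ∀ (U Y f : ℝ) (k : ℕ), ReachInv O.value o h (L * Metric.diam P ^ 2) m U Y f k y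
      (s.real 9) (s.real 10) → b ≤ inner ℝ a o := fun U Y f k hi => hi.feasible H hh hoc
  rcases hlin : O.lin a a b with _ | w
  · have hnone := (I.metaSolver a a b).1 hlin o ho
    refine Run.instr_seq ?_
    rw [Instr.step_lin_none (h := by simpa [e11, e8] using hlin)]
    simp only [NatExp.eval_lit]
    refine (Run.ite (T := 1) (fun ht => absurd ht (by simp)) fun _ => Run.skip).mono
      (by omega) ?_
    rintro _ rfl
    have same3 : SameExcept {0, 4} {8, 16} {5, 11} s ((s2.setNat 4 0).setNat 0 0) :=
      ((same2.mono (by simp) le_rfl le_rfl).setNat (by simp) _).setNat (by simp) _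
    have g3 := g.of_same same3 (by simp) (by simp) (by simp) (by simp) (fun k => by
      simp; omega)
    refine ⟨same3.mono (by intro k; simp; tauto) (by intro k; simp; tauto)
      (by intro k; simp; omega), g3, by rw [same3.1 6 (by simp)]; omega, ?_, fun U Y f k _ hi =>
      absurd (hfeas U Y f k hi) (not_le.2 hnone)⟩
    rw [same3.2.2 10 (by simp)]
    exact hb.mono I (by linarith)
  · obtain ⟨hw, hwb, -⟩ := (I.metaSolver a a b).2 w hlin
    refine Run.instr_seq ?_
    rw [Instr.step_lin_some (x := w) (h := by simpa [e11, e8] using hlin)]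
    simp only [NatExp.eval_lit]
    refine Run.ite (fun _ => ?_) (fun ht => absurd ht (by simp))
    set s3 := (s2.setNat 4 1).setVec 12 w with hs3
    have same3 : SameExcept {0, 4} {8, 16} {5, 11, 12} s s3 :=
      ((same2.mono (by simp) le_rfl (by intro k; simp; tauto)).setNat (by simp) _).setVec
        (by simp) _
    have f11 : s3.vec 11 = a := by simp [hs3, e11]
    have f8 : s3.real 8 = b := by simp [hs3, e8]
    have g3 := (g.of_same same3 (by simp) (by simp) (by simp) (by simp) (fun k => by
      simp; omega)).1
    refine Run.seq (Run.lsProg I (fun x hx => I.nonneg x (I.subset_cube hx)) hh g3.real2 g3.nat3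
      (by simpa [hs3] using hw) (by rw [f8, f11]; simpa [hs3] using hwb)) ?_
    rintro s4 ⟨same4', hls⟩
    rw [f8, f11] at hls
    have same4 : SameExcept {0, 4, 9} {5, 7, 8, 16} {5, 11, 12, 13, 14, 15} s s4 :=
      (same3.mono (by intro k; simp; tauto) (by intro k; simp; tauto)
        (by intro k; simp; tauto)).trans (same4'.mono le_rfl (by intro k; simp; tauto)
        (by intro k; simp; tauto))
    obtain ⟨g4, x4⟩ := g.of_same same4 (by simp) (by simp) (by simp) (by simp) (fun k => by
      simp; omega)
    obtain ⟨hqP, hqb, -⟩ := hls.2.2 (Nat.mul_pos hN0 hN0)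
    set q := s4.vec 14 with hq
    have hqc := I.subset_cube hqP
    refine Run.seq (Run.pushVec (by norm_num)) ?_
    rintro _ rfl
    obtain ⟨g5, x5⟩ := g4.push hqP n
    have e6 : s4.nat 6 = s.nat 6 := same4.1 6 (by simp)
    rw [e6] at g5 x5 ⊢
    have hne : ∀ j, j < 20 → ¬ j = 20 + s.nat 6 := fun j hj => by omega
    set s5 := ((s4.setNat 0 n).setVec (20 + s.nat 6) (s4.vec 14)).setNat 6 (s.nat 6 + 1) with hs5
    have h10 : s5.vec 10 = y := by
      simp [hs5, hne 10, same4.2.2 10, hy]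
    have h14 : s5.vec 14 = q := by simp [hs5, hne 14, hq]
    have hr : s5.real = s4.real := rfl
    have h2 : s5.real 2 = h := g5.real2
    have h9 : s5.real 9 = s.real 9 := by rw [hr, same4.2.1 9 (by simp)]
    have h10' : s5.real 10 = s.real 10 := by rw [hr, same4.2.1 10 (by simp)]
    refine Run.seq (Run.vecLoop 10 (fun i => y i + h * ((1 - y i) * q i)) (by simp)
      (fun i x hx => by simp [hx, h10, h14, h2])) ?_
    rintro _ rfl
    refine Run.instr_seq (Run.instr ?_)
    simp only [Instr.step_setReal, NatExp.eval_lit, RealExp.eval_add, RealExp.eval_mul,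
      RealExp.eval_sub, RealExp.eval_lit, RealExp.eval_cell, State.setReal_real, State.setNat_real,
      State.setVec_real, h2, h9, h10', Rat.cast_one, Nat.reduceEqDiff,
      if_false]
    set y' : Vec n := WithLp.toLp 2 fun i => y i + h * ((1 - y i) * q i) with hy'
    set s6 : State n := (((s5.setNat 0 n).setVec 10 y').setReal 9 ((1 - h) * s.real 9 +
      s.real 10)).setReal 10 ((1 - h) * s.real 10) with hs6
    have same6' : SameExcept {0} {9, 10} {10} s5 s6 :=
      ((((SameExcept.refl _ _ _ s5).setNat (by simp) _).setVec (by simp) _).setReal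
        (by simp) _).setReal (by simp) _
    obtain ⟨g6, x6⟩ := g5.of_same same6' (by simp) (by simp) (by simp) (by simp) (fun k => by
      simp; omega)
    have same5 : SameExcept {0, 4, 6, 9} {5, 7, 8, 9, 10, 16} {1, 2, 9}ᶜ s s5 :=
      (((same4.mono (by intro k; simp; tauto) (by intro k; simp; tauto)
        (by intro k; simp; omega)).setNat (by simp) _).setVec (by
          simp only [Set.mem_compl_iff, Set.mem_insert_iff, Set.mem_singleton_iff]
          omega) _).setNat (by simp) _
    refine ⟨same5.trans (same6'.mono (by simp) (by intro k; simp; tauto) (by simp)),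
      ⟨g6, (x4.trans x5).trans x6⟩, by simp [hs6, hs5], ?_, fun U Y f k hY hi => ?_⟩
    · refine hb.add I hc hh0 hqP (y' := s6.vec 10) (fun i => ?_) (fun i => ?_)
      · simpa [hs6, hy'] using (step_mem_cube hh hyc hqc i).1
      · have e : s6.vec 10 i = y i + h * ((1 - y i) * q i) := by simp [hs6, hy']
        rw [e]
        have h1 := mul_le_mul_of_nonneg_left (mul_le_of_le_one_left (hqc i).1
          (by linarith [(hyc i).1] : 1 - y i ≤ 1)) hh.1
        linarith
    · rcases lt_or_ge (O.value (psum q o)) Y with hlt | hge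
      · left
        refine Or.inr ⟨s.nat 6, le_rfl, by simp [hs6, hs5], ?_⟩
        have e : s6.vec (20 + s.nat 6) = q := by
          simp [hs6, hs5, hq]
          omega
        rw [e]
        exact ⟨hls.localOpt I hN ho hmax (hfeas U Y f k hi), hlt⟩
      · right
        have := hi.step I hh hoc hY hqP hqb hge
        simpa [hs6] using this

end

section

variable {L : ℝ} {P : Set (Vec n)} {O : Oracle n} {N m : ℕ} {h S : ℝ} {s : State n}

theorem Glob.setNat (g : Glob O P N m h S s) (c k : ℕ) (hc : c ≠ 1 ∧ c ≠ 2 ∧ c ≠ 3 ∧ c ≠ 6) :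
    Glob O P N m h S (s.setNat c k) ∧ Extends O s (s.setNat c k) :=
  g.of_same (A := {c}) (B := ∅) (C := ∅) ((SameExcept.refl _ _ _ s).setNat (Set.mem_singleton c) k)
    ⟨fun h => hc.1 h.symm, fun h => hc.2.1 h.symm, fun h => hc.2.2.1 h.symm,
      fun h => hc.2.2.2 h.symm⟩ (by simp) (by simp) (by simp) (by simp)

theorem Glob.setReal (g : Glob O P N m h S s) (c : ℕ) (r : ℝ) (hc : c ≠ 2 ∧ c ≠ 3 ∧ c ≠ 4) :
    Glob O P N m h S (s.setReal c r) ∧ Extends O s (s.setReal c r) :=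
  g.of_same (A := ∅) (B := {c}) (C := ∅) ((SameExcept.refl _ _ _ s).setReal (Set.mem_singleton c) r)
    (by simp) ⟨fun h => hc.1 h.symm, fun h => hc.2.1 h.symm, fun h => hc.2.2 h.symm⟩
    (by simp) (by simp) (by simp)

/-- The value that `k` steps of the second phase guarantee for the guesses `U` and `Y`, when the
first phase had `m` steps and ended with value `f`. -/
def reachValue (h e : ℝ) (m k : ℕ) (U Y f : ℝ) : ℝ :=
  (1 - h) ^ k * f + k * h * (1 - h) ^ (k - 1) * U +
    h ^ 2 * (k * (k - 1) / 2) * (1 - h) ^ (k + m) * Y - k * (h ^ 2 * e)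

/-- The second phase, started in `y`, has been run for the guesses `U` and `Y`, and has either
found a local optimum with a smaller value of `F (z ⊕ o)` or a solution of the guaranteed value,
provided that the guess `U` is valid. -/
def GuessDone (O : Oracle n) (P : Set (Vec n)) (o : Vec n) (h e τ : ℝ) (m k t₀ : ℕ) (y : Vec n)
    (U Y : ℝ) (s : State n) : Prop :=
  0 ≤ Y → U ≤ O.value (psum y o) → Success O P o (h * (O.value o + e)) τ Y t₀ s ∨
    reachValue h e m k U Y (O.value y) ≤ O.value (s.vec 0)

theorem GuessDone.mono {o : Vec n} {e τ U Y : ℝ} {k t₀ t₁ : ℕ} {y : Vec n} {s' : State n}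
    (hs : GuessDone O P o h e τ m k t₀ y U Y s) (hx : Extends O s s') (ht : t₁ ≤ t₀) :
    GuessDone O P o h e τ m k t₁ y U Y s' := fun hY hU =>
  (hs hY hU).imp (fun h1 => h1.mono hx le_rfl ht) fun h1 => h1.trans hx.1

/-- The second phase, for the guesses in the real cells `11` and `12`. -/
def reachProg : Prog :=
  .seq (copyVec 10 9)
  (.seq (.instr (.setReal (.lit 9) (rc 11)))
  (.seq (.instr (.setReal (.lit 10) (.mul (rc 2) (.mul (rc 13) (rc 12)))))
  (.seq (forLoop 8 (.sub (nc 1) (nc 2)) reachBody) (recordBest 10))))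

/-- Running time of the second phase. -/
def reachProgTime (n N : ℕ) : ℕ := 2 * coordTime n + N * (reachTime n N + 2) + 7

theorem Run.reachProg (I : IsInstance 1 L P O) (hh : h ∈ Set.Icc (0 : ℝ) 1) (hh0 : 0 < h)
    (hN : N * h = 1) (hmN : m ≤ N) {o : Vec n} (ho : o ∈ P)
    (hmax : ∀ y ∈ P, O.value y ≤ O.value o) (g : Glob O P N m h S s) (h13 : s.real 13 = (1 - h) ^ m)
    (hb : BelowWeight P (m * h) (s.vec 9)) (hy : ∀ i, s.vec 9 i ≤ 1 - (1 - h) ^ m) (τ : ℝ) :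
    Run O WeakDR.reachProg s (reachProgTime n N) (fun s' =>
      SameExcept {0, 4, 6, 8, 9} {4, 5, 7, 8, 9, 10, 16} {1, 2, 9}ᶜ s s' ∧
      (Glob O P N m h S s' ∧ Extends O s s') ∧ s'.nat 6 ≤ s.nat 6 + N ∧
      GuessDone O P o h (L * Metric.diam P ^ 2) τ m (N - m) (s.nat 6) (s.vec 9) (s.real 11)
        (s.real 12) s') := by
  have hK : (N - m) * (reachTime n N + 2) ≤ N * (reachTime n N + 2) :=
    Nat.mul_le_mul_right _ (Nat.sub_le _ _)
  refine (Run.seq (Run.copyVec 10 9) (T' := 1 + (1 + ((N - m) * (reachTime n N + 2) + 2 +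
    (coordTime n + 3)))) ?_).mono (by unfold reachProgTime; omega) fun _ h => h
  rintro _ rfl
  refine Run.instr_seq (Run.instr_seq ?_)
  set s1 := (Instr.setReal (.lit 10) (.mul (rc 2) (.mul (rc 13) (rc 12)))).step O
    ((Instr.setReal (.lit 9) (rc 11)).step O ((s.setNat 0 n).setVec 10 (s.vec 9))) with hs1
  have same1 : SameExcept {0} {9, 10} {10} s s1 :=
    ((((SameExcept.refl _ _ _ s).setNat (by simp) _).setVec (by simp) _).setReal
      (by simp) _).setReal (by simp) _
  have v10 : s1.vec 10 = s.vec 9 := by simp [hs1]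
  have r9 : s1.real 9 = s.real 11 := by simp [hs1]
  have r10 : s1.real 10 = h * ((1 - h) ^ m * s.real 12) := by simp [hs1, g.real2, h13]
  have g1 := g.of_same same1 (by simp) (by simp) (by simp) (by simp) (fun k => by simp; omega)
  have n6 : s1.nat 6 = s.nat 6 := same1.1 6 (by simp)
  have same1' : SameExcept {0, 4, 6, 8, 9} {5, 7, 8, 9, 10, 16} {1, 2, 9}ᶜ s s1 :=
    same1.mono (by simp) (by intro k; simp; tauto) (by simp)
  clear_value s1
  refine Run.seq (Run.forLoop (K := N - m) (T := reachTime n N) (fun k s' =>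
    SameExcept {0, 4, 6, 8, 9} {5, 7, 8, 9, 10, 16} {1, 2, 9}ᶜ s s' ∧
    (Glob O P N m h S s' ∧ Extends O s s') ∧ s'.nat 6 ≤ s.nat 6 + k ∧
    BelowWeight P (((m + k : ℕ) : ℝ) * h) (s'.vec 10) ∧
    (0 ≤ s.real 12 → s.real 11 ≤ O.value (psum (s.vec 9) o) →
      Success O P o (h * (O.value o + L * Metric.diam P ^ 2)) τ (s.real 12) (s.nat 6) s' ∨
      ReachInv O.value o h (L * Metric.diam P ^ 2) m (s.real 11) (s.real 12) (O.value (s.vec 9)) k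
        (s'.vec 10) (s'.real 9) (s'.real 10)))
    ⟨same1'.setNat (by simp) _, ?_, ?_, ?_, ?_⟩ ?_ ?_) ?_
  · have := g1.1.setNat 8 0 (by simp)
    exact ⟨this.1, g1.2.trans this.2⟩
  · simp [n6]
  · simpa [v10] using hb
  · intro _ hU
    refine Or.inr ⟨by simp [r9], by simp [r10]; ring, fun i => ?_, by simpa [r9, v10] using hU,
      by simp [v10]⟩
    simp only [State.setNat_vec, v10, zero_add]
    exact ⟨hb.1 i, hy i⟩
  · rintro k hk s' ⟨-, hg, -⟩ -
    simp [hg.1.nat1, hg.1.nat2]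
  · rintro k hk s' ⟨hs, hg, ht, hbw, hor⟩ hc
    have hk1 : ((m + k : ℕ) : ℝ) ≤ N := by exact_mod_cast (by omega : m + k ≤ N)
    refine (Run.reachBody I hh hh0 hN ho hmax hg.1 (by have := hh.1; positivity)
      ((mul_le_mul_of_nonneg_right hk1 hh.1).trans hN.le) hbw τ).mono le_rfl ?_
    rintro s'' ⟨hs', hg', ht', hbw', hor'⟩
    have hx := hg'.1.setNat 8 (k + 1) (by simp)
    refine ⟨by rw [hs'.1 8 (by simp), hc], (hs.trans (hs'.mono (by intro k; simp; tauto) le_rfl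
      le_rfl)).setNat (by simp) _, ⟨hx.1, (hg.2.trans hg'.2).trans hx.2⟩, by simp; omega, ?_,
      fun hY hU => ?_⟩
    · have e : ((m + k : ℕ) : ℝ) * h + h = ((m + (k + 1) : ℕ) : ℝ) * h := by push_cast; ring
      rw [e] at hbw'
      simpa using hbw'
    · rcases hor hY hU with h1 | h1
      · exact Or.inl (h1.mono (hg'.2.trans hx.2) le_rfl le_rfl)
      · rcases hor' _ _ _ _ hY h1 with h2 | h2
        · exact Or.inl (h2.mono hx.2 le_rfl hg.2.2.1)
        · exact Or.inr (by simpa using h2)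
  · rintro s2 ⟨-, hs, hg, ht, hbw, hor⟩
    have hw : ((m + (N - m) : ℕ) : ℝ) * h ≤ 1 := by
      rw [Nat.add_sub_cancel' hmN, hN]
    refine (Run.recordBest' hg.1 (hbw.mem I hw)).mono le_rfl ?_
    rintro s3 ⟨hs', hg', hv⟩
    refine ⟨(hs.mono le_rfl (by intro k; simp; tauto) le_rfl).trans
      (hs'.mono (by simp) (by intro k; simp; tauto) (by simp)), ⟨hg'.1, hg.2.trans hg'.2⟩, ?_,
      fun hY hU => ?_⟩
    · rw [hs'.1 6 (by simp)]; omega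
    · rcases hor hY hU with h1 | h1
      · exact Or.inl (h1.mono hg'.2 le_rfl le_rfl)
      · exact Or.inr (h1.2.2.2.2.trans hv)

/-- One run of the second phase, after which the second guess is increased. -/
def guessBody : Prog :=
  .seq reachProg (.instr (.setReal (.lit 12) (.add (rc 12) (.mul (rc 2) (rc 3)))))

/-- All guesses for the second number; then the first guess is increased. -/
def guessRow : Prog :=
  .seq (.instr (.setReal (.lit 12) (.lit 0)))
  (.seq (forLoop 11 (.add (.add (nc 1) (nc 1)) (.lit 1)) guessBody)
    (.instr (.setReal (.lit 11) (.add (rc 11) (.mul (rc 2) (rc 3))))))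

/-- Runs the second phase for all pairs of guesses. -/
def guessProg : Prog :=
  .seq (.instr (.setReal (.lit 11) (.sub (.lit 0) (rc 3))))
    (forLoop 10 (.add (.add (nc 1) (nc 1)) (.lit 1)) guessRow)

/-- Running time for all guesses for the second number. -/
def guessRowTime (n N : ℕ) : ℕ := 1 + ((2 * N + 1) * (reachProgTime n N + 1 + 2) + 2 + 1)

/-- Running time for all pairs of guesses. -/
def guessTime (n N : ℕ) : ℕ := 1 + ((2 * N + 1) * (guessRowTime n N + 2) + 2)

theorem Run.guessRow (I : IsInstance 1 L P O) (hh : h ∈ Set.Icc (0 : ℝ) 1) (hh0 : 0 < h)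
    (hN : N * h = 1) (hmN : m ≤ N) {o : Vec n} (ho : o ∈ P)
    (hmax : ∀ y ∈ P, O.value y ≤ O.value o) (g : Glob O P N m h S s) (h13 : s.real 13 = (1 - h) ^ m)
    (hb : BelowWeight P (m * h) (s.vec 9)) (hy : ∀ i, s.vec 9 i ≤ 1 - (1 - h) ^ m) (τ : ℝ) :
    Run O WeakDR.guessRow s (guessRowTime n N) (fun s' =>
      SameExcept {0, 4, 6, 8, 9, 11} {4, 5, 7, 8, 9, 10, 11, 12, 16} {1, 2, 9}ᶜ s s' ∧
      (Glob O P N m h S s' ∧ Extends O s s') ∧ s'.nat 6 ≤ s.nat 6 + (2 * N + 1) * N ∧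
      s'.real 11 = s.real 11 + h * S ∧
      ∀ j < 2 * N + 1, GuessDone O P o h (L * Metric.diam P ^ 2) τ m (N - m) (s.nat 6) (s.vec 9)
        (s.real 11) (j * (h * S)) s') := by
  refine Run.instr_seq (Run.seq (Run.forLoop (K := 2 * N + 1) (T := reachProgTime n N + 1)
    (fun k s' =>
      SameExcept {0, 4, 6, 8, 9, 11} {4, 5, 7, 8, 9, 10, 12, 16} {1, 2, 9}ᶜ s s' ∧
      (Glob O P N m h S s' ∧ Extends O s s') ∧ s'.nat 6 ≤ s.nat 6 + k * N ∧
      s'.real 12 = k * (h * S) ∧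
      ∀ j < k, GuessDone O P o h (L * Metric.diam P ^ 2) τ m (N - m) (s.nat 6) (s.vec 9)
        (s.real 11) (j * (h * S)) s') ?_ ?_ ?_) ?_)
  · have h1 := g.setReal 12 0 (by simp)
    have h2 := h1.1.setNat 11 0 (by simp)
    simp only [Instr.step_setReal, NatExp.eval_lit, RealExp.eval_lit, Rat.cast_zero]
    exact ⟨((SameExcept.refl _ _ _ s).setReal (by simp) _).setNat (by simp) _,
      ⟨h2.1, h1.2.trans h2.2⟩, by simp, by simp, fun j hj => absurd hj (by simp)⟩
  · rintro k hk s' ⟨-, hg, -⟩ -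
    simp only [NatExp.eval_add, NatExp.eval_cell, NatExp.eval_lit, hg.1.nat1]
    omega
  · rintro k hk s' ⟨hs, hg, ht, h12, hj⟩ hc
    have e9 : s'.vec 9 = s.vec 9 := hs.2.2 9 (by simp)
    have e11 : s'.real 11 = s.real 11 := hs.2.1 11 (by simp)
    refine Run.seq (Run.reachProg I hh hh0 hN hmN ho hmax hg.1
      (by rw [hs.2.1 13 (by simp), h13]) (by rwa [e9]) (by rwa [e9]) τ) ?_
    rintro s'' ⟨hs', hg', ht', hdone⟩
    refine Run.instr ?_
    simp only [Instr.step_setReal, NatExp.eval_lit, RealExp.eval_add, RealExp.eval_mul,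
      RealExp.eval_cell, hg'.1.real2, hg'.1.real3]
    have x1 := hg'.1.setReal 12 (s''.real 12 + h * S) (by simp)
    have x2 := x1.1.setNat 11 (k + 1) (by simp)
    have x3 := x1.2.trans x2.2
    have e12 : s''.real 12 = k * (h * S) := by rw [hs'.2.1 12 (by simp), h12]
    refine ⟨by simp [hs'.1 11, hc], ((hs.trans (hs'.mono (by intro k; simp; tauto)
      (by intro k; simp; tauto) le_rfl)).setReal (by simp) _).setNat (by simp) _,
      ⟨x2.1, (hg.2.trans hg'.2).trans x3⟩, ?_, ?_, fun j hjk => ?_⟩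
    · simp only [State.setNat_nat, State.setReal_nat]
      norm_num only
      rw [if_false, add_mul]
      omega
    · simp [e12]; ring
    · rcases Nat.lt_succ_iff_lt_or_eq.1 hjk with h1 | rfl
      · exact (hj j h1).mono (hg'.2.trans x3) le_rfl
      · rw [e9, e11, h12] at hdone
        exact hdone.mono x3 hg.2.2.1
  · rintro s' ⟨-, hs, hg, ht, -, hj⟩
    refine Run.instr ?_
    simp only [Instr.step_setReal, NatExp.eval_lit, RealExp.eval_add, RealExp.eval_mul,
      RealExp.eval_cell, hg.1.real2, hg.1.real3]
    have x1 := hg.1.setReal 11 (s'.real 11 + h * S) (by simp)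
    exact ⟨(hs.mono le_rfl (by intro k; simp; tauto) le_rfl).setReal (by simp) _,
      ⟨x1.1, hg.2.trans x1.2⟩, ht, by simp [hs.2.1 11], fun j hjk => (hj j hjk).mono x1.2 le_rfl⟩

theorem Run.guessProg (I : IsInstance 1 L P O) (hh : h ∈ Set.Icc (0 : ℝ) 1) (hh0 : 0 < h)
    (hN : N * h = 1) (hmN : m ≤ N) {o : Vec n} (ho : o ∈ P)
    (hmax : ∀ y ∈ P, O.value y ≤ O.value o) (g : Glob O P N m h S s) (h13 : s.real 13 = (1 - h) ^ m)
    (hb : BelowWeight P (m * h) (s.vec 9)) (hy : ∀ i, s.vec 9 i ≤ 1 - (1 - h) ^ m) (τ : ℝ) :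
    Run O WeakDR.guessProg s (guessTime n N) (fun s' =>
      SameExcept {0, 4, 6, 8, 9, 10, 11} {4, 5, 7, 8, 9, 10, 11, 12, 16} {1, 2, 9}ᶜ s s' ∧
      (Glob O P N m h S s' ∧ Extends O s s') ∧
      s'.nat 6 ≤ s.nat 6 + (2 * N + 1) * ((2 * N + 1) * N) ∧
      ∀ i < 2 * N + 1, ∀ j < 2 * N + 1, GuessDone O P o h (L * Metric.diam P ^ 2) τ m (N - m)
        (s.nat 6) (s.vec 9) (-S + i * (h * S)) (j * (h * S)) s') := by
  refine Run.instr_seq ((Run.forLoop (K := 2 * N + 1) (T := guessRowTime n N)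
    (fun k s' =>
      SameExcept {0, 4, 6, 8, 9, 10, 11} {4, 5, 7, 8, 9, 10, 11, 12, 16} {1, 2, 9}ᶜ s s' ∧
      (Glob O P N m h S s' ∧ Extends O s s') ∧ s'.nat 6 ≤ s.nat 6 + k * ((2 * N + 1) * N) ∧
      s'.real 11 = -S + k * (h * S) ∧
      ∀ i < k, ∀ j < 2 * N + 1, GuessDone O P o h (L * Metric.diam P ^ 2) τ m (N - m) (s.nat 6)
        (s.vec 9) (-S + i * (h * S)) (j * (h * S)) s') ?_ ?_ ?_).mono le_rfl ?_)
  · have h1 := g.setReal 11 (-S) (by simp)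
    have h2 := h1.1.setNat 10 0 (by simp)
    simp only [Instr.step_setReal, NatExp.eval_lit, RealExp.eval_lit, Rat.cast_zero,
      RealExp.eval_sub, RealExp.eval_cell, g.real3, zero_sub]
    exact ⟨((SameExcept.refl _ _ _ s).setReal (by simp) _).setNat (by simp) _,
      ⟨h2.1, h1.2.trans h2.2⟩, by simp, by simp, fun j hj => absurd hj (by simp)⟩
  · rintro k hk s' ⟨-, hg, -⟩ -
    simp only [NatExp.eval_add, NatExp.eval_cell, NatExp.eval_lit, hg.1.nat1]
    omega
  · rintro k hk s' ⟨hs, hg, ht, h11, hj⟩ hc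
    have e9 : s'.vec 9 = s.vec 9 := hs.2.2 9 (by simp)
    refine (Run.guessRow I hh hh0 hN hmN ho hmax hg.1
      (by rw [hs.2.1 13 (by simp), h13]) (by rwa [e9]) (by rwa [e9]) τ).mono le_rfl ?_
    rintro s'' ⟨hs', hg', ht', h11', hdone⟩
    have x := hg'.1.setNat 10 (k + 1) (by simp)
    refine ⟨by rw [hs'.1 10 (by simp), hc], (hs.trans (hs'.mono (by intro k; simp; tauto)
      le_rfl le_rfl)).setNat (by simp) _, ⟨x.1, (hg.2.trans hg'.2).trans x.2⟩, ?_, ?_,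
      fun i hik j hj2 => ?_⟩
    · simp only [State.setNat_nat]
      norm_num only
      rw [if_false, add_mul k 1]
      omega
    · simp [h11', h11]; ring
    · rcases Nat.lt_succ_iff_lt_or_eq.1 hik with h1 | rfl
      · exact (hj i h1 j hj2).mono (hg'.2.trans x.2) le_rfl
      · have := hdone j hj2
        rw [e9, h11] at this
        exact this.mono x.2 hg.2.2.1
  · rintro s' ⟨-, hs, hg, ht, -, hj⟩
    exact ⟨hs, hg, ht, hj⟩

end

/-! ### Processing one local optimum -/

/-- The numbers of steps `N` and `m` and the step length `h` are tuned to the feasible triple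
`(α, r, t)` with accuracy `ε`. -/
structure Tuned (N m : ℕ) (h α r t ε : ℝ) : Prop where
  mul_eq : (N : ℝ) * h = 1
  le : m ≤ N
  eps : 0 ≤ ε
  alpha : α ∈ Set.Icc (0 : ℝ) 1
  r_nonneg : 0 ≤ r
  coefB : 0 ≤ (1 - α) * coefB 1 t + α * coefD 1 r
  coefC : 0 ≤ (1 - α) * coefC 1 t + α * coefE 1 r
  discA : |discA N m h - coefA 1 t| ≤ ε
  discB : |discB N m h - WeakDR.coefB 1 t| ≤ ε
  discC : |discC N m h - WeakDR.coefC 1 t| ≤ ε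

/-- The value that the algorithm reaches when the optimal value is `v`, up to errors. -/
def target (h α t ε v e : ℝ) : ℝ := (1 - α) * coefA 1 t * v - 5 * ε * v - 3 * (h * (v + e))

theorem Tuned.pos {N m : ℕ} {h α r t ε : ℝ} (T : Tuned N m h α r t ε) : 0 < N :=
  Nat.pos_of_ne_zero (by rintro rfl; simpa using T.mul_eq)

theorem Tuned.step_pos {N m : ℕ} {h α r t ε : ℝ} (T : Tuned N m h α r t ε) : 0 < h := by
  have h1 : (0 : ℝ) < N := Nat.cast_pos.2 T.pos
  have h2 := T.mul_eq
  by_contra hn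
  nlinarith

theorem Tuned.step_mem {N m : ℕ} {h α r t ε : ℝ} (T : Tuned N m h α r t ε) :
    h ∈ Set.Icc (0 : ℝ) 1 := by
  have h1 : (1 : ℝ) ≤ N := by exact_mod_cast T.pos
  have h2 := T.mul_eq
  have h3 := T.step_pos
  exact ⟨h3.le, by nlinarith⟩

/-- Every number between `0` and `2 S` is close to a multiple of `h S`. -/
theorem exists_guess {N : ℕ} {h S x : ℝ} (hN : (N : ℝ) * h = 1) (hh : 0 < h) (hS : 0 < S)
    (h0 : 0 ≤ x) (h1 : x ≤ 2 * S) : ∃ j < 2 * N + 1, j * (h * S) ≤ x ∧ x - h * S ≤ j * (h * S) := by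
  have hp : 0 < h * S := mul_pos hh hS
  have hx : x / (h * S) ≤ ((2 * N : ℕ) : ℝ) := by
    rw [div_le_iff₀ hp]
    push_cast
    have : 2 * (N : ℝ) * (h * S) = 2 * S := by linear_combination 2 * S * hN
    linarith
  refine ⟨⌊x / (h * S)⌋₊, Nat.lt_succ_of_le (Nat.floor_le_of_le hx), ?_, ?_⟩
  · rw [← le_div_iff₀ hp]
    exact Nat.floor_le (by positivity)
  · have := (Nat.lt_floor_add_one (x / (h * S))).le
    rw [div_le_iff₀ hp] at this
    linarith

section

variable {L : ℝ} {P : Set (Vec n)} {O : Oracle n} {N m : ℕ} {h S α r t ε : ℝ} {s : State n}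

/-- If double greedy and all guesses have been tried for a local optimum `z`, then either the target
has been reached, or a local optimum with a smaller value of `F (z ⊕ o)` has been found: for the
right guesses, the two candidates cannot both be bad. -/
theorem success_of_guesses (I : IsInstance 1 L P O) (T : Tuned N m h α r t ε) {o : Vec n}
    (ho : o ∈ P) (hmax : ∀ y ∈ P, O.value y ≤ O.value o) (hS : O.value o ≤ S)
    (hS' : S ≤ O.value o + L * Metric.diam P ^ 2) {z x x' u y : Vec n} {t₀ : ℕ}
    (hz : LocalOpt O.value P o (h * (O.value o + L * Metric.diam P ^ 2)) z)
    (hdg : DGInv O.value z (had z o) h (h ^ 2 * (L * Metric.diam P ^ 2)) N x x')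
    (hx : O.value x ≤ O.value (s.vec 0))
    (hav : AvoidInv O.value z o h (L * Metric.diam P ^ 2) m u y)
    (hg : ∀ i < 2 * N + 1, ∀ j < 2 * N + 1, GuessDone O P o h (L * Metric.diam P ^ 2)
      (target h α t ε (O.value o) (L * Metric.diam P ^ 2)) m (N - m) t₀ y
      (-S + i * (h * S)) (j * (h * S)) s) :
    Success O P o (h * (O.value o + L * Metric.diam P ^ 2))
      (target h α t ε (O.value o) (L * Metric.diam P ^ 2))
      (max 0 (O.value (psum z o) - ε * O.value o)) t₀ s := by
  have H := I.isSmoothDR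
  have hoc := I.subset_cube ho
  have hzc := I.subset_cube hz.1
  have he := I.smoothness_nonneg
  have hxc := (hdg.mem_cube hzc).1
  have hh := T.step_mem
  have hv : 0 ≤ O.value o := I.nonneg _ hoc
  have hp0 : 0 ≤ O.value (had z o) := I.nonneg _ (had_mem_cube hzc hoc)
  have hp1 : O.value (had z o) ≤ O.value o := hmax _ (I.downClosed o ho _ fun i =>
    ⟨(had_mem_cube hzc hoc i).1, by simpa using mul_le_of_le_one_left (hoc i).1 (hzc i).2⟩)
  have hq0 : 0 ≤ O.value (psum z o) := I.nonneg _ (psum_mem_cube hzc hoc)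
  have hq1 : O.value (psum z o) ≤ 2 * O.value o := by
    have h1 := H.psum_add_had_le hzc hoc
    linarith [hmax z hz.1]
  rcases hv.eq_or_lt with h0 | hvpos
  · left
    have hx0 := I.nonneg _ hxc
    have : 0 ≤ h * (L * Metric.diam P ^ 2) := mul_nonneg hh.1 he
    refine le_trans ?_ hx
    unfold target
    rw [← h0]
    linarith
  have hSpos : 0 < S := hvpos.trans_le hS
  have hpw := one_sub_pow_mem hh m
  obtain ⟨i, hi, hi1, hi2⟩ := exists_guess T.mul_eq T.step_pos hSpos
    (x := O.value o - (1 - (1 - h) ^ m) * O.value (psum z o) + S)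
    (by have := mul_le_of_le_one_left hq0 hpw.2; linarith)
    (by have := mul_nonneg hpw.1 hq0; linarith)
  obtain ⟨j, hj, hj1, hj2⟩ := exists_guess T.mul_eq T.step_pos hSpos
    (x := max 0 (O.value (psum z o) - ε * O.value o)) (le_max_left _ _)
    (max_le (by linarith) (by have := mul_nonneg T.eps hv; linarith))
  have hY0 : 0 ≤ (j : ℝ) * (h * S) := by have := T.step_pos; positivity
  rcases hg i hi j hj hY0 ((by linarith : _ ≤ _).trans (hav.psum_ge H hh hzc hoc)) with h1 | h1
  · exact h1.mono (Extends.refl _ _) hj1 le_rfl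
  · left
    have hd := hdg.final T.mul_eq T.r_nonneg
    have hF0 := I.nonneg 0 zero_mem_cube
    refine (candidate_bound T.mul_eq T.le ⟨hp0, hp1⟩ ⟨hq0, hq1⟩ he hS' (U := -S + i * (h * S))
      (Y := j * (h * S)) (by linarith) ?_ T.eps hav.2.2.2 h1 hz.2
      (by linarith : _ ≤ (1 + r) ^ 2 * O.value x) T.alpha T.r_nonneg T.coefB T.coefC T.discA
      T.discB T.discC).trans (max_le hx le_rfl)
    have := le_max_right 0 (O.value (psum z o) - ε * O.value o)
    linarith

/-- Copies the queue element at the head to the vector cell `2`. -/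
def popVec : Prog := vecLoop (.lit 2) (.coord (.add (.lit 20) (nc 5)) (nc 0))

theorem Run.popVec : Run O WeakDR.popVec s (coordTime n)
    (fun s' => s' = (s.setNat 0 n).setVec 2 (s.vec (20 + s.nat 5))) :=
  Run.vecLoop 2 (fun i => s.vec (20 + s.nat 5) i) (by simp) (fun i x hx => by
    rw [RealExp.eval_coord _ _ _ i (by simp)]
    simp only [NatExp.eval_add, NatExp.eval_lit, NatExp.eval_cell, State.setVec_vec,
      State.setVec_nat, State.setNat_vec, State.setNat_nat]
    norm_num only
    rw [if_false, if_neg (by omega)])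

/-- Double greedy and the aided greedy for the local optimum at the head of the queue. -/
def processProg : Prog :=
  .seq popVec (.seq dgProg (.seq (recordBest 3) (.seq avoidProg guessProg)))

/-- Running time for one local optimum. -/
def processTime (n N : ℕ) : ℕ :=
  6 * coordTime n + N * (dgTime n + 2) + N * (avoidTime n + 2) + 8 + guessTime n N

/-- Number of points that are appended to the queue for one local optimum. -/
def fanout (N : ℕ) : ℕ := (2 * N + 1) * ((2 * N + 1) * N)

theorem Run.processProg (I : IsInstance 1 L P O) (T : Tuned N m h α r t ε) {o : Vec n}
    (ho : o ∈ P) (hmax : ∀ y ∈ P, O.value y ≤ O.value o) (hS : O.value o ≤ S)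
    (hS' : S ≤ O.value o + L * Metric.diam P ^ 2) (g : Glob O P N m h S s)
    (hq : s.nat 5 < s.nat 6) :
    Run O WeakDR.processProg s (processTime n N) (fun s' =>
      (s'.nat 5 = s.nat 5 ∧ s'.nat 7 = s.nat 7 ∧ s'.nat 12 = s.nat 12) ∧
      (Glob O P N m h S s' ∧ Extends O s s') ∧ s'.nat 6 ≤ s.nat 6 + fanout N ∧
      (LocalOpt O.value P o (h * (O.value o + L * Metric.diam P ^ 2)) (s.vec (20 + s.nat 5)) →
        Success O P o (h * (O.value o + L * Metric.diam P ^ 2))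
          (target h α t ε (O.value o) (L * Metric.diam P ^ 2))
          (max 0 (O.value (psum (s.vec (20 + s.nat 5)) o) - ε * O.value o)) (s.nat 6) s')) := by
  have hh := T.step_mem
  set z := s.vec (20 + s.nat 5) with hzdef
  have hz : z ∈ P := g.queue_mem _ hq
  have hzc := I.subset_cube hz
  have hoc := I.subset_cube ho
  have hm : m * (avoidTime n + 2) ≤ N * (avoidTime n + 2) := Nat.mul_le_mul_right _ T.le
  refine (Run.seq (T' := 2 * coordTime n + (N * (dgTime n + 2) + 2) + (coordTime n + 3 +
    (2 * coordTime n + 1 + (m * (avoidTime n + 2) + 2) + guessTime n N))) Run.popVec ?_).mono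
    (by unfold processTime; omega) fun _ h => h
  rintro _ rfl
  set s1 := (s.setNat 0 n).setVec 2 (s.vec (20 + s.nat 5)) with hs1
  have same1 : SameExcept {0} ∅ {2} s s1 :=
    ((SameExcept.refl _ _ _ s).setNat (by simp) _).setVec (by simp) _
  have z1 : s1.vec 2 = z := by simp [hs1, hzdef]
  obtain ⟨g1, x1⟩ := g.of_same same1 (by simp) (by simp) (by simp) (by simp) (fun k => by
    simp; omega)
  clear_value s1
  refine Run.seq (Run.dgProg I (q := had z o) hh.1 T.mul_eq g1.nat1 g1.real2 g1.vec1 (by rwa [z1])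
    (fun i => ⟨(had_mem_cube hzc hoc i).1, by
      rw [z1]; simpa using mul_le_of_le_one_right (hzc i).1 (hoc i).2⟩)) ?_
  rintro s2 ⟨same2, hdg⟩
  rw [z1] at hdg
  obtain ⟨g2, x2⟩ := g1.of_same same2 (by simp) (by simp) (by simp) (by simp) (fun k => by
    simp; omega)
  refine Run.seq (Run.recordBest' g2 (hdg.lower_mem I hz)) ?_
  rintro s3 ⟨same3, ⟨g3, x3⟩, hbest⟩
  have z3 : s3.vec 2 = z := by
    rw [same3.2.2 2 (by simp), same2.2.2 2 (by simp), z1]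
  refine Run.seq (Run.avoidProg I hh T.step_pos g3.nat2 g3.real2 g3.vec1 (by rwa [z3]) ho) ?_
  rintro s4 ⟨same4, hav, hbw, h13⟩
  rw [z3] at hav
  obtain ⟨g4, x4⟩ := g3.of_same same4 (by simp) (by simp) (by simp) (by simp) (fun k => by
    simp; omega)
  refine (Run.guessProg I hh T.step_pos T.mul_eq T.le ho hmax g4 h13 hbw (hav.le hzc)
    (target h α t ε (O.value o) (L * Metric.diam P ^ 2))).mono le_rfl ?_
  rintro s5 ⟨same5, ⟨g5, x5⟩, ht, hdone⟩
  have e6 : s4.nat 6 = s.nat 6 := by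
    rw [same4.1 6 (by simp), same3.1 6 (by simp), same2.1 6 (by simp), same1.1 6 (by simp)]
  have hnat : ∀ k, k ∉ ({0, 4, 6, 8, 9, 10, 11} : Set ℕ) → s5.nat k = s.nat k := fun k hk => by
    simp only [Set.mem_insert_iff, Set.mem_singleton_iff, not_or] at hk
    rw [same5.1 k (by simp [hk]), same4.1 k (by simp [hk]), same3.1 k (by simp [hk]),
      same2.1 k (by simp [hk]), same1.1 k (by simp [hk])]
  rw [e6] at ht hdone
  exact ⟨⟨hnat 5 (by simp), hnat 7 (by simp), hnat 12 (by simp)⟩,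
    ⟨g5, (((x1.trans x2).trans x3).trans x4).trans x5⟩, ht, fun hloc =>
    success_of_guesses I T ho hmax hS hS' hloc hdg (hbest.trans (x4.trans x5).1) hav hdone⟩

/-! ### Levels of the queue -/

/-- Processes all local optima that are in the queue at the beginning. -/
def levelProg : Prog :=
  .seq (.instr (.setNat (.lit 7) (nc 6)))
    (.while (.natLt (nc 5) (nc 7))
      (.seq processProg (.instr (.setNat (.lit 5) (.add (nc 5) (.lit 1))))))

/-- The queue contains, at position `s.nat 5` or later, a local optimum `z` for which `F (z ⊕ o)` is
at most `b`, or the target has been reached. -/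
def LevelInv (O : Oracle n) (P : Set (Vec n)) (o : Vec n) (e τ b : ℝ) (s : State n) : Prop :=
  τ ≤ O.value (s.vec 0) ∨ ∃ i, s.nat 5 ≤ i ∧ i < s.nat 6 ∧ LocalOpt O.value P o e (s.vec (20 + i)) ∧
    O.value (psum (s.vec (20 + i)) o) ≤ b

theorem Run.levelProg (I : IsInstance 1 L P O) (T : Tuned N m h α r t ε) {o : Vec n}
    (ho : o ∈ P) (hmax : ∀ y ∈ P, O.value y ≤ O.value o) (hS : O.value o ≤ S)
    (hS' : S ≤ O.value o + L * Metric.diam P ^ 2) (g : Glob O P N m h S s)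
    (hq : s.nat 5 ≤ s.nat 6) {b : ℝ} {R : ℕ} (hR : s.nat 6 ≤ R)
    (hinv : LevelInv O P o (h * (O.value o + L * Metric.diam P ^ 2))
      (target h α t ε (O.value o) (L * Metric.diam P ^ 2)) b s) :
    Run O WeakDR.levelProg s (1 + (R * (processTime n N + 1 + 1) + 1)) (fun s' =>
      s'.nat 12 = s.nat 12 ∧ (Glob O P N m h S s' ∧ Extends O s s') ∧ s'.nat 5 ≤ s'.nat 6 ∧
      s'.nat 6 ≤ R * (1 + fanout N) ∧
      LevelInv O P o (h * (O.value o + L * Metric.diam P ^ 2))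
        (target h α t ε (O.value o) (L * Metric.diam P ^ 2)) (b - ε * O.value o) s') := by
  have hoc := I.subset_cube ho
  refine Run.instr_seq ((Run.loop (K := s.nat 6 - s.nat 5) (T := processTime n N + 1) (fun k s' =>
    (s'.nat 5 = s.nat 5 + k ∧ s'.nat 7 = s.nat 6 ∧ s'.nat 12 = s.nat 12) ∧
    (Glob O P N m h S s' ∧ Extends O s s') ∧ s'.nat 6 ≤ s.nat 6 + k * fanout N ∧
    ∀ j < k, LocalOpt O.value P o (h * (O.value o + L * Metric.diam P ^ 2))
        (s.vec (20 + (s.nat 5 + j))) →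
      Success O P o (h * (O.value o + L * Metric.diam P ^ 2))
        (target h α t ε (O.value o) (L * Metric.diam P ^ 2))
        (max 0 (O.value (psum (s.vec (20 + (s.nat 5 + j))) o) - ε * O.value o)) (s.nat 6) s')
    ?_ ?_ ?_ ?_).mono ?_ ?_)
  · have x := g.setNat 7 (s.nat 6) (by simp)
    simp only [Instr.step_setNat, NatExp.eval_lit, NatExp.eval_cell]
    exact ⟨by simp, x, by simp, fun j hj => absurd hj (by simp)⟩
  · rintro s' ⟨⟨h5, h7, -⟩, -⟩
    simp only [Test.holds_natLt, NatExp.eval_cell, NatExp.eval_lit, h5, h7]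
    omega
  · rintro k hk s' ⟨⟨h5, h7, -⟩, -⟩
    simp only [Test.holds_natLt, NatExp.eval_cell, NatExp.eval_lit, h5, h7]
    omega
  · rintro k hk s' ⟨⟨h5, h7, h12⟩, hg, ht, hj⟩
    have hlt : s.nat 5 + k < s.nat 6 := by omega
    refine Run.seq (Run.processProg I T ho hmax hS hS' hg.1 (by
      rw [h5]; exact hlt.trans_le hg.2.2.1)) ?_
    rintro s'' ⟨⟨h5', h7', h12'⟩, hg', ht', hsucc⟩
    refine Run.instr ?_
    simp only [Instr.step_setNat, NatExp.eval_lit, NatExp.eval_cell, NatExp.eval_add]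
    have x := hg'.1.setNat 5 (s''.nat 5 + 1) (by simp)
    refine ⟨⟨by simp [h5', h5]; omega, by simp [h7', h7], by simp [h12', h12]⟩,
      ⟨x.1, (hg.2.trans hg'.2).trans x.2⟩, ?_, fun j hjk hloc => ?_⟩
    · simp only [State.setNat_nat]
      norm_num only
      rw [if_false, add_mul k 1]
      omega
    · rcases Nat.lt_succ_iff_lt_or_eq.1 hjk with h1 | rfl
      · exact (hj j h1 hloc).mono (hg'.2.trans x.2) le_rfl le_rfl
      · rw [h5, hg.2.2.2 _ hlt] at hsucc
        exact (hsucc hloc).mono x.2 le_rfl hg.2.2.1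
  · have : (s.nat 6 - s.nat 5) * (processTime n N + 1 + 1) ≤ R * (processTime n N + 1 + 1) :=
      Nat.mul_le_mul_right _ (by omega)
    omega
  · rintro s' ⟨⟨h5, h7, h12⟩, hg, ht, hj⟩
    have h56 : s'.nat 5 = s.nat 6 := by omega
    refine ⟨h12, hg, by rw [h56]; exact hg.2.2.1, ?_, ?_⟩
    · have : (s.nat 6 - s.nat 5) * fanout N ≤ R * fanout N := Nat.mul_le_mul_right _ (by omega)
      rw [mul_add, mul_one]
      omega
    · rcases hinv with h1 | ⟨i, hi1, hi2, hloc, hb⟩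
      · exact Or.inl (h1.trans hg.2.1)
      · obtain ⟨j, rfl⟩ := Nat.exists_eq_add_of_le hi1
        rcases hj j (by omega) hloc with h1 | ⟨i, h1, h2, h3, h4⟩
        · exact Or.inl h1
        · refine Or.inr ⟨i, by omega, h2, h3, ?_⟩
          have hnn := I.nonneg _ (psum_mem_cube (I.subset_cube h3.1) hoc)
          rcases lt_max_iff.1 h4 with h5 | h5
          · linarith
          · linarith

end

/-! ### The aided algorithm -/

/-- Computes `N²` in the natural-number cell `3`. -/
def squareProg : Prog := forLoop 8 (nc 1) (.instr (.setNat (.lit 3) (.add (nc 3) (nc 1))))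

/-- Finds a first point of `P` and the scale of the guesses, and puts a first local optimum on the
queue. -/
def startProg : Prog :=
  .seq (.instr (.grad (.lit 5) (.lit 0)))
  (.seq (.instr (.lin (.lit 4) (.lit 0) (.lit 5) (.lit 1) (.lit 0)))
  (.seq (sumLoop (.mul (cv 5) (cv 0)))
  (.seq (.instr (.value (.lit 4) (.lit 0)))
  (.seq (.instr (.value (.lit 16) (.lit 1)))
  (.seq (.instr (.setReal (.lit 3) (.add (rc 16) (rc 5))))
  (.seq (copyVec 12 0)
  (.seq lsProg (pushVec 14))))))))

/-- Running time of `startProg`. -/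
def startTime (n N : ℕ) : ℕ := 3 * coordTime n + 7 + searchTime n N

theorem Run.squareProg {O : Oracle n} {s : State n} {N : ℕ} (h1 : s.nat 1 = N) (h3 : s.nat 3 = 0) :
    Run O WeakDR.squareProg s (N * (1 + 2) + 2) (fun s' =>
      SameExcept {3, 8} ∅ ∅ s s' ∧ s'.nat 3 = N * N) := by
  refine (Run.forLoop (K := N) (T := 1) (fun k s' => SameExcept {3, 8} ∅ ∅ s s' ∧ s'.nat 3 = k * N)
    ⟨(SameExcept.refl _ _ _ s).setNat (by simp) _, by simp [h3]⟩ ?_ ?_).mono le_rfl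
    fun s' h => h.2
  · rintro k hk s' ⟨hs, -⟩ -
    simp [hs.1 1, h1]
  · rintro k hk s' ⟨hs, hk3⟩ hc
    refine Run.instr ⟨by simp [hc], (hs.setNat (by simp) _).setNat (by simp) _, ?_⟩
    simp [hk3, hs.1 1, h1]
    ring

theorem Run.startProg {L : ℝ} {P : Set (Vec n)} {O : Oracle n} (I : IsInstance 1 L P O)
    {N m : ℕ} {h : ℝ} (hh : h ∈ Set.Icc (0 : ℝ) 1) (hN : N * h = 1) {o : Vec n} (ho : o ∈ P)
    (hmax : ∀ y ∈ P, O.value y ≤ O.value o) {s : State n} (h1 : s.nat 1 = N) (h2 : s.nat 2 = m)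
    (h3 : s.nat 3 = N * N) (h5 : s.nat 5 = 0) (h6 : s.nat 6 = 0) (hr2 : s.real 2 = h)
    (hr8 : s.real 8 = 0) (hv : s.vec = fun _ => 0) (τ : ℝ) :
    Run O WeakDR.startProg s (startTime n N) (fun s' => ∃ S : ℝ, O.value o ≤ S ∧
      S ≤ O.value o + L * Metric.diam P ^ 2 ∧ Glob O P N m h S s' ∧ s'.nat 5 = 0 ∧ s'.nat 6 = 1 ∧
      O.value o - L * Metric.diam P ^ 2 ≤ O.value (s'.vec 0) ∧
      LevelInv O P o (h * (O.value o + L * Metric.diam P ^ 2)) τ (2 * O.value o) s') := by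
  have H := I.isSmoothDR
  have hoc := I.subset_cube ho
  have hN0 : 0 < N := Nat.pos_of_ne_zero (by rintro rfl; simp at hN)
  obtain ⟨w, hlin, hw, hwmax⟩ := I.lin_zero (O.grad 0)
  have hwc := I.subset_cube hw
  set S : ℝ := O.value 0 + inner ℝ (O.grad 0) w with hS
  have hS1 : O.value o ≤ S := by
    have h1 := H.le_inner (x := 0) (v := o) zero_mem_cube (by simpa using hoc) (fun i => (hoc i).1)
    rw [zero_add] at h1
    linarith [hwmax o ho]
  have hS2 : S - L * Metric.diam P ^ 2 ≤ O.value w := by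
    have h1 := I.lower_bound (x := 0) (v := w) (c := 1) zero_mem_cube (by simpa using hwc)
      (by simpa using I.norm_le hw)
    rw [zero_add] at h1
    linarith
  refine (Run.instr_seq (T := 1 + (1 + coordTime n + (1 + (1 + (1 + (coordTime n +
    (searchTime n N + (coordTime n + 1)))))))) (Run.instr_seq ?_)).mono
    (by unfold startTime; omega) fun _ h => h
  rw [Instr.step_lin_some (x := w) (h := by simpa [hv] using hlin)]
  simp only [NatExp.eval_lit, Instr.step_grad]
  refine Run.seq (Run.sumLoop (fun i => O.grad 0 i * w i) (fun i r => by simp [hv])) ?_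
  rintro _ rfl
  rw [← inner_eq_sum]
  refine Run.instr_seq (Run.instr_seq (Run.instr_seq ?_))
  set s1 := (Instr.setReal (.lit 3) (.add (rc 16) (rc 5))).step O ((Instr.value (.lit 16)
    (.lit 1)).step O ((Instr.value (.lit 4) (.lit 0)).step O (((((s.setVec 5
    (O.grad (s.vec 0))).setNat 4 1).setVec 0 w).setNat 0 n).setReal 5
    (inner ℝ (O.grad 0) w)))) with hs1
  refine Run.seq (Run.copyVec 12 0) ?_
  rintro _ rfl
  set s2 := (s1.setNat 0 n).setVec 12 (s1.vec 0) with hs2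
  have e12 : s2.vec 12 = w := by simp [hs2, hs1]
  have e0 : s2.vec 0 = w := by simp [hs2, hs1]
  have e11 : s2.vec 11 = 0 := by simp [hs2, hs1, hv]
  have e8 : s2.real 8 = 0 := by simp [hs2, hs1, hr8]
  have e3 : s2.real 3 = S := by simp [hs2, hs1, hS, hv]
  have g2 : Glob O P N m h S s2 := ⟨by simp [hs2, hs1, h1], by simp [hs2, hs1, h2],
    by simp [hs2, hs1, h3], by simp [hs2, hs1, hr2], e3, by simp [hs2, hs1, hv],
    by rw [e0]; exact hw, by rw [e0]; simp [hs2, hs1], by simp [hs2, hs1, h6]⟩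
  have f5 : s2.nat 5 = 0 := by simp [hs2, hs1, h5]
  have f6 : s2.nat 6 = 0 := by simp [hs2, hs1, h6]
  clear_value s2
  refine Run.seq (Run.lsProg I (fun x hx => I.nonneg x (I.subset_cube hx)) hh g2.real2 g2.nat3
    (by rw [e12]; exact hw) (by rw [e8, e11]; simp)) ?_
  rintro s3 ⟨same3, hls⟩
  rw [e8, e11] at hls
  obtain ⟨g3, x3⟩ := g2.of_same same3 (by simp) (by simp) (by simp) (by simp) (fun k => by
    simp; omega)
  have hq := hls.localOpt I hN ho hmax (by simp)
  refine (Run.pushVec (by norm_num)).mono le_rfl ?_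
  rintro _ rfl
  obtain ⟨g4, x4⟩ := g3.push hq.1 n
  have k6 : s3.nat 6 = 0 := by rw [same3.1 6 (by simp), f6]
  rw [k6] at g4 x4 ⊢
  refine ⟨S, hS1, by linarith [hmax w hw], g4, by simp [same3.1 5, f5], by simp, ?_, ?_⟩
  · have := (x3.trans x4).1
    rw [e0] at this
    linarith
  · refine Or.inr ⟨0, by simp [same3.1 5, f5], by simp, ?_⟩
    simp only [State.setNat_vec, State.setVec_vec, if_true]
    refine ⟨hq, ?_⟩
    have h1 := H.psum_add_had_le (I.subset_cube hq.1) hoc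
    have h2 := I.nonneg _ (had_mem_cube (I.subset_cube hq.1) hoc)
    linarith [hmax _ hq.1]

/-- The aided algorithm for the factors `a`, `b` of the numbers of steps and `l` levels. -/
def aidedProg (a b l : ℕ) : Prog :=
  .seq (initProg a b) (.seq squareProg (.seq startProg (forLoop 12 (.lit l) levelProg)))

/-- Running time of the aided algorithm for the step number `a M`. -/
def aidedTime (a l n M : ℕ) : ℕ :=
  (M * 5 + 2) + ((a * M * (1 + 2) + 2) + (startTime n (a * M) +
    (l * ((1 + ((1 + fanout (a * M)) ^ l * (processTime n (a * M) + 1 + 1) + 1)) + 2) + 2)))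

theorem polyBounded_aidedTime (a l : ℕ) : PolyBounded (aidedTime a l) := by
  have hN : PolyBounded fun _ M => a * M := (PolyBounded.const a).mul .right
  have hc : PolyBounded fun n _ => coordTime n := (PolyBounded.left.mul (.const 3)).add (.const 2)
  have hls : PolyBounded fun n M => searchTime n (a * M) :=
    hc.add (((hN.mul hN).mul ((((PolyBounded.const 3).mul hc).add (.const 6)).add (.const 2))).add
      (.const 2))
  have hdg : PolyBounded fun n _ => dgTime n :=
    ((PolyBounded.const 2).add ((PolyBounded.left.mul (.const 5)).add (.const 2))).add
      ((PolyBounded.const 2).mul hc)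
  have hav : PolyBounded fun n _ => avoidTime n := ((PolyBounded.const 3).mul hc).add (.const 3)
  have hre : PolyBounded fun n M => reachTime n (a * M) :=
    (hls.add ((PolyBounded.const 3).mul hc)).add (.const 8)
  have hrp : PolyBounded fun n M => reachProgTime n (a * M) :=
    (((PolyBounded.const 2).mul hc).add (hN.mul (hre.add (.const 2)))).add (.const 7)
  have h2N : PolyBounded fun _ M => 2 * (a * M) + 1 := ((PolyBounded.const 2).mul hN).add (.const 1)
  have hrow : PolyBounded fun n M => guessRowTime n (a * M) :=
    (PolyBounded.const 1).add (((h2N.mul ((hrp.add (.const 1)).add (.const 2))).add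
      (.const 2)).add (.const 1))
  have hgs : PolyBounded fun n M => guessTime n (a * M) :=
    (PolyBounded.const 1).add ((h2N.mul (hrow.add (.const 2))).add (.const 2))
  have hpr : PolyBounded fun n M => processTime n (a * M) :=
    (((((PolyBounded.const 6).mul hc).add (hN.mul (hdg.add (.const 2)))).add
      (hN.mul (hav.add (.const 2)))).add (.const 8)).add hgs
  have hfan : PolyBounded fun _ M => (1 + fanout (a * M)) ^ l :=
    ((PolyBounded.const 1).add (h2N.mul (h2N.mul hN))).pow l
  have hst : PolyBounded fun n M => startTime n (a * M) :=
    (((PolyBounded.const 3).mul hc).add (.const 7)).add hls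
  exact ((PolyBounded.right.mul (.const 5)).add (.const 2)).add
    (((hN.mul (.const (1 + 2))).add (.const 2)).add (hst.add
    (((PolyBounded.const l).mul (((PolyBounded.const 1).add ((hfan.mul ((hpr.add (.const 1)).add
      (.const 1))).add (.const 1))).add (.const 2))).add (.const 2))))

theorem Run.aidedProg {L : ℝ} {P : Set (Vec n)} {O : Oracle n} (I : IsInstance 1 L P O)
    {a b l : ℕ} {α r t ε δ : ℝ} (hδ : 0 < δ)
    (T : Tuned (a * ⌈1 / δ⌉₊) (b * ⌈1 / δ⌉₊) (1 / (a * ⌈1 / δ⌉₊ : ℝ)) α r t ε) (hl : 2 < l * ε)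
    {o : Vec n} (ho : o ∈ P) (hmax : ∀ y ∈ P, O.value y ≤ O.value o) :
    Run O (WeakDR.aidedProg a b l) (State.init n 1 δ) (aidedTime a l n ⌈1 / δ⌉₊) (fun s =>
      s.vec 0 ∈ P ∧ O.value o - L * Metric.diam P ^ 2 ≤ O.value (s.vec 0) ∧
      target (1 / (a * ⌈1 / δ⌉₊ : ℝ)) α t ε (O.value o) (L * Metric.diam P ^ 2) ≤
        O.value (s.vec 0)) := by
  have hoc := I.subset_cube ho
  have hh := T.step_mem
  have hv : 0 ≤ O.value o := I.nonneg _ hoc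
  have he := I.smoothness_nonneg
  set N := a * ⌈1 / δ⌉₊ with hNdef
  set h : ℝ := 1 / (a * ⌈1 / δ⌉₊ : ℝ) with hhdef
  set e := L * Metric.diam P ^ 2 with hedef
  refine Run.seq (Run.initProg hδ a b) ?_
  rintro _ rfl
  refine Run.seq (Run.squareProg (N := N) (by simp [initState, hNdef]) (by simp [initState])) ?_
  rintro s1 ⟨same1, h3⟩
  refine Run.seq (Run.startProg (m := b * ⌈1 / δ⌉₊) I hh T.mul_eq ho hmax
    (by rw [same1.1 1 (by simp)]; simp [initState, hNdef])
    (by rw [same1.1 2 (by simp)]; simp [initState]) h3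
    (by rw [same1.1 5 (by simp)]; simp [initState])
    (by rw [same1.1 6 (by simp)]; simp [initState])
    (by rw [same1.2.1 2 (by simp)]; simp [initState, hhdef])
    (by rw [same1.2.1 8 (by simp)]; simp [initState])
    (funext fun k => by rw [same1.2.2 k (by simp)]; simp [initState])
    (target h α t ε (O.value o) e)) ?_
  rintro s2 ⟨S, hS1, hS2, g2, h5, h6, hbase, hinv⟩
  refine (Run.forLoop (K := l)
    (T := 1 + ((1 + fanout N) ^ l * (processTime n N + 1 + 1) + 1)) (fun k s' =>
    (Glob O P N (b * ⌈1 / δ⌉₊) h S s' ∧ Extends O s2 s') ∧ s'.nat 5 ≤ s'.nat 6 ∧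
    s'.nat 6 ≤ (1 + fanout N) ^ k ∧
    LevelInv O P o (h * (O.value o + e)) (target h α t ε (O.value o) e)
      (2 * O.value o - k * (ε * O.value o)) s') ⟨g2.setNat 12 0 (by simp), ?_, ?_, ?_⟩ ?_ ?_).mono
    le_rfl ?_
  · simp [h5]
  · simp [h6]
  · simpa [LevelInv] using hinv
  · rintro k hk s' - -
    simp
  · rintro k hk s' ⟨hg, hq, ht, hi⟩ hc
    refine (Run.levelProg I T ho hmax hS1 hS2 hg.1 hq ht hi).mono ?_ ?_
    · have : (1 + fanout N) ^ k * (processTime n N + 1 + 1) ≤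
          (1 + fanout N) ^ l * (processTime n N + 1 + 1) :=
        Nat.mul_le_mul_right _ (Nat.pow_le_pow_right (by omega) hk.le)
      omega
    · rintro s'' ⟨h12, hg', hq', ht', hi'⟩
      have x := hg'.1.setNat 12 (k + 1) (by simp)
      refine ⟨by rw [h12, hc], ⟨x.1, (hg.2.trans hg'.2).trans x.2⟩, by simpa using hq', ?_, ?_⟩
      · rw [pow_succ]; simpa using ht'
      · have e1 : 2 * O.value o - k * (ε * O.value o) - ε * O.value o =
            2 * O.value o - ((k + 1 : ℕ) : ℝ) * (ε * O.value o) := by push_cast; ring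
        rw [e1] at hi'
        simpa [LevelInv] using hi'
  · rintro s3 ⟨-, hg, -, -, hi⟩
    refine ⟨hg.1.best_mem, hbase.trans hg.2.1, ?_⟩
    rcases hi with h1 | ⟨i, -, -, hloc, hb⟩
    · exact h1
    · have hnn := I.nonneg _ (psum_mem_cube (I.subset_cube hloc.1) hoc)
      rcases hv.eq_or_lt with h0 | h0
      · have h1 := I.nonneg _ (I.subset_cube hg.1.best_mem)
        have h2 := mul_nonneg hh.1 he
        refine le_trans ?_ h1
        unfold target
        rw [← h0]
        linarith
      · have := mul_lt_mul_of_pos_right hl h0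
        linarith

/-- The aided algorithm, tuned to an almost optimal feasible triple; in addition, its answer is optimal
up to `L D²`. -/
theorem exists_aided {ε : ℝ} (hε : 0 < ε) : ∃ (p : Prog) (f : ℕ → ℕ → ℕ), PolyBounded f ∧
    ∀ δ : ℝ, 0 < δ → δ < 1 → ∀ (n : ℕ) (P : Set (Vec n)) (O : Oracle n) (L : ℝ),
      IsInstance 1 L P O → Run O p (State.init n 1 δ) (f n ⌈1 / δ⌉₊) (fun s => s.vec 0 ∈ P ∧
        ∀ y ∈ P, (Phi 1 - ε) * O.value y - 3 * (δ * Metric.diam P ^ 2 * L) ≤ O.value (s.vec 0) ∧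
          O.value y - Metric.diam P ^ 2 * L ≤ O.value (s.vec 0)) := by
  -- one ninth of the loss for the choice of the triple, five for the discretization and the
  -- threshold, and three for the step length
  have hε9 : 0 < ε / 9 := by positivity
  obtain ⟨⟨α, r, t⟩, ⟨hα, hr, ht, hB, hC⟩, hA⟩ := exists_feasible_near hε9
  simp only at hα hr ht hB hC hA
  obtain ⟨a, b, ha, hba, happ⟩ := exists_disc_approx ht hε9
  have hl : 2 < ((⌊2 / (ε / 9)⌋₊ + 1 : ℕ) : ℝ) * (ε / 9) := by
    push_cast
    rw [← div_lt_iff₀ hε9]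
    exact Nat.lt_floor_add_one _
  refine ⟨aidedProg a b (⌊2 / (ε / 9)⌋₊ + 1), _, polyBounded_aidedTime a (⌊2 / (ε / 9)⌋₊ + 1),
    fun δ hδ hδ1 n P O L I => ?_⟩
  obtain ⟨o, ho, hmax⟩ := I.exists_max
  have hM : 0 < ⌈1 / δ⌉₊ := Nat.ceil_pos.2 (by positivity)
  have ha1 : (1 : ℝ) ≤ a := by exact_mod_cast ha
  have hM0 : (0 : ℝ) < ⌈1 / δ⌉₊ := Nat.cast_pos.2 hM
  have hN : ((a * ⌈1 / δ⌉₊ : ℕ) : ℝ) * (1 / (a * ⌈1 / δ⌉₊ : ℝ)) = 1 := by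
    push_cast
    field_simp
  obtain ⟨h1, h2, h3, h4⟩ := happ _ hM _ hN
  have T : Tuned (a * ⌈1 / δ⌉₊) (b * ⌈1 / δ⌉₊) (1 / (a * ⌈1 / δ⌉₊ : ℝ)) α r t (ε / 9) :=
    ⟨hN, Nat.mul_le_mul_right _ hba, hε9.le, hα, hr, hB, hC, h2, h3, h4⟩
  refine (Run.aidedProg I hδ T hl ho hmax).mono le_rfl ?_
  rintro s ⟨hs, hbase, htar⟩
  have hv := I.nonneg _ (I.subset_cube ho)
  have he := I.smoothness_nonneg
  have hstep : 1 / (a * ⌈1 / δ⌉₊ : ℝ) ≤ δ := by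
    have h5 := (div_le_iff₀ hδ).1 (Nat.le_ceil (1 / δ))
    rw [div_le_iff₀ (by positivity)]
    nlinarith
  refine ⟨hs, fun y hy => ⟨?_, by linarith [hmax y hy]⟩⟩
  have e1 : δ * Metric.diam P ^ 2 * L = δ * (L * Metric.diam P ^ 2) := by ring
  rw [e1]
  have hy0 := I.nonneg _ (I.subset_cube hy)
  have hbest := I.nonneg _ (I.subset_cube hs)
  have h6 : 0 ≤ δ * (L * Metric.diam P ^ 2) := mul_nonneg hδ.le he
  rcases le_total 0 (Phi 1 - ε) with h0 | h0
  · refine le_trans ?_ htar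
    unfold target
    have h7 := mul_le_mul_of_nonneg_left (hmax y hy) h0
    have h8 := mul_le_mul_of_nonneg_right hA hv
    have h9 := mul_le_mul_of_nonneg_right h1 hv
    have h10 := mul_le_mul_of_nonneg_right hstep he
    linarith
  · have := mul_nonpos_of_nonpos_of_nonneg h0 hy0
    linarith

/-! ### The approximation guarantees -/

theorem Run.returns {O : Oracle n} {p : Prog} {γ δ : ℝ} {T : ℕ} {Q : State n → Prop}
    (h : Run O p (State.init n γ δ) T Q) {T' : ℝ} (hT : (T : ℝ) ≤ T') :
    ∃ s : State n, Q s ∧ Returns O p γ δ T' (s.vec 0) := by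
  obtain ⟨s, t, he, ht, hq⟩ := h
  exact ⟨s, hq, s, t, he, (Nat.cast_le.2 ht).trans hT, rfl⟩

theorem IsInstance.smoothness_nonneg' {γ L : ℝ} {P : Set (Vec n)} {O : Oracle n}
    (I : IsInstance γ L P O) : 0 ≤ Metric.diam P ^ 2 * L := by
  rw [mul_comm]; exact I.smoothness_nonneg

/-- Continuous greedy achieves the factor `Φ_γ` for `γ < 1`. -/
theorem exists_greedy {γ : ℝ} (h0 : 0 < γ) (h1 : γ < 1) : ∃ (p : Prog) (K : ℕ),
    ∀ δ : ℝ, 0 < δ → δ < 1 → ∀ (n : ℕ) (P : Set (Vec n)) (O : Oracle n) (L : ℝ),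
      IsInstance γ L P O → ∃ x ∈ P, Returns O p γ δ (K * ((n : ℝ) + 1 / δ) ^ K) x ∧
        ∀ y ∈ P, Phi γ * O.value y - 1 * (δ * Metric.diam P ^ 2 * L) ≤ O.value x := by
  have hf : PolyBounded fun n M => M * 5 + 2 + (M * (2 + coordTime n + 2) + 2) :=
    ((PolyBounded.right.mul (.const 5)).add (.const 2)).add
      ((PolyBounded.right.mul (((PolyBounded.const 2).add ((PolyBounded.left.mul (.const 3)).add
        (.const 2))).add (.const 2))).add (.const 2))
  obtain ⟨K, hK⟩ := hf.exists_real_bound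
  refine ⟨greedyProg, K, fun δ hδ hδ1 n P O L I => ?_⟩
  obtain ⟨s, ⟨hs, hv⟩, hr⟩ := (Run.greedyProg I h0 h1 hδ).returns (hK δ hδ hδ1 n)
  exact ⟨_, hs, hr, hv⟩

/-- The guarantee for every fixed loss `ε` in the factor, with time polynomial in `n` and
`1 / δ`. -/
theorem exists_approximation {γ : ℝ} (h0 : 0 < γ) (h1 : γ ≤ 1) {ε : ℝ} (hε : 0 < ε) :
    ∃ (p : Prog) (K : ℕ), ∀ δ : ℝ, 0 < δ → δ < 1 →
      ∀ (n : ℕ) (P : Set (Vec n)) (O : Oracle n) (L : ℝ), IsInstance γ L P O →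
        ∃ x ∈ P, Returns O p γ δ (K * ((n : ℝ) + 1 / δ) ^ K) x ∧
          ∀ y ∈ P, (Phi γ - ε) * O.value y - 5 * (δ * Metric.diam P ^ 2 * L) ≤ O.value x := by
  rcases h1.eq_or_lt with rfl | h1
  · obtain ⟨p, f, hf, hp⟩ := exists_aided hε
    obtain ⟨K, hK⟩ := hf.exists_real_bound
    refine ⟨p, K, fun δ hδ hδ1 n P O L I => ?_⟩
    obtain ⟨s, ⟨hs, hv⟩, hr⟩ := (hp δ hδ hδ1 n P O L I).returns (hK δ hδ hδ1 n)
    refine ⟨_, hs, hr, fun y hy => ?_⟩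
    have := mul_nonneg hδ.le I.smoothness_nonneg'
    linarith [(hv y hy).1]
  · obtain ⟨p, K, hp⟩ := exists_greedy h0 h1
    refine ⟨p, K, fun δ hδ hδ1 n P O L I => ?_⟩
    obtain ⟨x, hx, hr, hv⟩ := hp δ hδ hδ1 n P O L I
    refine ⟨x, hx, hr, fun y hy => ?_⟩
    have h2 := mul_nonneg hδ.le I.smoothness_nonneg'
    have h3 := mul_nonneg hε.le (I.nonneg _ (I.subset_cube hy))
    linarith [hv y hy]

/-- The guarantee without loss in the factor, for fixed `δ`. For `γ = 1` the loss `ε = δ` in the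
factor is absorbed in the additive error: the first point that the algorithm finds is optimal up to
`L D²`, so that it is good enough unless the optimal value is at most `2 L D²`. -/
theorem exists_exact_approximation {γ : ℝ} (h0 : 0 < γ) (h1 : γ ≤ 1) {δ : ℝ} (hδ : 0 < δ)
    (hδ1 : δ < 1) : ∃ (p : Prog) (K : ℕ),
      ∀ (n : ℕ) (P : Set (Vec n)) (O : Oracle n) (L : ℝ), IsInstance γ L P O →
        ∃ x ∈ P, Returns O p γ δ (K * ((n : ℝ) + 1) ^ K) x ∧
          ∀ y ∈ P, Phi γ * O.value y - 5 * (δ * Metric.diam P ^ 2 * L) ≤ O.value x := by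
  rcases h1.eq_or_lt with rfl | h1
  · obtain ⟨p, f, hf, hp⟩ := exists_aided hδ
    obtain ⟨K, hK⟩ := hf.exists_real_bound
    obtain ⟨K', hK'⟩ := exists_bound_of_fixed (K := K) hδ hδ1
    refine ⟨p, K', fun n P O L I => ?_⟩
    obtain ⟨s, ⟨hs, hv⟩, hr⟩ := (hp δ hδ hδ1 n P O L I).returns ((hK δ hδ hδ1 n).trans (hK' n))
    refine ⟨_, hs, hr, fun y hy => ?_⟩
    obtain ⟨hv1, hv2⟩ := hv y hy
    have h2 := mul_nonneg hδ.le I.smoothness_nonneg'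
    rcases le_total (O.value y) (2 * (Metric.diam P ^ 2 * L)) with h3 | h3
    · have := mul_le_mul_of_nonneg_left h3 hδ.le
      linarith
    · have := mul_le_mul_of_nonneg_right Phi_one_lt.le (I.nonneg _ (I.subset_cube hy))
      linarith [I.nonneg _ (I.subset_cube hy)]
  · obtain ⟨p, K, hp⟩ := exists_greedy h0 h1
    obtain ⟨K', hK'⟩ := exists_bound_of_fixed (K := K) hδ hδ1
    refine ⟨p, K', fun n P O L I => ?_⟩
    obtain ⟨x, hx, ⟨s, t, he, ht, hsx⟩, hv⟩ := hp δ hδ hδ1 n P O L I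
    refine ⟨x, hx, ⟨s, t, he, ht.trans (hK' n), hsx⟩, fun y hy => ?_⟩
    have h2 := mul_nonneg hδ.le I.smoothness_nonneg'
    linarith [hv y hy]

end WeakDR

end

theorem mainTheorem1 :
    (∀ γ : ℝ, 0 < γ → γ ≤ 1 → ∃ C : ℝ, 0 < C ∧
      (∀ δ : ℝ, 0 < δ → δ < 1 → ∃ (p : WeakDR.Prog) (K : ℕ),
        ∀ (n : ℕ) (P : Set (WeakDR.Vec n)) (O : WeakDR.Oracle n) (L : ℝ),
          WeakDR.IsInstance γ L P O →
          ∃ x ∈ P, WeakDR.Returns O p γ δ (K * ((n : ℝ) + 1) ^ K) x ∧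
            ∀ y ∈ P, WeakDR.Phi γ * O.value y - C * (δ * Metric.diam P ^ 2 * L) ≤ O.value x) ∧
      (∀ ε : ℝ, 0 < ε → ∃ (p : WeakDR.Prog) (K : ℕ),
        ∀ δ : ℝ, 0 < δ → δ < 1 →
        ∀ (n : ℕ) (P : Set (WeakDR.Vec n)) (O : WeakDR.Oracle n) (L : ℝ),
          WeakDR.IsInstance γ L P O →
          ∃ x ∈ P, WeakDR.Returns O p γ δ (K * ((n : ℝ) + 1 / δ) ^ K) x ∧
            ∀ y ∈ P,
              (WeakDR.Phi γ - ε) * O.value y - C * (δ * Metric.diam P ^ 2 * L) ≤ O.value x)) ∧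
    (∀ γ : ℝ, 0 < γ → γ < 1 → γ * Real.exp (-γ) < WeakDR.Phi γ) ∧
    0.401 ≤ WeakDR.Phi 1 ∧ WeakDR.Phi 1 < 0.402 :=
  ⟨fun _ h0 h1 => ⟨5, by norm_num, fun _ hδ hδ1 => WeakDR.exists_exact_approximation h0 h1 hδ hδ1,
    fun _ hε => WeakDR.exists_approximation h0 h1 hε⟩,
    fun _ h0 h1 => WeakDR.lt_Phi_of_lt_one h0 h1, WeakDR.le_Phi_one, WeakDR.Phi_one_lt⟩
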